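/- **Theorem.** There are a universal constant $K>0$, a polynomial $p$ with coefficients in $\mathbb{N}$, and a deterministic algorithm with the following properties. Let $1\le n\le m$ be integers and let $A\in[-1,1]^{m\times n}$ be a real matrix. On input $(m,n,A)$ the algorithm halts and outputs a vector $x\in\{\pm1\}^n$ such that $$\|Ax\|_\infty\;\le\; K\sqrt{n\log\!\left(\frac{2m}{n}\right)},$$ where $\log$ is the natural logarithm and $\|y\|_\infty=\max_{i\le m}|y_i|$. The algorithm runs in polynomial time: (a) it is a single program, independent of $m,n,A$, for a random access machine over the real numbers with integer constants, whose elementary steps are the operations $+,-,\times,/$ and comparisons on real numbers, and additions, subtractions and comparisons on natural-number index registers; on every such input it performs at most $p(m+n)$ elementary steps; (b) if, moreover, all entries of $A$ are rational numbers of at most $b$ bits (numerator and denominator in lowest terms together), then all real numbers written during the computation are rational numbers of at most $p(m+n+b)$ bits, so that the algorithm also runs in polynomial time in the usual bit model. -/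

import Mathlib

/-!
A structured random access machine over the real numbers. It has registers `N 0, N 1, …` for
natural numbers (counters and indices) and two-dimensional arrays `X 0, X 1, …` of real numbers.
Its elementary operations are

* on counters: loading a constant, addition, truncated subtraction, comparison;
* on reals: loading an integer constant, `+`, `-`, `*`, `/`, comparison.

A program is a fixed finite object which does not depend on the input. There is no access to
randomness and there are no rounding, root or transcendental operations. Counters cannot be
multiplied, so after `t` steps their binary length is at most the initial length plus `O(t)`.
-/

namespace RealRAM

/-- The elementary arithmetic operations on real numbers. -/
inductive Op
  | add | sub | mul | div

/-- The value of an operation (division by zero returns zero, a case a program can test for). -/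
noncomputable def Op.eval : Op → ℝ → ℝ → ℝ
  | .add, x, y => x + y
  | .sub, x, y => x - y
  | .mul, x, y => x * y
  | .div, x, y => x / y

/-- The memory of the machine: the contents `nat a` of the counters `N a`, and the entries
`real a i j` of the arrays `X a`. -/
structure State where
  nat : ℕ → ℕ
  real : ℕ → ℕ → ℕ → ℝ

/-- A reference to an array cell: the cell `X arr [N row, N col]`. The array is fixed by the
program, the indices are read from counters. -/
structure Cell where
  arr : ℕ
  row : ℕ
  col : ℕ

/-- The number stored in a cell. -/
def State.get (s : State) (x : Cell) : ℝ := s.real x.arr (s.nat x.row) (s.nat x.col)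

/-- Store `v` in the cell `x`. -/
def State.set (s : State) (x : Cell) (v : ℝ) : State where
  nat := s.nat
  real := fun a i j =>
    if a = x.arr ∧ i = s.nat x.row ∧ j = s.nat x.col then v else s.real a i j

/-- Store `v` in the counter `a`. -/
def State.setNat (s : State) (a v : ℕ) : State where
  nat := Function.update s.nat a v
  real := s.real

/-- The elementary tests: strict comparison of two counters or of two array cells. -/
inductive Test
  | natLt (a b : ℕ)
  | realLt (x y : Cell)

/-- The test is passed in state `s`. -/
def Test.Holds : Test → State → Prop
  | .natLt a b, s => s.nat a < s.nat b
  | .realLt x y, s => s.get x < s.get y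

/-- Programs. -/
inductive Prog
  | skip
  /-- `N a := k` -/
  | natConst (a k : ℕ)
  /-- `N a := N b + N c` -/
  | natAdd (a b c : ℕ)
  /-- `N a := N b - N c` (truncated at zero) -/
  | natSub (a b c : ℕ)
  /-- `x := k` -/
  | const (x : Cell) (k : ℤ)
  /-- `x := y o z` -/
  | arith (o : Op) (x y z : Cell)
  | seq (c d : Prog)
  | ite (b : Test) (c d : Prog)
  | while (b : Test) (c : Prog)

/-- `Run V c s t s'`: the program `c`, started in the state `s`, halts in the state `s'` after
exactly `t` elementary steps (assignments, arithmetic operations and tests cost one step each),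
and every real number that it writes during the computation lies in the set `V`. -/
inductive Run (V : Set ℝ) : Prog → State → ℕ → State → Prop
  | skip (s : State) : Run V .skip s 0 s
  | natConst (s : State) (a k : ℕ) : Run V (.natConst a k) s 1 (s.setNat a k)
  | natAdd (s : State) (a b c : ℕ) :
      Run V (.natAdd a b c) s 1 (s.setNat a (s.nat b + s.nat c))
  | natSub (s : State) (a b c : ℕ) :
      Run V (.natSub a b c) s 1 (s.setNat a (s.nat b - s.nat c))
  | const (s : State) (x : Cell) (k : ℤ) (hk : (k : ℝ) ∈ V) :
      Run V (.const x k) s 1 (s.set x (k : ℝ))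
  | arith (s : State) (o : Op) (x y z : Cell) (h : o.eval (s.get y) (s.get z) ∈ V) :
      Run V (.arith o x y z) s 1 (s.set x (o.eval (s.get y) (s.get z)))
  | seq {c d : Prog} {s s' s'' : State} {t t' : ℕ}
      (hc : Run V c s t s') (hd : Run V d s' t' s'') : Run V (.seq c d) s (t + t') s''
  | iteTrue {b : Test} {c d : Prog} {s s' : State} {t : ℕ}
      (hb : b.Holds s) (hc : Run V c s t s') : Run V (.ite b c d) s (t + 1) s'
  | iteFalse {b : Test} {c d : Prog} {s s' : State} {t : ℕ}
      (hb : ¬ b.Holds s) (hd : Run V d s t s') : Run V (.ite b c d) s (t + 1) s'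
  | whileTrue {b : Test} {c : Prog} {s s' s'' : State} {t t' : ℕ}
      (hb : b.Holds s) (hc : Run V c s t s') (hw : Run V (.while b c) s' t' s'') :
      Run V (.while b c) s (t + t' + 1) s''
  | whileFalse {b : Test} {c : Prog} {s : State}
      (hb : ¬ b.Holds s) : Run V (.while b c) s 1 s

/-- The initial state on input `A`: the counters `N 0` and `N 1` hold the dimensions, the array
`X 0` holds the matrix, and everything else is zero. -/
def input {m n : ℕ} (A : Matrix (Fin m) (Fin n) ℝ) : State where
  nat := fun a => if a = 0 then m else if a = 1 then n else 0
  real := fun a i j => if h : a = 0 ∧ i < m ∧ j < n then A ⟨i, h.2.1⟩ ⟨j, h.2.2⟩ else 0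

/-- The vector of length `n` that is read off as the output: the first `n` entries of the first
row of the array `X 1`. -/
def output (n : ℕ) (s : State) : Fin n → ℝ := fun j => s.real 1 0 j

/-- The rational numbers whose numerator and denominator (in lowest terms) have together at most
`b` binary digits. -/
def ratOfBitSize (b : ℕ) : Set ℝ :=
  {x | ∃ q : ℚ, (q : ℝ) = x ∧ q.num.natAbs.size + q.den.size ≤ b}

/-- The program `c` on input `A` halts with output `x`, in time bounded by the polynomial `p`:

* the number of elementary steps is at most `p (m + n)`;
* if the entries of `A` are rationals of at most `b` bits, then all numbers written
  during the computation are rationals of at most `p (m + n + b)` bits. Thus, on rational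
  inputs, polynomially many bit operations suffice. -/
def ComputesInTime (c : Prog) (p : Polynomial ℕ) {m n : ℕ} (A : Matrix (Fin m) (Fin n) ℝ)
    (x : Fin n → ℝ) : Prop :=
  ∃ (t : ℕ) (s : State), Run Set.univ c (input A) t s ∧ output n s = x ∧
    t ≤ p.eval (m + n) ∧
    ∀ b : ℕ, (∀ i j, A i j ∈ ratOfBitSize b) →
      Run (ratOfBitSize (p.eval (m + n + b))) c (input A) t s

end RealRAM

/-! ### Runs of the machine and integer expressions -/

namespace RealRAM

/-! The signs come from a deterministic walk. The matrix is rounded to an integer matrix b close to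
nA, and an integer point x starts at 0 in the box |x_j| ≤ D = 64n^5. A coordinate is alive while
|x_j| < D - L, where L = 32n^4. Each step adds ±y, with y an integer vector of entries at most L
supported on the living coordinates. Once fewer than 16 coordinates live, the signs of x are taken;
this changes each row of b by at most 16n.

A phase begins with k living coordinates and ends when at most k/2 are left. Let ℓ be of order
log(4m/k), ρ of order √(k/ℓ) and at least 1, M = nDρ, and let s_i be the displacement of row i
during the phase. The potential is Σ φ(s_i), with φ(s) = β^s + β^(-s) and β = 1 + 1/M. Since φ(s+d)
+ φ(s-d) = φ(s)φ(d) and φ(d) ≤ 2(1 + d²/M²), the better sign increases the potential by a small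
factor. The direction is nearly orthogonal to x, so the energy ‖x‖² grows by at least ‖y‖²/2, and
its weighted quadratic form is at most 26n²‖y‖² times the sum of the weights
(`rounded_direction_bounds`). Hence the logarithm of the potential is paid for by energy. A phase
gains at most kD² of it, so the potential stays below 2m·exp(52ℓ), while a heavy row, |s_i| ≥ 80ℓM,
contributes at least 2^(80ℓ). Thus at most k/16 rows are heavy, which leaves room to choose y nearly
orthogonal to them as well. A heavy row then moves only by an amount paid for by energy, and a light
row exceeds the threshold by at most one step (`WalkInv.step`). If ℓ ≤ k, every displacement is of
order ℓM, that is nD√(k log(4m/k)); if ℓ > k, a trivial bound is good enough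
(`WalkInv.row_le_phaseBound`). The phase bounds decrease geometrically (`phaseBound_half`), so their
sum is of the order of the first.

A good direction exists by averaging the quadratic form over an orthonormal basis of the admissible
subspace. It is found by integer power iteration from every living coordinate vector, one of which
must succeed (`exists_good_direction`), and is then scaled and rounded down.

The algorithm is written in a total language of integer expressions with bounded sums, products and
loops. Compilation is proved correct once (`Com.run_compile`), with time and size bounds by
structural recursion (`mainCom_grows`). Floors are obtained by counting, powers as products with
conditional factors. Entries of A are only compared with quotients of integers and never copied, so
the numbers written have size polynomial in m + n even for real A. -/

theorem Run.mono {V V' : Set ℝ} (h : V ⊆ V') {c : Prog} {s s' : State} {t : ℕ}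
    (hr : Run V c s t s') : Run V' c s t s' := by
  induction hr with
  | skip s => exact .skip s
  | natConst s a k => exact .natConst s a k
  | natAdd s a b c => exact .natAdd s a b c
  | natSub s a b c => exact .natSub s a b c
  | const s x k hk => exact .const s x k (h hk)
  | arith s o x y z hk => exact .arith s o x y z (h hk)
  | seq _ _ h1 h2 => exact .seq h1 h2
  | iteTrue hb _ h1 => exact .iteTrue hb h1
  | iteFalse hb _ h1 => exact .iteFalse hb h1
  | whileTrue hb _ _ h1 h2 => exact .whileTrue hb h1 h2
  | whileFalse hb => exact .whileFalse hb

/-! ### Sizes of written numbers -/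

theorem ratOfBitSize_mono {a b : ℕ} (h : a ≤ b) : ratOfBitSize a ⊆ ratOfBitSize b := by
  rintro x ⟨q, hq, hs⟩
  exact ⟨q, hq, hs.trans h⟩

theorem intCast_mem_ratOfBitSize {P : ℕ} {z : ℤ} (h : |z| < 2 ^ P) :
    (z : ℝ) ∈ ratOfBitSize (2 * P + 1) := by
  refine ⟨z, by simp, ?_⟩
  have h1 : z.natAbs < 2 ^ P := by zify; simpa using h
  have h2 : z.natAbs.size ≤ P := Nat.size_le.2 h1
  simp only [Rat.num_intCast, Rat.den_intCast, Nat.size_one]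
  omega

theorem div_mem_ratOfBitSize {P : ℕ} {a b : ℤ} (ha : |a| < 2 ^ P) (hb : |b| < 2 ^ P) :
    ((a : ℝ) / b) ∈ ratOfBitSize (2 * P + 1) := by
  refine ⟨(a : ℚ) / b, by simp, ?_⟩
  have ha1 : a.natAbs < 2 ^ P := by zify; simpa using ha
  have hb1 : b.natAbs < 2 ^ P := by zify; simpa using hb
  -- Division by zero gives 0, of size one; otherwise reduction to lowest terms only shrinks
  -- numerator and denominator.
  by_cases hb0 : b = 0
  · subst hb0
    simp
  have hn : ((a : ℚ) / b).num.natAbs ≤ a.natAbs := by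
    by_cases ha0 : a = 0
    · subst ha0; simp
    · exact Nat.le_of_dvd (Int.natAbs_pos.2 ha0)
        (Int.natAbs_dvd_natAbs.2 (by
          have := Rat.num_dvd a hb0
          rwa [Rat.divInt_eq_div] at this))
  have hd : ((a : ℚ) / b).den ≤ b.natAbs := by
    have := Rat.den_dvd a b
    rw [Rat.divInt_eq_div] at this
    exact Nat.le_of_dvd (Int.natAbs_pos.2 hb0)
      (by simpa using Int.natAbs_dvd_natAbs.2 this)
  have h1 : ((a : ℚ) / b).num.natAbs.size ≤ P := Nat.size_le.2 (hn.trans_lt ha1)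
  have h2 : ((a : ℚ) / b).den.size ≤ P := Nat.size_le.2 (hd.trans_lt hb1)
  omega

/-! ### Elementary facts about states -/

@[simp] theorem State.set_nat (s : State) (x : Cell) (v : ℝ) : (s.set x v).nat = s.nat := rfl

@[simp] theorem State.setNat_real (s : State) (a v : ℕ) : (s.setNat a v).real = s.real := rfl

@[simp] theorem State.setNat_nat_self (s : State) (a v : ℕ) : (s.setNat a v).nat a = v := by
  simp [State.setNat]

theorem State.setNat_nat_of_ne (s : State) {a b : ℕ} (v : ℕ) (h : b ≠ a) :
    (s.setNat a v).nat b = s.nat b := by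
  simp [State.setNat, h]

theorem State.set_real_of_ne (s : State) (x : Cell) (v : ℝ) {a : ℕ} (h : a ≠ x.arr) :
    (s.set x v).real a = s.real a := by
  funext i j
  simp [State.set, h]

/-- The loop `for N v := 0 to N b - 1`; the counter `N 3` is assumed to hold `1`. -/
def forLoop (v b : ℕ) (body : Prog) : Prog :=
  .seq (.natConst v 0) (.while (.natLt v b) (.seq body (.natAdd v v 3)))

/-- The invariant is imposed after the counter has been updated. The increment adds counter 3, so
the body must restore the counter `v` and leave 1 in counter 3. Each round costs the body, the
increment and a test; initialization and the last test give the final 2. -/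
theorem Run.forLoop {V : Set ℝ} {v b : ℕ} {body : Prog} (n T : ℕ)
    (I : ℕ → State → Prop) (s : State) (h0 : I 0 (s.setNat v 0))
    (hb : ∀ i s, I i s → s.nat b = n)
    (hstep : ∀ i < n, ∀ s, I i s → s.nat v = i → ∃ k s', Run V body s k s' ∧ k ≤ T ∧
      s'.nat v = i ∧ s'.nat 3 = 1 ∧ I (i + 1) (s'.setNat v (i + 1))) :
    ∃ k s', Run V (forLoop v b body) s k s' ∧ k ≤ n * (T + 2) + 2 ∧ s'.nat v = n ∧ I n s' := by
  have key : ∀ d i s, i + d = n → I i s → s.nat v = i →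
      ∃ k s', Run V (.while (.natLt v b) (.seq body (.natAdd v v 3))) s k s' ∧
        k ≤ d * (T + 2) + 1 ∧ s'.nat v = n ∧ I n s' := by
    intro d
    induction d with
    | zero =>
      intro i s hi hI hv
      have hi : i = n := by omega
      subst hi
      exact ⟨1, s, .whileFalse (by simp [Test.Holds, hv, hb _ _ hI]), by omega, hv, hI⟩
    | succ d ih =>
      intro i s hi hI hv
      obtain ⟨k, s', hr, hk, hv', h3, hI'⟩ := hstep i (by omega) s hI hv
      have hn := Run.natAdd (V := V) s' v v 3
      rw [hv', h3] at hn
      obtain ⟨k2, s2, hr2, hk2, hv2, hI2⟩ := ih (i + 1) _ (by omega) hI' (by simp)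
      refine ⟨_, s2, .whileTrue ?_ (.seq hr hn) hr2, ?_, hv2, hI2⟩
      · simp only [Test.Holds, hv, hb _ _ hI]; omega
      · have : (d + 1) * (T + 2) = d * (T + 2) + (T + 2) := by ring
        omega
  obtain ⟨k, s', hr, hk, hv, hI⟩ := key n 0 (s.setNat v 0) (by omega) h0 (by simp)
  exact ⟨_, s', .seq (.natConst s v 0) hr, by omega, hv, hI⟩

/-- Copy `src` to the different cell `dst`. -/
def move (dst src : Cell) : Prog := .seq (.const dst 0) (.arith .add dst dst src)

/-- Copying means clearing and then adding. The two arrays must differ, since otherwise clearing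
might destroy the source, and 0 must be a permitted value. -/
theorem Run.move {V : Set ℝ} (s : State) (dst src : Cell) (hne : src.arr ≠ dst.arr)
    (h0 : (0 : ℝ) ∈ V) (h : s.get src ∈ V) :
    Run V (move dst src) s 2 (s.set dst (s.get src)) := by
  have h1 : Run V (.const dst 0) s 1 (s.set dst ((0 : ℤ) : ℝ)) := .const s dst 0 (by simpa using h0)
  have e1 : (s.set dst ((0 : ℤ) : ℝ)).get dst = 0 := by simp [State.get, State.set]
  have e2 : (s.set dst ((0 : ℤ) : ℝ)).get src = s.get src := by
    simp [State.get, State.set, hne]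
  have h2 := Run.arith (V := V) (s.set dst ((0 : ℤ) : ℝ)) .add dst dst src
    (by rw [e1, e2]; simpa [Op.eval] using h)
  have e3 : (s.set dst ((0 : ℤ) : ℝ)).set dst
      (Op.eval .add ((s.set dst ((0 : ℤ) : ℝ)).get dst) ((s.set dst ((0 : ℤ) : ℝ)).get src)) =
      s.set dst (s.get src) := by
    rw [e1, e2]
    simp only [State.set, Op.eval, zero_add, State.mk.injEq, true_and]
    funext a i j
    split_ifs <;> rfl
  rw [e3] at h2
  exact .seq h1 h2

/-! ### A total language over the integers -/

inductive BinOp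
  | add | sub | mul

def BinOp.toOp : BinOp → Op
  | .add => .add
  | .sub => .sub
  | .mul => .mul

def BinOp.eval : BinOp → ℤ → ℤ → ℤ
  | .add, x, y => x + y
  | .sub, x, y => x - y
  | .mul, x, y => x * y

theorem BinOp.toOp_eval (o : BinOp) (x y : ℤ) : o.toOp.eval x y = ((o.eval x y : ℤ) : ℝ) := by
  cases o <;> simp [BinOp.toOp, BinOp.eval, Op.eval]

/-- Integer expressions. Variables are numbered by nesting depth: at depth `l` the variables
below `l` are in scope, and `sum` and `prod` bind the variable `l`. -/
inductive Expr
  | const (k : ℤ)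
  | cell (a i j : ℕ)
  | bin (o : BinOp) (e f : Expr)
  | ite (e f g h : Expr)
  | iteInput (e f : Expr) (i j : ℕ) (g h : Expr)
  | sum (b : ℕ) (e : Expr)
  | prod (b : ℕ) (e : Expr)

abbrev Mem := ℕ → ℕ → ℕ → ℤ

open Classical in
/-- The value of an expression at depth `l`, for an input `A`, the array contents `M` and the
values `v` of the variables. -/
noncomputable def Expr.eval (A : ℕ → ℕ → ℝ) (M : Mem) : Expr → ℕ → (ℕ → ℕ) → ℤ
  | .const k, _, _ => k
  | .cell a i j, _, v => M a (v i) (v j)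
  | .bin o e f, l, v => o.eval (e.eval A M l v) (f.eval A M l v)
  | .ite e f g h, l, v =>
      if e.eval A M l v < f.eval A M l v then g.eval A M l v else h.eval A M l v
  | .iteInput e f i j g h, l, v =>
      if (e.eval A M l v : ℝ) / (f.eval A M l v : ℝ) < A (v i) (v j)
        then g.eval A M l v else h.eval A M l v
  | .sum b e, l, v => ∑ i ∈ Finset.range (v b), e.eval A M (l + 1) (Function.update v l i)
  | .prod b e, l, v => ∏ i ∈ Finset.range (v b), e.eval A M (l + 1) (Function.update v l i)

/-- All variables are in scope, and the arrays are numbered from `1` to `99`. -/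
def Expr.wf : Expr → ℕ → Bool
  | .const _, _ => true
  | .cell a i j, l => decide (0 < a) && decide (a < 100) && decide (i < l) && decide (j < l)
  | .bin _ e f, l => e.wf l && f.wf l
  | .ite e f g h, l => e.wf l && f.wf l && g.wf l && h.wf l
  | .iteInput e f i j g h, l =>
      e.wf l && f.wf l && decide (i < l) && decide (j < l) && g.wf l && h.wf l
  | .sum b e, l => decide (b < l) && e.wf (l + 1)
  | .prod b e, l => decide (b < l) && e.wf (l + 1)

/-- The scalar `X t [0, 0]`; the counter `N 2` is assumed to hold `0`. -/
def scalar (t : ℕ) : Cell := ⟨t, 2, 2⟩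

/-- Code that puts the value of the expression into `scalar t`, using the scalars above `t`. -/
def Expr.compile : Expr → ℕ → ℕ → Prog
  | .const k, _, t => .const (scalar t) k
  | .cell a i j, _, t => move (scalar t) ⟨a, i, j⟩
  | .bin o e f, l, t =>
      .seq (e.compile l t) (.seq (f.compile l (t + 1))
        (.arith o.toOp (scalar t) (scalar t) (scalar (t + 1))))
  | .ite e f g h, l, t =>
      .seq (e.compile l t) (.seq (f.compile l (t + 1))
        (.ite (.realLt (scalar t) (scalar (t + 1))) (g.compile l t) (h.compile l t)))
  | .iteInput e f i j g h, l, t =>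
      .seq (e.compile l t) (.seq (f.compile l (t + 1))
        (.seq (.arith .div (scalar t) (scalar t) (scalar (t + 1)))
          (.ite (.realLt (scalar t) ⟨0, i, j⟩) (g.compile l t) (h.compile l t))))
  | .sum b e, l, t =>
      .seq (.const (scalar t) 0) (forLoop l b (.seq (e.compile (l + 1) (t + 1))
        (.arith .add (scalar t) (scalar t) (scalar (t + 1)))))
  | .prod b e, l, t =>
      .seq (.const (scalar t) 1) (forLoop l b (.seq (e.compile (l + 1) (t + 1))
        (.arith .mul (scalar t) (scalar t) (scalar (t + 1)))))

/-- A bound for the running time, in terms of a bound for the variables. -/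
noncomputable def Expr.cost : Expr → Polynomial ℕ
  | .const _ => 1
  | .cell _ _ _ => 2
  | .bin _ e f => e.cost + f.cost + 1
  | .ite e f g h => e.cost + f.cost + g.cost + h.cost + 1
  | .iteInput e f _ _ g h => e.cost + f.cost + g.cost + h.cost + 2
  | .sum _ e => Polynomial.X * (e.cost + 3) + 3
  | .prod _ e => Polynomial.X * (e.cost + 3) + 3

/-- A bound for the bit size of the value, in terms of bounds `γ` for the arrays and `Q` for the
variables. -/
def Expr.valueBits (γ : ℕ → ℕ) (Q : ℕ) : Expr → ℕ
  | .const k => k.natAbs.size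
  | .cell a _ _ => γ a
  | .bin .mul e f => e.valueBits γ Q + f.valueBits γ Q
  | .bin _ e f => max (e.valueBits γ Q) (f.valueBits γ Q) + 1
  | .ite _ _ g h => max (g.valueBits γ Q) (h.valueBits γ Q)
  | .iteInput _ _ _ _ g h => max (g.valueBits γ Q) (h.valueBits γ Q)
  | .sum _ e => Q + e.valueBits γ Q
  | .prod _ e => Q * e.valueBits γ Q + 1

/-- A bound for the bit sizes of all intermediate values. -/
def Expr.maxBits (γ : ℕ → ℕ) (Q : ℕ) : Expr → ℕ
  | .const k => k.natAbs.size
  | .cell a _ _ => γ a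
  | .bin o e f => e.maxBits γ Q + f.maxBits γ Q + (Expr.bin o e f).valueBits γ Q
  | .ite e f g h => e.maxBits γ Q + f.maxBits γ Q + g.maxBits γ Q + h.maxBits γ Q
  | .iteInput e f _ _ g h => e.maxBits γ Q + f.maxBits γ Q + g.maxBits γ Q + h.maxBits γ Q
  | .sum _ e => e.maxBits γ Q + (Q + e.valueBits γ Q)
  | .prod _ e => e.maxBits γ Q + (Q * e.valueBits γ Q + 1)

/-- The array entries have at most the given bit sizes. -/
def BoundedBy (γ : ℕ → ℕ) (M : Mem) : Prop := ∀ a i j, |M a i j| < 2 ^ γ a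

theorem abs_lt_two_pow_add {a b : ℤ} {p q : ℕ} (ha : |a| < 2 ^ p) (hb : |b| < 2 ^ q) :
    |a| + |b| < 2 ^ (max p q + 1) := by
  have h1 : (2 : ℤ) ^ p ≤ 2 ^ max p q := pow_le_pow_right₀ (by norm_num) (by omega)
  have h2 : (2 : ℤ) ^ q ≤ 2 ^ max p q := pow_le_pow_right₀ (by norm_num) (by omega)
  rw [pow_succ]; linarith

theorem abs_sum_lt_two_pow {p Q T : ℕ} (hT : T ≤ Q) (f : ℕ → ℤ)
    (h : ∀ i < T, |f i| < 2 ^ p) : |∑ i ∈ Finset.range T, f i| < 2 ^ (Q + p) := by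
  have h1 : |∑ i ∈ Finset.range T, f i| ≤ ∑ i ∈ Finset.range T, (2 : ℤ) ^ p :=
    (Finset.abs_sum_le_sum_abs _ _).trans
      (Finset.sum_le_sum fun i hi => (h i (Finset.mem_range.1 hi)).le)
  -- Charging Q bits for the number of summands is wasteful, but it avoids logarithms and keeps the
  -- bound polynomial.
  have h2 : (T : ℤ) < 2 ^ Q := by exact_mod_cast hT.trans_lt Nat.lt_two_pow_self
  rw [Finset.sum_const, Finset.card_range, nsmul_eq_mul] at h1
  rw [pow_add]
  exact h1.trans_lt (mul_lt_mul_of_pos_right h2 (by positivity))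

theorem abs_prod_lt_two_pow {p Q T : ℕ} (hT : T ≤ Q) (f : ℕ → ℤ)
    (h : ∀ i < T, |f i| < 2 ^ p) : |∏ i ∈ Finset.range T, f i| < 2 ^ (Q * p + 1) := by
  have h1 : |∏ i ∈ Finset.range T, f i| ≤ ∏ i ∈ Finset.range T, (2 : ℤ) ^ p := by
    rw [Finset.abs_prod]
    exact Finset.prod_le_prod (fun i _ => abs_nonneg _)
      (fun i hi => (h i (Finset.mem_range.1 hi)).le)
  rw [Finset.prod_const, Finset.card_range, ← pow_mul] at h1
  refine h1.trans_lt (pow_lt_pow_right₀ (by norm_num) ?_)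
  have : p * T ≤ Q * p := by rw [mul_comm]; exact Nat.mul_le_mul_right _ hT
  omega

theorem Int.abs_lt_two_pow_size (k : ℤ) : |k| < 2 ^ k.natAbs.size := by
  have := Nat.lt_size_self k.natAbs
  zify at this
  simpa using this

theorem Expr.abs_eval_lt (A : ℕ → ℕ → ℝ) (M : Mem) {γ : ℕ → ℕ} (hM : BoundedBy γ M) (Q : ℕ)
    (e : Expr) : ∀ (l : ℕ) (v : ℕ → ℕ), e.wf l → (∀ i < l, v i ≤ Q) →
      |e.eval A M l v| < 2 ^ e.valueBits γ Q := by
  have mono : ∀ (z : ℤ) (p q : ℕ), p ≤ q → |z| < 2 ^ p → |z| < 2 ^ q := fun z p q h hz =>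
    hz.trans_le (pow_le_pow_right₀ (by norm_num) h)
  have upd : ∀ (l : ℕ) (v : ℕ → ℕ) (b i : ℕ), (∀ i < l, v i ≤ Q) → b < l → i < v b →
      ∀ j < l + 1, Function.update v l i j ≤ Q := by
    intro l v b i hv hb hi j hj
    by_cases h : j = l
    · subst h; simpa using hi.le.trans (hv _ hb)
    · simpa [h] using hv j (by omega)
  induction e with
  | const k => intro l v _ _; exact Int.abs_lt_two_pow_size k
  | cell a i j => intro l v _ _; exact hM _ _ _
  | bin o e f ihe ihf =>
    intro l v hw hv
    simp only [Expr.wf, Bool.and_eq_true] at hw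
    have h1 := ihe l v hw.1 hv
    have h2 := ihf l v hw.2 hv
    cases o with
    | add => exact (abs_add_le _ _).trans_lt (abs_lt_two_pow_add h1 h2)
    | sub => exact (abs_sub _ _).trans_lt (abs_lt_two_pow_add h1 h2)
    | mul =>
      simp only [Expr.eval, BinOp.eval, Expr.valueBits]
      rw [abs_mul, pow_add]
      exact mul_lt_mul'' h1 h2 (abs_nonneg _) (abs_nonneg _)
  | ite e f g h _ _ ihg ihh =>
    intro l v hw hv
    simp only [Expr.wf, Bool.and_eq_true] at hw
    simp only [Expr.eval, Expr.valueBits]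
    split_ifs
    · exact mono _ _ _ (by omega) (ihg l v hw.1.2 hv)
    · exact mono _ _ _ (by omega) (ihh l v hw.2 hv)
  | iteInput e f i j g h _ _ ihg ihh =>
    intro l v hw hv
    simp only [Expr.wf, Bool.and_eq_true] at hw
    simp only [Expr.eval, Expr.valueBits]
    split_ifs
    · exact mono _ _ _ (by omega) (ihg l v hw.1.2 hv)
    · exact mono _ _ _ (by omega) (ihh l v hw.2 hv)
  | sum b e ih =>
    intro l v hw hv
    simp only [Expr.wf, Bool.and_eq_true, decide_eq_true_eq] at hw
    exact abs_sum_lt_two_pow (hv b hw.1) _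
      fun i hi => ih (l + 1) _ hw.2 (upd l v b i hv hw.1 hi)
  | prod b e ih =>
    intro l v hw hv
    simp only [Expr.wf, Bool.and_eq_true, decide_eq_true_eq] at hw
    exact abs_prod_lt_two_pow (hv b hw.1) _
      fun i hi => ih (l + 1) _ hw.2 (upd l v b i hv hw.1 hi)

theorem Expr.valueBits_le_maxBits (γ : ℕ → ℕ) (Q : ℕ) (e : Expr) :
    e.valueBits γ Q ≤ e.maxBits γ Q := by
  induction e with
  | const k => exact le_rfl
  | cell a i j => exact le_rfl
  | bin o e f _ _ => simp only [Expr.maxBits]; omega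
  | ite e f g h _ _ _ _ => simp only [Expr.maxBits, Expr.valueBits]; omega
  | iteInput e f _ _ g h _ _ _ _ => simp only [Expr.maxBits, Expr.valueBits]; omega
  | sum b e _ => simp only [Expr.maxBits, Expr.valueBits]; omega
  | prod b e _ => simp only [Expr.maxBits, Expr.valueBits]; omega

/-- The state `s` represents the input `A`, the arrays `M`, and the variables `v` below `l`. -/
structure Represents (A : ℕ → ℕ → ℝ) (M : Mem) (l : ℕ) (v : ℕ → ℕ) (s : State) : Prop where
  nat : ∀ i < l, s.nat i = v i
  input : s.real 0 = A
  real : ∀ a, 0 < a → a < 100 → ∀ i j, s.real a i j = M a i j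

theorem Represents.congr {A : ℕ → ℕ → ℝ} {M : Mem} {l : ℕ} {v : ℕ → ℕ} {s s' : State}
    (h : Represents A M l v s) (h1 : ∀ i < l, s'.nat i = s.nat i)
    (h2 : ∀ a < 100, s'.real a = s.real a) : Represents A M l v s' where
  nat i hi := (h1 i hi).trans (h.nat i hi)
  input := (h2 0 (by norm_num)).trans h.input
  real a h0 ha i j := by rw [h2 a ha]; exact h.real a h0 ha i j

/-- The constant counters have their values, and `Q` bounds all variables. -/
structure GoodVars (Q l : ℕ) (v : ℕ → ℕ) : Prop where
  le : 4 ≤ l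
  zero : v 2 = 0
  one : v 3 = 1
  bound : ∀ i < l, v i ≤ Q

theorem GoodVars.update {Q l : ℕ} {v : ℕ → ℕ} (h : GoodVars Q l v) {b i : ℕ} (hb : b < l)
    (hi : i < v b) : GoodVars Q (l + 1) (Function.update v l i) where
  le := h.le.trans (Nat.le_succ l)
  zero := by rw [Function.update_of_ne (by have := h.le; omega)]; exact h.zero
  one := by rw [Function.update_of_ne (by have := h.le; omega)]; exact h.one
  bound j hj := by
    by_cases e : j = l
    · subst e; simpa using hi.le.trans (h.bound _ hb)
    · simpa [e] using h.bound j (by omega)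

theorem Represents.update {A : ℕ → ℕ → ℝ} {M : Mem} {l : ℕ} {v : ℕ → ℕ} {s : State} {i : ℕ}
    (h : Represents A M l v s) (hi : s.nat l = i) :
    Represents A M (l + 1) (Function.update v l i) s where
  nat j hj := by
    by_cases e : j = l
    · subst e; simpa using hi
    · simpa [e] using h.nat j (by omega)
  input := h.input
  real := h.real

theorem Represents.get_scalar {A : ℕ → ℕ → ℝ} {M : Mem} {l Q : ℕ} {v : ℕ → ℕ} {s : State}
    (h : Represents A M l v s) (hv : GoodVars Q l v) (t : ℕ) :
    s.get (scalar t) = s.real t 0 0 := by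
  have h2 : s.nat 2 = 0 := (h.nat 2 (by have := hv.le; omega)).trans hv.zero
  simp [State.get, scalar, h2]

theorem Represents.set_scalar {A : ℕ → ℕ → ℝ} {M : Mem} {l Q : ℕ} {v : ℕ → ℕ} {s : State}
    (h : Represents A M l v s) (hv : GoodVars Q l v) (t : ℕ) (x : ℝ) :
    (s.set (scalar t) x).real t 0 0 = x := by
  have h2 : s.nat 2 = 0 := (h.nat 2 (by have := hv.le; omega)).trans hv.zero
  simp [State.set, scalar, h2]

/-- The set of numbers that are written by compiled code. -/
abbrev Written (P : ℕ) : Set ℝ := ratOfBitSize (2 * P + 1)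

theorem mem_written {P p : ℕ} {z : ℤ} (h : |z| < 2 ^ p) (hp : p ≤ P) : (z : ℝ) ∈ Written P :=
  intCast_mem_ratOfBitSize (h.trans_le (pow_le_pow_right₀ (by norm_num) hp))

theorem zero_mem_written (P : ℕ) : (0 : ℝ) ∈ Written P := by
  simpa using mem_written (P := P) (z := 0) (p := P) (by simp) le_rfl

/-- The conclusion of the correctness theorem for compiled expressions. -/
def Expr.Computes (P : ℕ) (A : ℕ → ℕ → ℝ) (M : Mem) (e : Expr) (l t : ℕ) (v : ℕ → ℕ) (T : ℕ)
    (s : State) : Prop :=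
  ∃ k s', Run (Written P) (e.compile l t) s k s' ∧ k ≤ T ∧ s'.real t 0 0 = e.eval A M l v ∧
    (∀ i < l, s'.nat i = s.nat i) ∧ ∀ a < t, s'.real a = s.real a

/-- Structural induction. A first operand in scalar t survives the evaluation of the second, which
writes only to scalars from t + 1 on. Binders use counters from l on, so variables in scope keep
their values. `100 < t` separates scratch space from the arrays of the program and the buffer. -/
theorem Expr.run_compile (A : ℕ → ℕ → ℝ) (M : Mem) {γ : ℕ → ℕ} (hM : BoundedBy γ M) (Q P : ℕ)
    (e : Expr) : ∀ (l t : ℕ) (v : ℕ → ℕ) (s : State), e.wf l → GoodVars Q l v →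
      Represents A M l v s → 100 < t → e.maxBits γ Q ≤ P →
      e.Computes P A M l t v (e.cost.eval Q) s := by
  have set2 : ∀ (s : State) (t : ℕ) (x : ℝ), ∀ a < t, (s.set (scalar t) x).real a = s.real a :=
    fun s t x a ha => State.set_real_of_ne _ _ _ (by simp [scalar]; omega)
  -- Sums and products are the same loop with different operations. `acc` lists the partial results;
  -- each is written to memory and needs its own size bound.
  have loop : ∀ (o : BinOp) (f : ℤ → ℤ → ℤ) (hf : ∀ x y : ℤ, o.toOp.eval x y = (f x y : ℤ))
      (c : ℤ) (acc : ℕ → ℤ) (e : Expr) (b l t : ℕ) (v : ℕ → ℕ) (s : State)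
      (_ : acc 0 = c)
      (_ : ∀ i, acc (i + 1) = f (acc i) (e.eval A M (l + 1) (Function.update v l i)))
      (_ : ∀ i ≤ v b, (acc i : ℝ) ∈ Written P)
      (_ : ∀ i < v b, ∀ s, Represents A M (l + 1) (Function.update v l i) s →
        e.Computes P A M (l + 1) (t + 1) (Function.update v l i) (e.cost.eval Q) s)
      (_ : b < l) (_ : GoodVars Q l v) (_ : Represents A M l v s) (_ : 100 < t),
      ∃ k s', Run (Written P) (.seq (.const (scalar t) c) (forLoop l b
          (.seq (e.compile (l + 1) (t + 1))
            (.arith o.toOp (scalar t) (scalar t) (scalar (t + 1)))))) s k s' ∧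
        k ≤ Q * (e.cost.eval Q + 3) + 3 ∧ s'.real t 0 0 = acc (v b) ∧
        (∀ i < l, s'.nat i = s.nat i) ∧ ∀ a < t, s'.real a = s.real a := by
    intro o f hf c acc e b l t v s hacc0 hacc hmem ih hb hv hs ht
    have hl := hv.le
    have hc : Run (Written P) (.const (scalar t) c) s 1 (s.set (scalar t) (c : ℝ)) :=
      .const s _ c (by rw [← hacc0]; exact hmem 0 (Nat.zero_le _))
    obtain ⟨k, s', hr, hk, -, h1, h2, h3⟩ := Run.forLoop (V := Written P) (v := l) (b := b)
      (body := .seq (e.compile (l + 1) (t + 1))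
            (.arith o.toOp (scalar t) (scalar t) (scalar (t + 1)))) (v b)
      (e.cost.eval Q + 1)
      (fun i s' => s'.real t 0 0 = acc i ∧ (∀ i < l, s'.nat i = s.nat i) ∧
        ∀ a < t, s'.real a = s.real a) (s.set (scalar t) (c : ℝ))
      ⟨by rw [State.setNat_real, hs.set_scalar hv, hacc0],
        fun i hi => by rw [State.setNat_nat_of_ne _ _ (by omega)]; rfl,
        fun a ha => by rw [State.setNat_real]; exact set2 _ _ _ a ha⟩
      (fun i s' hI => (hI.2.1 b hb).trans (hs.nat b hb))
      (by
        rintro i hi s1 ⟨h1, h2, h3⟩ hi1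
        have hs1 : Represents A M l v s1 := hs.congr h2 fun a ha => h3 a (by omega)
        have hs1' := hs1.update hi1
        obtain ⟨k, s2, hr, hk, hv2, hn2, ha2⟩ := ih i hi s1 hs1'
        have hs2 : Represents A M l v s2 := hs1.congr (fun j hj => hn2 j (by omega))
          fun a ha => ha2 a (by omega)
        have e1 : o.toOp.eval (s2.get (scalar t)) (s2.get (scalar (t + 1))) = acc (i + 1) := by
          rw [hs2.get_scalar hv, hs2.get_scalar hv, hv2, ha2 t (by omega), h1, hf, hacc]
        have hr2 := Run.arith (V := Written P) s2 o.toOp (scalar t) (scalar t) (scalar (t + 1))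
          (by rw [e1]; exact hmem (i + 1) hi)
        rw [e1] at hr2
        refine ⟨_, _, .seq hr hr2, by omega, ?_, ?_, ?_, ?_, ?_⟩
        · rw [State.set_nat, hn2 l (by omega), hi1]
        · rw [State.set_nat, hs2.nat 3 (by omega), hv.one]
        · rw [State.setNat_real, hs2.set_scalar hv]
        · intro j hj
          rw [State.setNat_nat_of_ne _ _ (by omega), State.set_nat, hn2 j (by omega), h2 j hj]
        · intro a ha
          rw [State.setNat_real, set2 _ _ _ a ha, ha2 a (by omega), h3 a ha])
    refine ⟨_, s', .seq hc hr, ?_, h1, h2, h3⟩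
    have : v b * (e.cost.eval Q + 1 + 2) ≤ Q * (e.cost.eval Q + 3) :=
      Nat.mul_le_mul (hv.bound b hb) le_rfl
    omega
  induction e with
  | const k =>
    intro l t v s _ hv hs ht hP
    refine ⟨1, _, .const s _ k (mem_written (Int.abs_lt_two_pow_size k) hP), ?_,
      hs.set_scalar hv t _, fun _ _ => rfl, set2 _ _ _⟩
    simp [Expr.cost]
  | cell a i j =>
    intro l t v s hw hv hs ht hP
    simp only [Expr.wf, Bool.and_eq_true, decide_eq_true_eq] at hw
    have e1 : s.get ⟨a, i, j⟩ = M a (v i) (v j) := by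
      simp only [State.get]
      rw [hs.nat i hw.1.2, hs.nat j hw.2, hs.real a hw.1.1.1 hw.1.1.2]
    refine ⟨2, _, Run.move s (scalar t) ⟨a, i, j⟩ (by simp [scalar]; omega)
      (zero_mem_written P) (by rw [e1]; exact mem_written (hM _ _ _) hP), ?_,
      ?_, fun _ _ => rfl, set2 _ _ _⟩
    · simp [Expr.cost]
    · rw [hs.set_scalar hv, e1]; rfl
  | bin o e f ihe ihf =>
    intro l t v s hw hv hs ht hP
    have hb := Expr.abs_eval_lt A M hM Q (.bin o e f) l v hw hv.bound
    simp only [Expr.wf, Bool.and_eq_true] at hw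
    simp only [Expr.maxBits] at hP
    obtain ⟨k1, s1, hr1, hk1, hv1, hn1, ha1⟩ := ihe l t v s hw.1 hv hs ht (by omega)
    have hs1 := hs.congr hn1 fun a ha => ha1 a (by omega)
    obtain ⟨k2, s2, hr2, hk2, hv2, hn2, ha2⟩ := ihf l (t + 1) v s1 hw.2 hv hs1 (by omega) (by omega)
    have hs2 := hs1.congr hn2 fun a ha => ha2 a (by omega)
    have e1 : o.toOp.eval (s2.get (scalar t)) (s2.get (scalar (t + 1))) =
        (Expr.bin o e f).eval A M l v := by
      rw [hs2.get_scalar hv, hs2.get_scalar hv, hv2, ha2 t (by omega), hv1, BinOp.toOp_eval]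
      rfl
    have hr := Run.arith (V := Written P) s2 o.toOp (scalar t) (scalar t) (scalar (t + 1))
      (by rw [e1]; exact mem_written hb (by omega))
    refine ⟨_, _, .seq hr1 (.seq hr2 hr), ?_, ?_, ?_, ?_⟩
    · simp only [Expr.cost, Polynomial.eval_add, Polynomial.eval_one]; omega
    · rw [hs2.set_scalar hv, e1]
    · intro i hi; rw [State.set_nat, hn2 i hi, hn1 i hi]
    · intro a ha; rw [set2 _ _ _ a ha, ha2 a (by omega), ha1 a ha]
  | ite e f g h ihe ihf ihg ihh =>
    intro l t v s hw hv hs ht hP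
    simp only [Expr.wf, Bool.and_eq_true] at hw
    simp only [Expr.maxBits] at hP
    obtain ⟨⟨⟨hwe, hwf⟩, hwg⟩, hwh⟩ := hw
    obtain ⟨k1, s1, hr1, hk1, hv1, hn1, ha1⟩ := ihe l t v s hwe hv hs ht (by omega)
    have hs1 := hs.congr hn1 fun a ha => ha1 a (by omega)
    obtain ⟨k2, s2, hr2, hk2, hv2, hn2, ha2⟩ := ihf l (t + 1) v s1 hwf hv hs1 (by omega) (by omega)
    have hs2 := hs1.congr hn2 fun a ha => ha2 a (by omega)
    have e1 : s2.get (scalar t) = e.eval A M l v := by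
      rw [hs2.get_scalar hv, ha2 t (by omega), hv1]
    have e2 : s2.get (scalar (t + 1)) = f.eval A M l v := by
      rw [hs2.get_scalar hv, hv2]
    by_cases hc : e.eval A M l v < f.eval A M l v
    · obtain ⟨k3, s3, hr3, hk3, hv3, hn3, ha3⟩ := ihg l t v s2 hwg hv hs2 ht (by omega)
      refine ⟨_, _, .seq hr1 (.seq hr2 (.iteTrue ?_ hr3)), ?_, ?_, ?_, ?_⟩
      · simp only [Test.Holds, e1, e2]; exact_mod_cast hc
      · simp only [Expr.cost, Polynomial.eval_add, Polynomial.eval_one]; omega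
      · simp only [Expr.eval, if_pos hc, hv3]
      · intro i hi; rw [hn3 i hi, hn2 i hi, hn1 i hi]
      · intro a ha; rw [ha3 a ha, ha2 a (by omega), ha1 a ha]
    · obtain ⟨k3, s3, hr3, hk3, hv3, hn3, ha3⟩ := ihh l t v s2 hwh hv hs2 ht (by omega)
      refine ⟨_, _, .seq hr1 (.seq hr2 (.iteFalse ?_ hr3)), ?_, ?_, ?_, ?_⟩
      · simp only [Test.Holds, e1, e2]; exact_mod_cast hc
      · simp only [Expr.cost, Polynomial.eval_add, Polynomial.eval_one]; omega
      · simp only [Expr.eval, if_neg hc, hv3]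
      · intro i hi; rw [hn3 i hi, hn2 i hi, hn1 i hi]
      · intro a ha; rw [ha3 a ha, ha2 a (by omega), ha1 a ha]
  | iteInput e f i j g h ihe ihf ihg ihh =>
    intro l t v s hw hv hs ht hP
    simp only [Expr.wf, Bool.and_eq_true, decide_eq_true_eq] at hw
    simp only [Expr.maxBits] at hP
    obtain ⟨⟨⟨⟨⟨hwe, hwf⟩, hi⟩, hj⟩, hwg⟩, hwh⟩ := hw
    have be := Expr.abs_eval_lt A M hM Q e l v hwe hv.bound
    have bf := Expr.abs_eval_lt A M hM Q f l v hwf hv.bound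
    have me := e.valueBits_le_maxBits γ Q
    have mf := f.valueBits_le_maxBits γ Q
    obtain ⟨k1, s1, hr1, hk1, hv1, hn1, ha1⟩ := ihe l t v s hwe hv hs ht (by omega)
    have hs1 := hs.congr hn1 fun a ha => ha1 a (by omega)
    obtain ⟨k2, s2, hr2, hk2, hv2, hn2, ha2⟩ := ihf l (t + 1) v s1 hwf hv hs1 (by omega) (by omega)
    have hs2 := hs1.congr hn2 fun a ha => ha2 a (by omega)
    have e1 : Op.eval .div (s2.get (scalar t)) (s2.get (scalar (t + 1))) =
        (e.eval A M l v : ℝ) / (f.eval A M l v : ℝ) := by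
      rw [hs2.get_scalar hv, hs2.get_scalar hv, hv2, ha2 t (by omega), hv1]; rfl
    have hr := Run.arith (V := Written P) s2 .div (scalar t) (scalar t) (scalar (t + 1))
      (by
        rw [e1]
        exact div_mem_ratOfBitSize (be.trans_le (pow_le_pow_right₀ (by norm_num) (by omega)))
          (bf.trans_le (pow_le_pow_right₀ (by norm_num) (by omega))))
    rw [e1] at hr
    set s3 := s2.set (scalar t) ((e.eval A M l v : ℝ) / (f.eval A M l v : ℝ)) with hs3def
    have hs3 : Represents A M l v s3 := hs2.congr (fun _ _ => rfl)
      fun a ha => set2 _ _ _ a (by omega)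
    have e2 : s3.get (scalar t) = (e.eval A M l v : ℝ) / (f.eval A M l v : ℝ) := by
      rw [hs3.get_scalar hv, hs2.set_scalar hv]
    have e3 : s3.get ⟨0, i, j⟩ = A (v i) (v j) := by
      simp only [State.get]; rw [hs3.nat i hi, hs3.nat j hj, hs3.input]
    have a3 : ∀ a < t, s3.real a = s.real a := fun a ha => by
      rw [hs3def, set2 _ _ _ a ha, ha2 a (by omega), ha1 a ha]
    have n3 : ∀ i < l, s3.nat i = s.nat i := fun i hi => by
      rw [hs3def, State.set_nat, hn2 i hi, hn1 i hi]
    by_cases hc : (e.eval A M l v : ℝ) / (f.eval A M l v : ℝ) < A (v i) (v j)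
    · obtain ⟨k4, s4, hr4, hk4, hv4, hn4, ha4⟩ := ihg l t v s3 hwg hv hs3 ht (by omega)
      refine ⟨_, _, .seq hr1 (.seq hr2 (.seq hr (.iteTrue ?_ hr4))), ?_, ?_, ?_, ?_⟩
      · simp only [Test.Holds, e2, e3]; exact hc
      · simp only [Expr.cost, Polynomial.eval_add, Polynomial.eval_ofNat]; omega
      · simp only [Expr.eval, if_pos hc, hv4]
      · intro i hi; rw [hn4 i hi, n3 i hi]
      · intro a ha; rw [ha4 a ha, a3 a ha]
    · obtain ⟨k4, s4, hr4, hk4, hv4, hn4, ha4⟩ := ihh l t v s3 hwh hv hs3 ht (by omega)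
      refine ⟨_, _, .seq hr1 (.seq hr2 (.seq hr (.iteFalse ?_ hr4))), ?_, ?_, ?_, ?_⟩
      · simp only [Test.Holds, e2, e3]; exact hc
      · simp only [Expr.cost, Polynomial.eval_add, Polynomial.eval_ofNat]; omega
      · simp only [Expr.eval, if_neg hc, hv4]
      · intro i hi; rw [hn4 i hi, n3 i hi]
      · intro a ha; rw [ha4 a ha, a3 a ha]
  | sum b e ih =>
    intro l t v s hw hv hs ht hP
    simp only [Expr.wf, Bool.and_eq_true, decide_eq_true_eq] at hw
    simp only [Expr.maxBits] at hP
    obtain ⟨k, s', h1, h2, h3⟩ := loop .add (· + ·) (fun x y => BinOp.toOp_eval .add x y) 0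
      (fun T => ∑ i ∈ Finset.range T, e.eval A M (l + 1) (Function.update v l i)) e b l t v s
      (by simp) (fun i => Finset.sum_range_succ _ _)
      (fun T hT => mem_written (abs_sum_lt_two_pow (hT.trans (hv.bound b hw.1)) _ fun i hi =>
          Expr.abs_eval_lt A M hM Q e (l + 1) _ hw.2 (hv.update hw.1 (hi.trans_le hT)).bound)
        (by omega))
      (fun i hi s hs => ih (l + 1) (t + 1) _ s hw.2 (hv.update hw.1 hi) hs (by omega) (by omega))
      hw.1 hv hs ht
    exact ⟨k, s', h1, by simpa [Expr.cost] using h2, h3⟩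
  | prod b e ih =>
    intro l t v s hw hv hs ht hP
    simp only [Expr.wf, Bool.and_eq_true, decide_eq_true_eq] at hw
    simp only [Expr.maxBits] at hP
    obtain ⟨k, s', h1, h2, h3⟩ := loop .mul (· * ·) (fun x y => BinOp.toOp_eval .mul x y) 1
      (fun T => ∏ i ∈ Finset.range T, e.eval A M (l + 1) (Function.update v l i)) e b l t v s
      (by simp) (fun i => Finset.prod_range_succ _ _)
      (fun T hT => mem_written (abs_prod_lt_two_pow (hT.trans (hv.bound b hw.1)) _ fun i hi =>
          Expr.abs_eval_lt A M hM Q e (l + 1) _ hw.2 (hv.update hw.1 (hi.trans_le hT)).bound)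
        (by omega))
      (fun i hi s hs => ih (l + 1) (t + 1) _ s hw.2 (hv.update hw.1 hi) hs (by omega) (by omega))
      hw.1 hv hs ht
    exact ⟨k, s', h1, by simpa [Expr.cost] using h2, h3⟩

end RealRAM

/-! ### Total array programs and their compilation -/

namespace RealRAM

/-- Total programs: simultaneous assignment to the upper left `p × q` block of an array (the indices
are the variables `l` and `l + 1`), sequence, and bounded repetition (the counter is the variable
`l`). -/
inductive Com
  | assign (a p q : ℕ) (e : Expr)
  | seq (c d : Com)
  | rep (b : ℕ) (c : Com)

/-- Replace the upper left `p × q` block of the array `a`. -/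
def Mem.assign (M : Mem) (a p q : ℕ) (f : ℕ → ℕ → ℤ) : Mem :=
  fun a' i j => if a' = a ∧ i < p ∧ j < q then f i j else M a' i j

noncomputable def Com.exec (A : ℕ → ℕ → ℝ) : Com → ℕ → (ℕ → ℕ) → Mem → Mem
  | .assign a p q e, l, v, M => M.assign a (v p) (v q) fun i j =>
      e.eval A M (l + 2) (Function.update (Function.update v l i) (l + 1) j)
  | .seq c d, l, v, M => d.exec A l v (c.exec A l v M)
  | .rep b c, l, v, M =>
      Nat.rec M (fun i M' => c.exec A (l + 1) (Function.update v l i) M') (v b)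

def Com.wf : Com → ℕ → Bool
  | .assign a p q e, l =>
      decide (0 < a) && decide (a < 100) && decide (p < l) && decide (q < l) && e.wf (l + 2)
  | .seq c d, l => c.wf l && d.wf l
  | .rep b c, l => decide (b < l) && c.wf (l + 1)

/-- Code for a program at depth `l`; the array `X 100` is used as a buffer. -/
def Com.compile : Com → ℕ → Prog
  | .assign a p q e, l =>
      .seq
        (forLoop l p (forLoop (l + 1) q
          (.seq (e.compile (l + 2) 101) (move ⟨100, l, l + 1⟩ (scalar 101)))))
        (forLoop l p (forLoop (l + 1) q (move ⟨a, l, l + 1⟩ ⟨100, l, l + 1⟩)))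
  | .seq c d, l => .seq (c.compile l) (d.compile l)
  | .rep b c, l => forLoop l b (c.compile (l + 1))

noncomputable def Com.cost : Com → Polynomial ℕ
  | .assign _ _ _ e =>
      Polynomial.X * (Polynomial.X * (e.cost + 4) + 4) + 2 + (Polynomial.X * (Polynomial.X * 4 + 4) + 2)
  | .seq c d => c.cost + d.cost
  | .rep _ c => Polynomial.X * (c.cost + 2) + 2

/-- A bound for the bit sizes of all values in expressions, if the arrays are bounded by `Γ`. -/
def Com.maxBits (Γ : ℕ → ℕ) (Q : ℕ) : Com → ℕ
  | .assign _ _ _ e => e.maxBits Γ Q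
  | .seq c d => c.maxBits Γ Q + d.maxBits Γ Q
  | .rep _ c => c.maxBits Γ Q

/-- The program turns arrays bounded by `γ` into arrays bounded by `γ'`, never exceeding `Γ`. -/
inductive Com.Grows (Q : ℕ) (Γ : ℕ → ℕ) : Com → (ℕ → ℕ) → (ℕ → ℕ) → Prop
  | assign {a p q : ℕ} {e : Expr} {γ γ' : ℕ → ℕ} (h : γ ≤ γ') (ha : e.valueBits γ Q ≤ γ' a)
      (hΓ : γ ≤ Γ) : Grows Q Γ (.assign a p q e) γ γ'
  | seq {c d : Com} {γ γ' γ'' : ℕ → ℕ} (hc : Grows Q Γ c γ γ') (hd : Grows Q Γ d γ' γ'') :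
      Grows Q Γ (.seq c d) γ γ''
  | rep {b : ℕ} {c : Com} {γ' : ℕ → ℕ} (g : ℕ → ℕ → ℕ) (h : ∀ i < Q, Grows Q Γ c (g i) (g (i + 1)))
      (h' : ∀ i ≤ Q, g i ≤ γ') : Grows Q Γ (.rep b c) (g 0) γ'

theorem BoundedBy.mono {γ γ' : ℕ → ℕ} {M : Mem} (h : BoundedBy γ M) (hle : γ ≤ γ') :
    BoundedBy γ' M := fun a i j =>
  (h a i j).trans_le (pow_le_pow_right₀ (by norm_num) (hle a))

theorem Expr.valueBits_mono {γ γ' : ℕ → ℕ} (h : γ ≤ γ') (Q : ℕ) (e : Expr) :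
    e.valueBits γ Q ≤ e.valueBits γ' Q := by
  induction e with
  | const k => exact le_rfl
  | cell a i j => exact h a
  | bin o e f he hf => cases o <;> simp only [Expr.valueBits] <;> omega
  | ite e f g h _ _ hg hh => simp only [Expr.valueBits]; omega
  | iteInput e f _ _ g h _ _ hg hh => simp only [Expr.valueBits]; omega
  | sum b e he => simp only [Expr.valueBits]; omega
  | prod b e he =>
    simp only [Expr.valueBits]
    exact Nat.succ_le_succ (Nat.mul_le_mul le_rfl he)

theorem Expr.maxBits_mono {γ γ' : ℕ → ℕ} (h : γ ≤ γ') (Q : ℕ) (e : Expr) :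
    e.maxBits γ Q ≤ e.maxBits γ' Q := by
  induction e with
  | const k => exact le_rfl
  | cell a i j => exact h a
  | bin o e f he hf =>
    have := Expr.valueBits_mono h Q (.bin o e f)
    simp only [Expr.maxBits]; omega
  | ite e f g h _ _ hg hh => simp only [Expr.maxBits]; omega
  | iteInput e f _ _ g h _ _ hg hh => simp only [Expr.maxBits]; omega
  | sum b e he =>
    have := Expr.valueBits_mono h Q e
    simp only [Expr.maxBits]; omega
  | prod b e he =>
    have := Nat.mul_le_mul (le_refl Q) (Expr.valueBits_mono h Q e)
    simp only [Expr.maxBits]; omega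

/-- A double loop that processes the cells of a `p × q` block one after the other. -/
theorem Run.forLoop₂ {V : Set ℝ} {Q l p q : ℕ} {v : ℕ → ℕ} {body : Prog}
    (T : ℕ) (hv : GoodVars Q l v) (hp : p < l) (hq : q < l)
    (I : ℕ → ℕ → State → Prop) (hI : ∀ i j s s', I i j s → s'.real = s.real → I i j s')
    (hrow : ∀ i s, I i (v q) s → I (i + 1) 0 s)
    (hbody : ∀ i < v p, ∀ j < v q, ∀ s, I i j s → (∀ i < l, s.nat i = v i) →
      s.nat l = i → s.nat (l + 1) = j →
      ∃ k s', Run V body s k s' ∧ k ≤ T ∧ (∀ i < l + 2, s'.nat i = s.nat i) ∧ I i (j + 1) s')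
    (s : State) (hs : ∀ i < l, s.nat i = v i) (h0 : I 0 0 s) :
    ∃ k s', Run V (RealRAM.forLoop l p (RealRAM.forLoop (l + 1) q body)) s k s' ∧
      k ≤ Q * (Q * (T + 2) + 4) + 2 ∧ (∀ i < l, s'.nat i = v i) ∧ I (v p) 0 s' := by
  have hl := hv.le
  obtain ⟨k, s', hr, hk, -, h1, h2⟩ := Run.forLoop (V := V) (v := l) (b := p)
    (body := RealRAM.forLoop (l + 1) q body) (v p) (v q * (T + 2) + 2)
    (fun i s => I i 0 s ∧ ∀ i < l, s.nat i = v i) s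
    ⟨hI _ _ _ _ h0 rfl, fun i hi => by rw [State.setNat_nat_of_ne _ _ (by omega)]; exact hs i hi⟩
    (fun i s h => h.2 p hp)
    (by
      rintro i hi s1 ⟨h1, h2⟩ hi1
      obtain ⟨k, s', hr, hk, -, h3, h4, h5⟩ := Run.forLoop (V := V) (v := l + 1) (b := q)
        (body := body) (v q) T
        (fun j s => I i j s ∧ (∀ i < l, s.nat i = v i) ∧ s.nat l = i) s1
        ⟨hI _ _ _ _ h1 rfl, fun i hi => by
          rw [State.setNat_nat_of_ne _ _ (by omega)]; exact h2 i hi, by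
          rw [State.setNat_nat_of_ne _ _ (by omega)]; exact hi1⟩
        (fun i s h => h.2.1 q hq)
        (by
          rintro j hj s2 ⟨h3, h4, h5⟩ hj2
          obtain ⟨k, s', hr, hk, h6, h7⟩ := hbody i hi j hj s2 h3 h4 h5 hj2
          refine ⟨k, s', hr, hk, by rw [h6 _ (by omega), hj2],
            by rw [h6 _ (by omega), h4 _ (by omega), hv.one], hI _ _ _ _ h7 rfl, ?_, ?_⟩
          · intro i hi
            rw [State.setNat_nat_of_ne _ _ (by omega), h6 i (by omega), h4 i hi]
          · rw [State.setNat_nat_of_ne _ _ (by omega), h6 l (by omega), h5])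
      refine ⟨k, s', hr, hk, h5, by rw [h4 _ (by omega), hv.one],
        hI _ _ _ _ (hrow _ _ h3) rfl, fun i hi => ?_⟩
      rw [State.setNat_nat_of_ne _ _ (by omega), h4 i hi])
  refine ⟨k, s', hr, hk.trans ?_, h2, h1⟩
  have e1 := Nat.mul_le_mul (hv.bound q hq) (le_refl (T + 2))
  have e2 := Nat.mul_le_mul (hv.bound p hp)
    (show v q * (T + 2) + 2 + 2 ≤ Q * (T + 2) + 4 by omega)
  omega

/-- The expression may read the array that is being assigned. The first double loop therefore stores
all new values in the buffer and leaves the arrays below 100 intact; only the second one overwrites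
the target. -/
theorem Com.run_compile_assign (A : ℕ → ℕ → ℝ) (M : Mem) {γ : ℕ → ℕ} (hM : BoundedBy γ M)
    (Q P : ℕ) (a p q : ℕ) (e : Expr) (l : ℕ) (v : ℕ → ℕ) (s : State)
    (hw : (Com.assign a p q e).wf l) (hv : GoodVars Q l v) (hs : Represents A M l v s)
    (hP : e.maxBits γ Q ≤ P) :
    ∃ k s', Run (Written P) ((Com.assign a p q e).compile l) s k s' ∧
      k ≤ (Com.assign a p q e).cost.eval Q ∧
      Represents A ((Com.assign a p q e).exec A l v M) l v s' := by
  simp only [Com.wf, Bool.and_eq_true, decide_eq_true_eq] at hw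
  obtain ⟨⟨⟨⟨h0, h100⟩, hp⟩, hq⟩, hw⟩ := hw
  have hl := hv.le
  set f : ℕ → ℕ → ℤ := fun i j =>
    e.eval A M (l + 2) (Function.update (Function.update v l i) (l + 1) j) with hf
  have gv : ∀ i < v p, ∀ j < v q,
      GoodVars Q (l + 2) (Function.update (Function.update v l i) (l + 1) j) := by
    intro i hi j hj
    refine (hv.update hp hi).update (b := q) (by omega) ?_
    rw [Function.update_of_ne (by omega)]; exact hj
  have hfw : ∀ i < v p, ∀ j < v q, (f i j : ℝ) ∈ Written P := by
    intro i hi j hj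
    exact mem_written (Expr.abs_eval_lt A M hM Q e _ _ hw (gv i hi j hj).bound)
      ((e.valueBits_le_maxBits γ Q).trans hP)
  obtain ⟨k1, s1, hr1, hk1, hn1, ⟨hI1, hA1⟩⟩ := Run.forLoop₂ (V := Written P)
    (Q := Q) (l := l) (p := p) (q := q) (v := v)
    (body := .seq (e.compile (l + 2) 101) (move ⟨100, l, l + 1⟩ (scalar 101)))
    (e.cost.eval Q + 2) hv hp hq
    (fun i j s' => (∀ a < 100, s'.real a = s.real a) ∧
      ∀ i' j', i' < v p → j' < v q → (i' < i ∨ i' = i ∧ j' < j) → s'.real 100 i' j' = f i' j')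
    (fun i j s s' h e => by rw [e]; exact h)
    (fun i s h => ⟨h.1, fun i' j' hi' hj' hh => h.2 i' j' hi' hj' (by omega)⟩)
    (by
      rintro i hi j hj s1 ⟨h1, h2⟩ hn hil hjl
      have hs1 : Represents A M l v s1 :=
        hs.congr (fun i hi => (hn i hi).trans (hs.nat i hi).symm) h1
      have hs1' := (hs1.update hil).update hjl
      obtain ⟨k, s2, hr, hk, hv2, hn2, ha2⟩ := Expr.run_compile A M hM Q P e (l + 2) 101 _ s1 hw
        (gv i hi j hj) hs1' (by omega) hP
      have hs2 := hs1'.congr hn2 fun a ha => ha2 a (by omega)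
      have e1 : s2.get (scalar 101) = f i j := by
        rw [hs2.get_scalar (gv i hi j hj), hv2]
      have hm := Run.move (V := Written P) s2 ⟨100, l, l + 1⟩ (scalar 101) (by simp [scalar])
        (zero_mem_written P) (by rw [e1]; exact hfw i hi j hj)
      rw [e1] at hm
      refine ⟨_, _, .seq hr hm, by omega, hn2, ?_, ?_⟩
      · intro a ha
        rw [State.set_real_of_ne _ _ _ (by simp; omega), ha2 a (by omega), h1 a ha]
      · intro i' j' hi' hj' hh
        simp only [State.set, hn2 l (by omega), hn2 (l + 1) (by omega), hil, hjl, true_and]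
        split_ifs with hc
        · rw [hc.1, hc.2]
        · rw [ha2 100 (by omega)]
          exact h2 i' j' hi' hj' (by omega))
    s hs.nat ⟨fun _ _ => rfl, fun i' j' _ _ hh => by omega⟩
  obtain ⟨k2, s2, hr2, hk2, hn2, ⟨hI2, hA2, hB2⟩⟩ := Run.forLoop₂ (V := Written P)
    (Q := Q) (l := l) (p := p) (q := q) (v := v)
    (body := move ⟨a, l, l + 1⟩ ⟨100, l, l + 1⟩)
    2 hv hp hq
    (fun i j s' => (∀ a' < 100, a' ≠ a → s'.real a' = s.real a') ∧
      s'.real 100 = s1.real 100 ∧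
      ∀ i' j', s'.real a i' j' = if i' < v p ∧ j' < v q ∧ (i' < i ∨ i' = i ∧ j' < j) then (f i' j' : ℝ)
        else s.real a i' j')
    (fun i j s s' h e => by rw [e]; exact h)
    (fun i s h => ⟨h.1, h.2.1, fun i' j' => by
      rw [h.2.2 i' j']
      refine if_congr ?_ rfl rfl
      constructor <;> rintro ⟨h1, h2, h3⟩ <;> refine ⟨h1, h2, ?_⟩ <;> omega⟩)
    (by
      rintro i hi j hj s2 ⟨h1, h2, h3⟩ hn hil hjl
      have e1 : s2.get ⟨100, l, l + 1⟩ = f i j := by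
        simp only [State.get, hil, hjl, h2]
        exact hA1 i j hi hj (by omega)
      have hm := Run.move (V := Written P) s2 ⟨a, l, l + 1⟩ ⟨100, l, l + 1⟩
        (by simp only [ne_eq]; omega)
        (zero_mem_written P) (by rw [e1]; exact hfw i hi j hj)
      rw [e1] at hm
      refine ⟨_, _, hm, le_rfl, fun _ _ => rfl, ?_, ?_, ?_⟩
      · intro a' ha hne
        rw [State.set_real_of_ne _ _ _ (by simpa using hne), h1 a' ha hne]
      · rw [State.set_real_of_ne _ _ _ (by simp only [ne_eq]; omega), h2]
      · intro i' j'
        simp only [State.set, hil, hjl, true_and]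
        by_cases hc : i' = i ∧ j' = j
        · rw [if_pos hc, if_pos (by omega), hc.1, hc.2]
        · rw [if_neg hc, h3]
          refine if_congr ?_ rfl rfl
          constructor <;> rintro ⟨h1, h2, h3⟩ <;> refine ⟨h1, h2, ?_⟩ <;> omega)
    s1 hn1 ⟨fun a' ha _ => hI1 a' ha, rfl, fun i' j' => by
      rw [if_neg (by omega), hI1 a h100]⟩
  refine ⟨_, s2, .seq hr1 hr2, ?_, hn2, ?_, ?_⟩
  · simp only [Com.cost, Polynomial.eval_add, Polynomial.eval_mul, Polynomial.eval_X,
      Polynomial.eval_ofNat]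
    have e1 : Q * (Q * (Polynomial.eval Q e.cost + 2 + 2) + 4) =
      Q * (Q * (Polynomial.eval Q e.cost + 4) + 4) := rfl
    have e2 : Q * (Q * (2 + 2) + 4) = Q * (Q * 4 + 4) := rfl
    omega
  · rw [hI2 0 (by omega) (by omega)]; exact hs.input
  · intro a' h0' ha' i j
    simp only [Com.exec, Mem.assign]
    by_cases hc : a' = a
    · subst hc
      rw [hB2]
      by_cases hc' : i < v p ∧ j < v q
      · rw [if_pos ⟨hc'.1, hc'.2, Or.inl hc'.1⟩, if_pos ⟨rfl, hc'⟩]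
      · rw [if_neg (by omega), if_neg (by omega)]
        exact hs.real a' h0' ha' i j
    · rw [hI2 a' ha' hc, if_neg (by omega)]
      exact hs.real a' h0' ha' i j

/-- The size bound and the simulation are proved together, since simulating a command requires the
size bound left by its predecessor. -/
theorem Com.run_compile (A : ℕ → ℕ → ℝ) (Q P : ℕ) {Γ : ℕ → ℕ} {c : Com} {γ γ' : ℕ → ℕ}
    (hc : c.Grows Q Γ γ γ') : ∀ (l : ℕ) (v : ℕ → ℕ) (s : State) (M : Mem), BoundedBy γ M →
      c.wf l → GoodVars Q l v → Represents A M l v s → c.maxBits Γ Q ≤ P →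
      BoundedBy γ' (c.exec A l v M) ∧
      ∃ k s', Run (Written P) (c.compile l) s k s' ∧ k ≤ c.cost.eval Q ∧
        Represents A (c.exec A l v M) l v s' := by
  induction hc with
  | @assign a p q e γ γ' h ha hΓ =>
    intro l v s M hM hw hv hs hP
    refine ⟨?_, Com.run_compile_assign A M hM Q P a p q e l v s hw hv hs
      ((e.maxBits_mono hΓ Q).trans hP)⟩
    simp only [Com.wf, Bool.and_eq_true, decide_eq_true_eq] at hw
    intro a' i j
    simp only [Com.exec, Mem.assign]
    split_ifs with hc
    · obtain ⟨rfl, hi, hj⟩ := hc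
      have hl := hv.le
      refine (Expr.abs_eval_lt A M hM Q e _ _ hw.2 ?_).trans_le
        (pow_le_pow_right₀ (by norm_num) ha)
      refine ((hv.update hw.1.1.2 hi).update (b := q) (by omega) ?_).bound
      rw [Function.update_of_ne (by omega)]; exact hj
    · exact (hM.mono h) a' i j
  | seq _ _ ih1 ih2 =>
    intro l v s M hM hw hv hs hP
    simp only [Com.wf, Bool.and_eq_true] at hw
    simp only [Com.maxBits] at hP
    obtain ⟨hb1, k1, s1, hr1, hk1, hs1⟩ := ih1 l v s M hM hw.1 hv hs (by omega)
    obtain ⟨hb2, k2, s2, hr2, hk2, hs2⟩ := ih2 l v s1 _ hb1 hw.2 hv hs1 (by omega)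
    refine ⟨hb2, _, s2, .seq hr1 hr2, ?_, hs2⟩
    simp only [Com.cost, Polynomial.eval_add]
    omega
  | @rep b c γ' g h h' ih =>
    intro l v s M hM hw hv hs hP
    simp only [Com.wf, Bool.and_eq_true, decide_eq_true_eq] at hw
    simp only [Com.maxBits] at hP
    have hl := hv.le
    have hbQ := hv.bound b hw.1
    set N : ℕ → Mem := fun n => Nat.rec M
      (fun i M' => c.exec A (l + 1) (Function.update v l i) M') n with hN
    have hbd : ∀ i ≤ v b, BoundedBy (g i) (N i) := by
      intro i
      induction i with
      | zero => intro _; exact hM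
      | succ i ihi =>
        intro hi
        have hv' := hv.update hw.1 (show i < v b by omega)
        -- The induction hypothesis speaks about a machine state. To extract the size bound alone,
        -- an artificial state representing the memory `N i` is supplied.
        exact (ih i (by omega) (l + 1) _ ⟨Function.update v l i, fun a' j' k' =>
          if a' = 0 then A j' k' else (N i a' j' k' : ℝ)⟩ (N i) (ihi (by omega)) hw.2 hv'
          ⟨fun _ _ => rfl, by simp, fun a ha _ i j => by simp [ha.ne']⟩ hP).1
    refine ⟨(hbd _ le_rfl).mono (h' _ hbQ), ?_⟩
    obtain ⟨k, s', hr, hk, -, hI⟩ := Run.forLoop (V := Written P) (v := l) (b := b)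
      (body := c.compile (l + 1)) (v b) (c.cost.eval Q)
      (fun i s => Represents A (N i) l v s) s
      ⟨fun i hi => by rw [State.setNat_nat_of_ne _ _ (by omega)]; exact hs.nat i hi, hs.input, hs.real⟩
      (fun i s h => h.nat b hw.1)
      (by
        intro i hi s1 hs1 hi1
        obtain ⟨-, k, s2, hr, hk, hs2⟩ := ih i (by omega) (l + 1) _ s1 (N i) (hbd i hi.le) hw.2
          (hv.update hw.1 hi) (hs1.update hi1) hP
        have hn : ∀ j < l, s2.nat j = v j := fun j hj => by
          rw [hs2.nat j (by omega), Function.update_of_ne (by omega)]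
        refine ⟨k, s2, hr, hk, by simpa using hs2.nat l (by omega),
          by rw [hn 3 (by omega), hv.one], fun j hj => ?_, hs2.input, hs2.real⟩
        rw [State.setNat_nat_of_ne _ _ (by omega)]; exact hn j hj)
    refine ⟨k, s', hr, hk.trans ?_, hI⟩
    simp only [Com.cost, Polynomial.eval_add, Polynomial.eval_mul, Polynomial.eval_X,
      Polynomial.eval_ofNat]
    have := Nat.mul_le_mul hbQ (le_refl (c.cost.eval Q + 2))
    omega

end RealRAM

/-! ### The power method -/

/-- Consecutive ratios of a log-convex sequence increase. Zero terms need a separate case: a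
vanishing term forces the next one to vanish. -/
theorem logConvex_ratio_le {a : ℕ → ℝ} (h0 : ∀ r, 0 ≤ a r)
    (h : ∀ r, a (r + 1) ^ 2 ≤ a r * a (r + 2)) {β : ℝ} (h1 : β * a 0 ≤ a 1) (r : ℕ) :
    β * a r ≤ a (r + 1) := by
  induction r with
  | zero => exact h1
  | succ r ih =>
    rcases (h0 r).eq_or_lt with hr | hr
    · have h2 := h r
      rw [← hr, zero_mul] at h2
      have h3 : a (r + 1) = 0 := by nlinarith
      rw [h3, mul_zero]
      exact h0 _
    · have h2 : (β * a r) * a (r + 1) ≤ a r * a (r + 2) :=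
        (mul_le_mul_of_nonneg_right ih (h0 _)).trans (by rw [← sq]; exact h r)
      have h3 : a r * (β * a (r + 1)) ≤ a r * a (r + 2) := by linarith
      exact le_of_mul_le_mul_left h3 hr

theorem logConvex_pow_le {a : ℕ → ℝ} (h0 : ∀ r, 0 ≤ a r)
    (h : ∀ r, a (r + 1) ^ 2 ≤ a r * a (r + 2)) {β : ℝ} (hβ : 0 ≤ β) (h1 : β * a 0 ≤ a 1) (r : ℕ) :
    β ^ r * a 0 ≤ a r := by
  induction r with
  | zero => simp
  | succ r ih =>
    rw [pow_succ']
    calc β * β ^ r * a 0 = β * (β ^ r * a 0) := by ring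
      _ ≤ β * a r := mul_le_mul_of_nonneg_left ih hβ
      _ ≤ a (r + 1) := logConvex_ratio_le h0 h h1 r

/-- Increasing ratios read backwards: if the last ratio is at most θ, so are all earlier ones. -/
theorem le_pow_of_logConvex {a : ℕ → ℝ} (h0 : ∀ r, 0 ≤ a r)
    (h : ∀ r, a (r + 1) ^ 2 ≤ a r * a (r + 2)) {θ : ℝ} (hθ : 0 ≤ θ) :
    ∀ r, a (r + 1) ≤ θ * a r → a r ≤ θ ^ r * a 0 ∧ a (r + 1) ≤ θ ^ (r + 1) * a 0 := by
  intro r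
  induction r with
  | zero => intro h1; simpa using h1
  | succ r ih =>
    intro h1
    have h2 : a (r + 1) ≤ θ * a r := by
      rcases (h0 (r + 1)).eq_or_lt with hr | hr
      · rw [← hr]; exact mul_nonneg hθ (h0 r)
      · have h3 : a (r + 1) * a (r + 1) ≤ (θ * a r) * a (r + 1) := by
          calc a (r + 1) * a (r + 1) = a (r + 1) ^ 2 := by ring
            _ ≤ a r * a (r + 2) := h r
            _ ≤ a r * (θ * a (r + 1)) := mul_le_mul_of_nonneg_left h1 (h0 r)
            _ = _ := by ring
        exact le_of_mul_le_mul_right h3 hr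
    obtain ⟨-, h4⟩ := ih h2
    refine ⟨h4, h1.trans ?_⟩
    calc θ * a (r + 1) ≤ θ * (θ ^ (r + 1) * a 0) := mul_le_mul_of_nonneg_left h4 hθ
      _ = _ := by ring

section Power

variable {E : Type*} [NormedAddCommGroup E] [InnerProductSpace ℝ E]

theorem LinearMap.IsSymmetric.inner_sq_le {C : E →ₗ[ℝ] E} (hC : C.IsSymmetric)
    (hp : ∀ x, 0 ≤ inner ℝ x (C x)) (v w : E) :
    inner ℝ v (C w) ^ 2 ≤ inner ℝ v (C v) * inner ℝ w (C w) := by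
  have h : ∀ t : ℝ, 0 ≤ inner ℝ w (C w) * (t * t) + 2 * inner ℝ v (C w) * t + inner ℝ v (C v) := by
    intro t
    have h1 := hp (v + t • w)
    have h2 : inner ℝ w (C v) = inner ℝ v (C w) := by rw [← hC w v, real_inner_comm]
    simp only [map_add, map_smul, inner_add_left, inner_add_right, inner_smul_left,
      inner_smul_right, h2, RCLike.conj_to_real] at h1
    linarith
  have h3 := discrim_le_zero h
  simp only [discrim] at h3
  linarith

theorem LinearMap.IsSymmetric.pow_inner {B : E →ₗ[ℝ] E} (hB : B.IsSymmetric) (r : ℕ) (x y : E) :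
    inner ℝ ((B ^ r) x) y = inner ℝ x ((B ^ r) y) := by
  induction r generalizing x y with
  | zero => rfl
  | succ r ih =>
    rw [pow_succ, Module.End.mul_apply, ih, hB, ← Module.End.mul_apply, ← pow_succ', pow_succ,
      Module.End.mul_apply]

/-- With r = 2k the value is ‖B^k x‖²; with r = 2k + 1 it is the form of B at B^k x. -/
theorem LinearMap.IsSymmetric.pow_nonneg {B : E →ₗ[ℝ] E} (hB : B.IsSymmetric)
    (hp : ∀ x, 0 ≤ inner ℝ x (B x)) (r : ℕ) (x : E) : 0 ≤ inner ℝ x ((B ^ r) x) := by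
  obtain ⟨k, rfl | rfl⟩ := Nat.even_or_odd' r
  · rw [two_mul, pow_add, Module.End.mul_apply, ← hB.pow_inner]
    exact real_inner_self_nonneg
  · rw [two_mul, add_assoc, pow_add, Module.End.mul_apply, ← hB.pow_inner, pow_succ',
      Module.End.mul_apply]
    exact hp _

/-- Among the images `B ^ N` of the unit vectors `b i`, one has a large Rayleigh quotient, if some
unit vector in their span has a slightly larger one. -/
theorem LinearMap.IsSymmetric.exists_pow_rayleigh {B : E →ₗ[ℝ] E} (hB : B.IsSymmetric)
    (hp : ∀ x, 0 ≤ inner ℝ x (B x)) {ι : Type*} (s : Finset ι) (b : ι → E) (hb : ∀ i, ‖b i‖ = 1)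
    (x : ι → ℝ) (hx : ∑ i ∈ s, x i ^ 2 = 1) (v : E) (hv : v = ∑ i ∈ s, x i • b i) (hv1 : ‖v‖ = 1)
    {β θ : ℝ} (hβ : 0 ≤ β) (hθ : 0 ≤ θ) (hβv : β ≤ inner ℝ v (B v)) (N : ℕ)
    (hN : s.card * θ ^ (2 * N) < β ^ (2 * N)) :
    ∃ i ∈ s, θ * ‖(B ^ N) (b i)‖ ^ 2 < inner ℝ ((B ^ N) (b i)) (B ((B ^ N) (b i))) := by
  -- If all the quotients are at most θ, then ‖B^N b_i‖² ≤ θ^(2N) for each i, and Cauchy–Schwarz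
  -- gives ‖B^N v‖² ≤ |s| θ^(2N). But log-convexity started at v gives ‖B^N v‖² ≥ β^(2N). No
  -- eigenvectors are needed.
  by_contra! hcon
  -- Cauchy–Schwarz for the semidefinite form of B^r, applied to w and Bw.
  have lc : ∀ (w : E) (r : ℕ), inner ℝ w ((B ^ (r + 1)) w) ^ 2 ≤
      inner ℝ w ((B ^ r) w) * inner ℝ w ((B ^ (r + 2)) w) := by
    intro w r
    have h := LinearMap.IsSymmetric.inner_sq_le (C := B ^ r) (fun x y => hB.pow_inner r x y)
      (hB.pow_nonneg hp r) w (B w)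
    rw [← Module.End.mul_apply, ← pow_succ, hB, ← Module.End.mul_apply (f := B), ← pow_succ'] at h
    exact h
  have hsq : ∀ w : E, ‖(B ^ N) w‖ ^ 2 = inner ℝ w ((B ^ (2 * N)) w) := by
    intro w
    rw [two_mul, pow_add, Module.End.mul_apply, ← hB.pow_inner, real_inner_self_eq_norm_sq]
  have h1 : β ^ (2 * N) ≤ ‖(B ^ N) v‖ ^ 2 := by
    rw [hsq]
    have := logConvex_pow_le (a := fun r => inner ℝ v ((B ^ r) v)) (hB.pow_nonneg hp · v) (lc v) hβ
      (by simpa [hv1] using hβv) (2 * N)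
    simpa [hv1] using this
  have h2 : ∀ i ∈ s, ‖(B ^ N) (b i)‖ ^ 2 ≤ θ ^ (2 * N) := by
    intro i hi
    have h3 := hcon i hi
    rw [hsq] at h3 ⊢
    have h4 : inner ℝ ((B ^ N) (b i)) (B ((B ^ N) (b i))) =
        inner ℝ (b i) ((B ^ (2 * N + 1)) (b i)) := by
      rw [two_mul, add_assoc, pow_add, Module.End.mul_apply, ← hB.pow_inner, pow_succ',
        Module.End.mul_apply]
    rw [h4] at h3
    have := (le_pow_of_logConvex (a := fun r => inner ℝ (b i) ((B ^ r) (b i)))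
      (hB.pow_nonneg hp · _) (lc _) hθ (2 * N) h3).1
    simpa [hb i] using this
  have h3 : ‖(B ^ N) v‖ ≤ ∑ i ∈ s, |x i| * ‖(B ^ N) (b i)‖ := by
    rw [hv, map_sum]
    refine (norm_sum_le _ _).trans (Finset.sum_le_sum fun i _ => ?_)
    rw [map_smul, norm_smul, Real.norm_eq_abs]
  have h4 : ‖(B ^ N) v‖ ^ 2 ≤ s.card * θ ^ (2 * N) := by
    calc ‖(B ^ N) v‖ ^ 2 ≤ (∑ i ∈ s, |x i| * ‖(B ^ N) (b i)‖) ^ 2 :=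
          pow_le_pow_left₀ (norm_nonneg _) h3 2
      _ ≤ (∑ i ∈ s, |x i| ^ 2) * ∑ i ∈ s, ‖(B ^ N) (b i)‖ ^ 2 :=
          Finset.sum_mul_sq_le_sq_mul_sq _ _ _
      _ = ∑ i ∈ s, ‖(B ^ N) (b i)‖ ^ 2 := by simp only [sq_abs, hx, one_mul]
      _ ≤ ∑ i ∈ s, θ ^ (2 * N) := Finset.sum_le_sum h2
      _ = _ := by rw [Finset.sum_const, nsmul_eq_mul]
  linarith

end Power

/-- A unit vector with given support that is orthogonal to few vectors and has small average square
inner product with many others. -/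
theorem exists_unit_vector_small_form {n : ℕ} {ι : Type*} [DecidableEq ι] (s t : Finset ι)
    (al : Finset (Fin n))
    (u : ι → EuclideanSpace ℝ (Fin n)) (w : ι → ℝ) (hw : ∀ i ∈ s, 0 ≤ w i) {U : ℝ}
    (hU : ∀ i ∈ s, ‖u i‖ ^ 2 ≤ U) (hal : 0 < al.card) (ht : 2 * t.card ≤ al.card) :
    ∃ v : EuclideanSpace ℝ (Fin n), ‖v‖ = 1 ∧ (∀ j ∉ al, v j = 0) ∧ (∀ i ∈ t, inner ℝ (u i) v = 0) ∧
      (∑ i ∈ s, w i * inner ℝ (u i) v ^ 2) * al.card ≤ 2 * ((∑ i ∈ s, w i) * U) := by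
  classical
  -- The orthogonal complement of these vectors has dimension d ≥ |al|/2. By Bessel, each u_i
  -- contributes at most ‖u_i‖² in total over an orthonormal basis of it, so some basis vector does
  -- no worse than the average, at most Σ w_i U / d.
  set F : Finset (EuclideanSpace ℝ (Fin n)) :=
    t.image u ∪ alᶜ.image (fun j => EuclideanSpace.single j (1 : ℝ)) with hF
  set K := Submodule.span ℝ (F : Set (EuclideanSpace ℝ (Fin n))) with hK
  have hKd : Module.finrank ℝ K ≤ t.card + (n - al.card) := by
    refine (finrank_span_finset_le_card F).trans ((Finset.card_union_le _ _).trans ?_)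
    refine add_le_add Finset.card_image_le (Finset.card_image_le.trans ?_)
    rw [Finset.card_compl, Fintype.card_fin]
  have hdim := K.finrank_add_finrank_orthogonal
  rw [finrank_euclideanSpace_fin] at hdim
  have haln : al.card ≤ n := by simpa using al.card_le_univ
  set d := Module.finrank ℝ Kᗮ with hd
  have hd2 : al.card ≤ 2 * d := by omega
  set e := stdOrthonormalBasis ℝ Kᗮ with he
  have hon : Orthonormal ℝ (fun i => (e i : EuclideanSpace ℝ (Fin n))) :=
    e.orthonormal.comp_linearIsometry (Kᗮ).subtypeₗᵢ
  have hmem : ∀ i, ∀ f ∈ F, inner ℝ f (e i : EuclideanSpace ℝ (Fin n)) = 0 := fun i f hf =>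
    (Submodule.mem_orthogonal K _).1 (e i).2 f (Submodule.subset_span hf)
  have hsum : ∑ a, ∑ i ∈ s, w i * inner ℝ (u i) (e a : EuclideanSpace ℝ (Fin n)) ^ 2 ≤
      (∑ i ∈ s, w i) * U := by
    rw [Finset.sum_comm, Finset.sum_mul]
    refine Finset.sum_le_sum fun i hi => ?_
    rw [← Finset.mul_sum]
    refine mul_le_mul_of_nonneg_left ?_ (hw i hi)
    refine le_trans ?_ (hU i hi)
    have := hon.sum_inner_products_le (u i) (s := Finset.univ)
    simpa [real_inner_comm] using this
  have hex : ∃ a, (∑ i ∈ s, w i * inner ℝ (u i) (e a : EuclideanSpace ℝ (Fin n)) ^ 2) * d ≤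
      (∑ i ∈ s, w i) * U := by
    by_contra! hcon
    have hdpos : 0 < d := by omega
    have : Nonempty (Fin (Module.finrank ℝ Kᗮ)) := ⟨⟨0, hdpos⟩⟩
    have h1 := Finset.sum_lt_sum_of_nonempty (s := Finset.univ) Finset.univ_nonempty
      (fun a _ => hcon a)
    rw [Finset.sum_const, Finset.card_univ, Fintype.card_fin, nsmul_eq_mul, ← Finset.sum_mul,
      mul_comm] at h1
    have : (0 : ℝ) < d := by exact_mod_cast hdpos
    exact absurd (lt_of_mul_lt_mul_right h1 this.le) (not_lt.2 hsum)
  obtain ⟨a, ha⟩ := hex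
  refine ⟨e a, hon.1 a, fun j hj => ?_, fun i hi => ?_, ?_⟩
  · have := hmem a (EuclideanSpace.single j (1 : ℝ)) (by
      simp only [hF, Finset.mem_union, Finset.mem_image]
      exact Or.inr ⟨j, by simpa using hj, rfl⟩)
    rw [EuclideanSpace.inner_single_left] at this
    simpa using this
  · exact hmem a (u i) (by
      simp only [hF, Finset.mem_union, Finset.mem_image]
      exact Or.inl ⟨i, hi, rfl⟩)
  · have h0 : 0 ≤ ∑ i ∈ s, w i * inner ℝ (u i) (e a : EuclideanSpace ℝ (Fin n)) ^ 2 :=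
      Finset.sum_nonneg fun i hi => mul_nonneg (hw i hi) (sq_nonneg _)
    have h2 : (al.card : ℝ) ≤ 2 * d := by exact_mod_cast hd2
    nlinarith

/-! ### Integer power iteration -/

open Finset in
/-- The integer vector `Λ z - ∑ c i ⟨u i, z⟩ u i`. -/
def iterStep (n m : ℕ) (u : ℕ → ℕ → ℤ) (c : ℕ → ℤ) (Λ : ℤ) (z : ℕ → ℤ) : ℕ → ℤ :=
  fun j => Λ * z j - ∑ i ∈ range m, c i * u i j * ∑ l ∈ range n, u i l * z l

/-- The real vector with given integer coordinates. -/
noncomputable def euclideanOfInt (n : ℕ) (z : ℕ → ℤ) : EuclideanSpace ℝ (Fin n) :=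
  WithLp.toLp 2 fun j => (z j : ℝ)

theorem inner_euclideanOfInt (n : ℕ) (y z : ℕ → ℤ) :
    inner ℝ (euclideanOfInt n y) (euclideanOfInt n z) =
      ((∑ j ∈ Finset.range n, y j * z j : ℤ) : ℝ) := by
  rw [Finset.sum_range]
  simp [euclideanOfInt, PiLp.inner_apply, mul_comm]

theorem norm_sq_euclideanOfInt (n : ℕ) (z : ℕ → ℤ) :
    ‖euclideanOfInt n z‖ ^ 2 = ((∑ j ∈ Finset.range n, z j * z j : ℤ) : ℝ) := by
  rw [← real_inner_self_eq_norm_sq, inner_euclideanOfInt]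

/-- `iterStep` is B = Λ - Σ c_i u_i u_iᵀ in integer coordinates. Λ is at least the trace of the
form, so B is positive semidefinite. A small value of the form is a large Rayleigh quotient of B: v
witnesses Λ - μ, and power iteration from some coordinate vector beats Λ - θ. -/
theorem exists_iterStep_small_form {n m : ℕ} (u : ℕ → ℕ → ℤ) (c : ℕ → ℤ) (hc : ∀ i < m, 0 ≤ c i)
    (al : Finset (Fin n)) {Λ : ℤ}
    (hΛ : ∑ i ∈ Finset.range m, c i * ∑ j ∈ Finset.range n, u i j * u i j ≤ Λ)
    (v : EuclideanSpace ℝ (Fin n)) (hv1 : ‖v‖ = 1) (hv : ∀ j ∉ al, v j = 0) {μ θ : ℤ}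
    (hμ : ∑ i ∈ Finset.range m, (c i : ℝ) * inner ℝ (euclideanOfInt n (u i)) v ^ 2 ≤ μ)
    (hμΛ : μ ≤ Λ) (hθΛ : θ ≤ Λ) (N : ℕ)
    (hN : (al.card : ℤ) * (Λ - θ) ^ (2 * N) < (Λ - μ) ^ (2 * N)) :
    ∃ a ∈ al, ∀ z : ℕ → ℤ, z = (iterStep n m u c Λ)^[N] (Pi.single (a : ℕ) 1) →
      ∑ i ∈ Finset.range m, c i * (∑ j ∈ Finset.range n, u i j * z j) ^ 2 <
        θ * ∑ j ∈ Finset.range n, z j * z j := by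
  set U : ℕ → EuclideanSpace ℝ (Fin n) := fun i => euclideanOfInt n (u i) with hU
  set B : EuclideanSpace ℝ (Fin n) →ₗ[ℝ] EuclideanSpace ℝ (Fin n) :=
    (Λ : ℝ) • LinearMap.id - ∑ i ∈ Finset.range m, (c i : ℝ) •
      (LinearMap.toSpanSingleton ℝ _ (U i) ∘ₗ (innerₗ (EuclideanSpace ℝ (Fin n)) (U i))) with hBdef
  have hB : ∀ x, B x = (Λ : ℝ) • x - ∑ i ∈ Finset.range m, (c i : ℝ) • inner ℝ (U i) x • U i := by
    intro x
    simp [hBdef, LinearMap.sum_apply]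
  have hBi : ∀ x y, inner ℝ x (B y) = (Λ : ℝ) * inner ℝ x y -
      ∑ i ∈ Finset.range m, (c i : ℝ) * (inner ℝ (U i) x * inner ℝ (U i) y) := by
    intro x y
    rw [hB, inner_sub_right, inner_smul_right, inner_sum]
    congr 1
    refine Finset.sum_congr rfl fun i _ => ?_
    rw [inner_smul_right, inner_smul_right, real_inner_comm (U i) x]
    ring
  have hsym : B.IsSymmetric := by
    intro x y
    rw [real_inner_comm, hBi, hBi, real_inner_comm]
    congr 1
    exact Finset.sum_congr rfl fun i _ => by ring
  have hBself : ∀ x, inner ℝ x (B x) = (Λ : ℝ) * ‖x‖ ^ 2 -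
      ∑ i ∈ Finset.range m, (c i : ℝ) * inner ℝ (U i) x ^ 2 := by
    intro x
    rw [hBi, real_inner_self_eq_norm_sq]
    congr 1
    exact Finset.sum_congr rfl fun i _ => by ring
  have hpos : ∀ x, 0 ≤ inner ℝ x (B x) := by
    intro x
    rw [hBself, sub_nonneg]
    have h1 : ∑ i ∈ Finset.range m, (c i : ℝ) * inner ℝ (U i) x ^ 2 ≤
        ∑ i ∈ Finset.range m, (c i : ℝ) * ‖U i‖ ^ 2 * ‖x‖ ^ 2 := by
      refine Finset.sum_le_sum fun i hi => ?_
      rw [mul_assoc, ← mul_pow]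
      refine mul_le_mul_of_nonneg_left ?_ (by exact_mod_cast hc i (Finset.mem_range.1 hi))
      rw [← sq_abs]
      exact pow_le_pow_left₀ (abs_nonneg _) (abs_real_inner_le_norm _ _) 2
    refine h1.trans ?_
    rw [← Finset.sum_mul]
    refine mul_le_mul_of_nonneg_right ?_ (sq_nonneg _)
    have h2 : ((∑ i ∈ Finset.range m, c i * ∑ j ∈ Finset.range n, u i j * u i j : ℤ) : ℝ) ≤ Λ := by
      exact_mod_cast hΛ
    refine le_trans (le_of_eq ?_) h2
    push_cast
    refine Finset.sum_congr rfl fun i _ => ?_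
    rw [hU, norm_sq_euclideanOfInt]
    push_cast
    rfl
  have hstep : ∀ z, B (euclideanOfInt n z) = euclideanOfInt n (iterStep n m u c Λ z) := by
    intro z
    rw [hB]
    ext j
    simp only [hU, inner_euclideanOfInt]
    simp [euclideanOfInt, iterStep]
    exact Finset.sum_congr rfl fun i _ => by ring
  have hpow : ∀ (r : ℕ) z, (B ^ r) (euclideanOfInt n z) =
      euclideanOfInt n ((iterStep n m u c Λ)^[r] z) := by
    intro r
    induction r with
    | zero => intro z; rfl
    | succ r ih => intro z; rw [pow_succ, Module.End.mul_apply, hstep, ih, Function.iterate_succ_apply]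
  have hsingle : ∀ a : Fin n, euclideanOfInt n (Pi.single (a : ℕ) 1) = EuclideanSpace.single a (1 : ℝ) := by
    intro a
    ext j
    simp [euclideanOfInt, Pi.single_apply, Fin.ext_iff]
  have hvsum : v = ∑ j ∈ al, v j • EuclideanSpace.single j (1 : ℝ) := by
    ext j
    by_cases hj : j ∈ al
    · simp [hj, Pi.single_apply]
    · simp [hj, Pi.single_apply, hv j hj]
  have hvsq : ∑ j ∈ al, v j ^ 2 = 1 := by
    have h1 : ‖v‖ ^ 2 = ∑ j, v j ^ 2 := by
      rw [EuclideanSpace.norm_sq_eq]; simp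
    rw [hv1, one_pow] at h1
    rw [h1]
    exact Finset.sum_subset (Finset.subset_univ _) fun j _ hj => by rw [hv j hj]; simp
  have hμΛ' : (μ : ℝ) ≤ Λ := by exact_mod_cast hμΛ
  have hθΛ' : (θ : ℝ) ≤ Λ := by exact_mod_cast hθΛ
  obtain ⟨a, ha, h⟩ := hsym.exists_pow_rayleigh hpos al (fun j => EuclideanSpace.single j (1 : ℝ))
    (by simp) (fun j => v j) hvsq v hvsum hv1 (β := (Λ : ℝ) - μ) (θ := (Λ : ℝ) - θ)
    (by linarith) (by linarith) (by rw [hBself, hv1]; linarith) N (by exact_mod_cast hN)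
  refine ⟨a, ha, ?_⟩
  rintro z hz
  rw [← hsingle, hpow, ← hz, hBself, norm_sq_euclideanOfInt] at h
  simp only [hU, inner_euclideanOfInt] at h
  have h2 : ∑ i ∈ Finset.range m, (c i : ℝ) * (((∑ j ∈ Finset.range n, u i j * z j : ℤ)) : ℝ) ^ 2 <
      θ * ((∑ j ∈ Finset.range n, z j * z j : ℤ) : ℝ) := by linarith
  exact_mod_cast h2

/-! ### The potential function -/

/-- The even function `β ^ s + β ^ (-s)` with `β = 1 + 1 / M`. -/
noncomputable def phi (M : ℝ) (s : ℤ) : ℝ := (1 + 1 / M) ^ s + (1 + 1 / M) ^ (-s)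

theorem one_add_inv_pos {M : ℝ} (hM : 0 < M) : 0 < 1 + 1 / M := by positivity

theorem phi_pos {M : ℝ} (hM : 0 < M) (s : ℤ) : 0 < phi M s :=
  add_pos (zpow_pos (one_add_inv_pos hM) _) (zpow_pos (one_add_inv_pos hM) _)

theorem phi_zero (M : ℝ) : phi M 0 = 2 := by norm_num [phi]

theorem phi_add_phi_sub {M : ℝ} (hM : 0 < M) (s d : ℤ) :
    phi M (s + d) + phi M (s - d) = phi M s * phi M d := by
  have h := (one_add_inv_pos hM).ne'
  simp only [phi, sub_eq_add_neg, neg_add, zpow_add₀ h, neg_neg]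
  ring

theorem Real.exp_le_one_add_two_mul {v : ℝ} (h0 : 0 ≤ v) (h1 : v ≤ 1 / 2) :
    Real.exp v ≤ 1 + 2 * v := by
  have h2 := Real.one_sub_le_exp_neg v
  have h3 : Real.exp v * Real.exp (-v) = 1 := by rw [← Real.exp_add]; simp
  have h4 : Real.exp v * (1 - v) ≤ 1 := by
    exact (mul_le_mul_of_nonneg_left h2 (Real.exp_pos v).le).trans h3.le
  nlinarith [Real.exp_pos v]

/-- φ(d) = 2 cosh u with u = d log(1 + 1/M), so |u| ≤ |d|/M ≤ 1, and cosh u ≤ exp(u²/2) ≤ 1 + u². -/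
theorem phi_le {M : ℝ} (hM : 0 < M) {d : ℤ} (hd : |(d : ℝ)| ≤ M) :
    phi M d ≤ 2 * (1 + (d : ℝ) ^ 2 / M ^ 2) := by
  have hβ := one_add_inv_pos hM
  set u := (d : ℝ) * Real.log (1 + 1 / M) with hu
  have h1 : phi M d = 2 * Real.cosh u := by
    rw [phi, ← Real.rpow_intCast, ← Real.rpow_intCast, Real.rpow_def_of_pos hβ,
      Real.rpow_def_of_pos hβ, Real.cosh_eq, hu]
    push_cast
    rw [show Real.log (1 + 1 / M) * -(d : ℝ) = -((d : ℝ) * Real.log (1 + 1 / M)) by ring, mul_comm]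
    ring
  have hl0 : 0 ≤ Real.log (1 + 1 / M) := Real.log_nonneg (by
    have : 0 < 1 / M := by positivity
    linarith)
  have hl1 : Real.log (1 + 1 / M) ≤ 1 / M := by
    have := Real.log_le_sub_one_of_pos hβ
    linarith
  have hu2 : u ^ 2 ≤ (d : ℝ) ^ 2 / M ^ 2 := by
    rw [hu, mul_pow, div_eq_mul_one_div ((d : ℝ) ^ 2), ← one_div_pow]
    exact mul_le_mul_of_nonneg_left (pow_le_pow_left₀ hl0 hl1 2) (sq_nonneg _)
  have hd2 : (d : ℝ) ^ 2 / M ^ 2 ≤ 1 := by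
    rw [div_le_one (by positivity), ← sq_abs]
    exact pow_le_pow_left₀ (abs_nonneg _) hd 2
  rw [h1]
  have h2 := Real.cosh_le_exp_half_sq u
  have h3 := Real.exp_le_one_add_two_mul (v := u ^ 2 / 2) (by positivity) (by linarith)
  linarith

/-- Bernoulli's inequality gives (1 + 1/M)^M ≥ 2. -/
theorem two_pow_le_phi {M : ℕ} (hM : 0 < M) (a : ℕ) {s : ℤ} (hs : (a * M : ℤ) ≤ |s|) :
    (2 : ℝ) ^ a ≤ phi M s := by
  have hM' : (0 : ℝ) < M := by exact_mod_cast hM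
  have hβ := one_add_inv_pos hM'
  have h1 : (2 : ℝ) ≤ (1 + 1 / (M : ℝ)) ^ M := by
    have := one_add_mul_le_pow (a := 1 / (M : ℝ)) (by
      have : 0 < 1 / (M : ℝ) := by positivity
      linarith) M
    rw [mul_one_div_cancel hM'.ne'] at this
    linarith
  have h2 : (1 + 1 / (M : ℝ)) ^ |s| ≤ phi M s := by
    rcases abs_cases s with ⟨h, _⟩ | ⟨h, _⟩ <;> rw [h, phi]
    · linarith [zpow_pos hβ (-s)]
    · linarith [zpow_pos hβ s]
  refine le_trans ?_ h2
  calc (2 : ℝ) ^ a ≤ ((1 + 1 / (M : ℝ)) ^ M) ^ a := pow_le_pow_left₀ (by norm_num) h1 a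
    _ = (1 + 1 / (M : ℝ)) ^ ((a * M : ℕ) : ℤ) := by rw [zpow_natCast, ← pow_mul, mul_comm]
    _ ≤ _ := zpow_le_zpow_right₀ (by
      have : 0 < 1 / (M : ℝ) := by positivity
      linarith) (by exact_mod_cast hs)

/-- The integer weight that the algorithm computes. -/
def weight (Q : ℕ) (S M s : ℤ) : ℤ :=
  ∏ t ∈ Finset.range Q, (if (t : ℤ) < S + s then M + 1 else M) +
    ∏ t ∈ Finset.range Q, (if (t : ℤ) < S - s then M + 1 else M)

theorem prod_ite_lt (Q a : ℕ) (h : a ≤ Q) (x y : ℤ) :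
    ∏ t ∈ Finset.range Q, (if (t : ℤ) < a then x else y) = x ^ a * y ^ (Q - a) := by
  obtain ⟨d, rfl⟩ := Nat.exists_eq_add_of_le h
  rw [Finset.prod_range_add]
  have h1 : ∏ t ∈ Finset.range a, (if (t : ℤ) < a then x else y) = x ^ a := by
    rw [Finset.prod_congr rfl (g := fun _ => x) (fun t ht => if_pos (by
      exact_mod_cast Finset.mem_range.1 ht))]
    simp
  have h2 : ∏ t ∈ Finset.range d, (if ((a + t : ℕ) : ℤ) < a then x else y) = y ^ d := by
    rw [Finset.prod_congr rfl (g := fun _ => y) (fun t _ => if_neg (by push_cast; omega))]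
    simp
  rw [h1, h2]
  simp

/-- An exponent that depends on data is realized by Q factors, of which the first a equal M + 1 and
the others M: the product is M^Q β^a. The shift by S makes both exponents nonnegative, and the
factor common to all rows does not affect comparisons. -/
theorem weight_eq {Q : ℕ} {S M s : ℤ} (hM : 0 < M) (hs : |s| ≤ S) (hQ : 2 * S ≤ Q) :
    (weight Q S M s : ℝ) = (M : ℝ) ^ Q * (1 + 1 / (M : ℝ)) ^ S * phi M s := by
  have hM' : (0 : ℝ) < M := by exact_mod_cast hM
  have hβ := one_add_inv_pos hM'
  have key : ∀ a : ℤ, 0 ≤ a → a ≤ Q →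
      ((∏ t ∈ Finset.range Q, (if (t : ℤ) < a then M + 1 else M) : ℤ) : ℝ) =
        (M : ℝ) ^ Q * (1 + 1 / (M : ℝ)) ^ a := by
    intro a ha haQ
    lift a to ℕ using ha
    have haQ' : a ≤ Q := by exact_mod_cast haQ
    rw [prod_ite_lt Q a haQ']
    push_cast
    rw [zpow_natCast, show (1 + 1 / (M : ℝ)) = (M + 1) / M by field_simp, div_pow,
      ← Nat.sub_add_cancel haQ', pow_add]
    simp only [Nat.add_sub_cancel]
    field_simp
  have h1 := abs_le.1 hs
  rw [weight]
  push_cast [-Int.cast_prod]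
  rw [key _ (by linarith) (by linarith), key _ (by linarith) (by linarith), phi,
    sub_eq_add_neg, zpow_add₀ hβ.ne', zpow_add₀ hβ.ne']
  ring

/-! ### Counting and rounding -/

/-- This replaces floors and searches: for a decreasing predicate, a bounded sum of indicators finds
the first failure. -/
theorem count_eq_first {Q : ℕ} (p : ℕ → Prop) [DecidablePred p]
    (anti : ∀ s t, s ≤ t → p t → p s) (hQ : ¬ p Q) :
    ∃ c : ℕ, (∑ t ∈ Finset.range Q, if p t then (1 : ℤ) else 0) = c ∧ c ≤ Q ∧ ¬ p c ∧
      ∀ t < c, p t := by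
  have hex : ∃ t, ¬ p t := ⟨Q, hQ⟩
  refine ⟨Nat.find hex, ?_, Nat.find_min' hex hQ, Nat.find_spec hex,
    fun t ht => not_not.1 (Nat.find_min hex ht)⟩
  rw [Finset.sum_boole]
  have : Finset.filter p (Finset.range Q) = Finset.range (Nat.find hex) := by
    ext t
    simp only [Finset.mem_filter, Finset.mem_range]
    constructor
    · rintro ⟨_, h2⟩
      by_contra h
      exact Nat.find_spec hex (anti _ _ (not_lt.1 h) h2)
    · intro h
      exact ⟨h.trans_le (Nat.find_min' hex hQ), not_not.1 (Nat.find_min hex h)⟩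
  rw [this, Finset.card_range]

theorem sum_range_eq_sum_of_support {R : Type*} [AddCommMonoid R] {n : ℕ} {al : Finset ℕ}
    (hal : al ⊆ Finset.range n) (f : ℕ → R) (hf : ∀ j < n, j ∉ al → f j = 0) :
    ∑ j ∈ Finset.range n, f j = ∑ j ∈ al, f j :=
  (Finset.sum_subset hal fun j hn hj => hf j (Finset.mem_range.1 hn) hj).symm

/-- Consequences of rounding `L z / ‖z‖₁` down to an integer vector `y`. -/
structure RoundingOf (n : ℕ) (al : Finset ℕ) (L τ : ℝ) (z y : ℕ → ℤ) : Prop where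
  abs_le : ∀ j < n, |(y j : ℝ)| ≤ L
  le_norm : L ^ 2 ≤ 4 * al.card * ∑ j ∈ Finset.range n, (y j : ℝ) ^ 2
  norm_le : τ ^ 2 * ∑ j ∈ Finset.range n, (z j : ℝ) ^ 2 ≤
    4 * ∑ j ∈ Finset.range n, (y j : ℝ) ^ 2
  norm_le' : τ ^ 2 * ∑ j ∈ Finset.range n, (z j : ℝ) ^ 2 ≤ L ^ 2
  inner_le : ∀ (g : ℕ → ℝ) (G : ℝ), (∀ j ∈ al, |g j| ≤ G) →
    |∑ j ∈ Finset.range n, g j * y j - τ * ∑ j ∈ Finset.range n, g j * z j| ≤ G * al.card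

theorem roundingOf_floor {n : ℕ} {al : Finset ℕ} (hal : al ⊆ Finset.range n) {L : ℤ} (hL : 0 < L)
    (hk : 0 < al.card) (hkL : 4 * (al.card : ℝ) ^ 2 ≤ (L : ℝ) ^ 2) {z y : ℕ → ℤ}
    (hz : ∀ j < n, j ∉ al → z j = 0) (hy : ∀ j < n, j ∉ al → y j = 0) {Z : ℤ}
    (hZ : Z = ∑ j ∈ Finset.range n, |z j|) (hZ0 : 0 < Z)
    (hfl : ∀ j < n, y j * Z ≤ L * z j ∧ L * z j < (y j + 1) * Z) :
    RoundingOf n al L (L / Z) z y := by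
  have hLR : (0 : ℝ) < L := by exact_mod_cast hL
  have hZR : (0 : ℝ) < Z := by exact_mod_cast hZ0
  have hkR : (1 : ℝ) ≤ al.card := by exact_mod_cast hk
  set τ : ℝ := L / Z with hτ
  have hτ0 : 0 < τ := div_pos hLR hZR
  have hZ' : (Z : ℝ) = ∑ j ∈ al, |(z j : ℝ)| := by
    rw [hZ, sum_range_eq_sum_of_support hal _ fun j hn hj => by rw [hz j hn hj]; simp]
    push_cast; rfl
  have hτZ : τ * ∑ j ∈ al, |(z j : ℝ)| = L := by
    rw [← hZ', hτ]; field_simp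
  have herr : ∀ j < n, 0 ≤ τ * z j - y j ∧ τ * z j - y j < 1 := by
    intro j hj
    obtain ⟨h1, h2⟩ := hfl j hj
    have h1' : (y j : ℝ) * Z ≤ L * z j := by exact_mod_cast h1
    have h2' : (L : ℝ) * z j < (y j + 1) * Z := by exact_mod_cast h2
    have e : τ * z j = L * z j / Z := by rw [hτ]; ring
    constructor
    · rw [e, sub_nonneg, le_div_iff₀ hZR]; exact h1'
    · rw [e, sub_lt_iff_lt_add, div_lt_iff₀ hZR]; linarith
  have herr1 : ∀ j ∈ al, |τ * z j - y j| ≤ 1 := fun j hj => by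
    have := herr j (Finset.mem_range.1 (hal hj))
    rw [abs_le]; constructor <;> linarith
  have habs : ∀ j < n, |y j| ≤ L := by
    intro j hj
    obtain ⟨h1, h2⟩ := hfl j hj
    have h3 : |z j| ≤ Z := by
      rw [hZ]
      exact Finset.single_le_sum (f := fun j => |z j|) (fun _ _ => abs_nonneg _)
        (Finset.mem_range.2 hj)
    have h4 := _root_.abs_le.1 h3
    rw [_root_.abs_le]
    constructor
    · have : -L * Z < (y j + 1) * Z := by nlinarith
      have := lt_of_mul_lt_mul_right this hZ0.le
      omega
    · have : y j * Z ≤ L * Z := by nlinarith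
      exact le_of_mul_le_mul_right this hZ0
  have hzs : ∑ j ∈ Finset.range n, (z j : ℝ) ^ 2 = ∑ j ∈ al, (z j : ℝ) ^ 2 :=
    sum_range_eq_sum_of_support hal _ fun j hn hj => by rw [hz j hn hj]; simp
  have hys : ∑ j ∈ Finset.range n, (y j : ℝ) ^ 2 = ∑ j ∈ al, (y j : ℝ) ^ 2 :=
    sum_range_eq_sum_of_support hal _ fun j hn hj => by rw [hy j hn hj]; simp
  set X := ∑ j ∈ al, (z j : ℝ) ^ 2 with hX
  set Y := ∑ j ∈ al, (y j : ℝ) ^ 2 with hY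
  have hXL : τ ^ 2 * X ≤ L ^ 2 := by
    have h1 : X ≤ (∑ j ∈ al, |(z j : ℝ)|) ^ 2 := by
      rw [hX]
      have := Finset.sum_sq_le_sq_sum_of_nonneg (s := al) (f := fun j => |(z j : ℝ)|)
        (fun j _ => abs_nonneg _)
      simpa using this
    calc τ ^ 2 * X ≤ τ ^ 2 * (∑ j ∈ al, |(z j : ℝ)|) ^ 2 :=
          mul_le_mul_of_nonneg_left h1 (sq_nonneg _)
      _ = L ^ 2 := by rw [← mul_pow, hτZ]
  have hLX : (L : ℝ) ^ 2 ≤ al.card * (τ ^ 2 * X) := by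
    have h1 : (∑ j ∈ al, |(z j : ℝ)|) ^ 2 ≤ al.card * X := by
      have := sq_sum_le_card_mul_sum_sq (s := al) (f := fun j => |(z j : ℝ)|)
      simpa [hX] using this
    calc (L : ℝ) ^ 2 = τ ^ 2 * (∑ j ∈ al, |(z j : ℝ)|) ^ 2 := by rw [← mul_pow, hτZ]
      _ ≤ τ ^ 2 * (al.card * X) := mul_le_mul_of_nonneg_left h1 (sq_nonneg _)
      _ = _ := by ring
  -- Coordinatewise, (τz)² ≤ 2y² + 2(τz - y)², and the rounding error is at most 1.
  have hXY : τ ^ 2 * X ≤ 2 * Y + 2 * al.card := by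
    rw [hX, Finset.mul_sum, hY, Finset.mul_sum, Finset.card_eq_sum_ones]
    push_cast
    rw [Finset.mul_sum, ← Finset.sum_add_distrib]
    refine Finset.sum_le_sum fun j hj => ?_
    have h1 := sq_le_one_iff_abs_le_one (τ * z j - y j) |>.2 (herr1 j hj)
    nlinarith [sq_nonneg (τ * z j - 2 * y j)]
  -- L² ≤ 2|al|Y + 2|al|², and by `hkL` the last term is at most L²/2.
  have hmain : (L : ℝ) ^ 2 ≤ 4 * al.card * Y := by
    have h1 : (al.card : ℝ) * (τ ^ 2 * X) ≤ al.card * (2 * Y + 2 * al.card) :=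
      mul_le_mul_of_nonneg_left hXY (by linarith)
    nlinarith
  have hYk : (al.card : ℝ) ≤ Y := by
    have : (al.card : ℝ) * al.card ≤ al.card * Y := by nlinarith
    exact le_of_mul_le_mul_left this (by linarith)
  refine ⟨fun j hj => ?_, ?_, ?_, ?_, ?_⟩
  · exact_mod_cast habs j hj
  · rw [hys]; exact hmain
  · rw [hzs, hys]; linarith
  · rw [hzs]; exact hXL
  · intro g G hg
    rw [sum_range_eq_sum_of_support hal (fun j => g j * (y j : ℝ)) fun j hn hj => by
        rw [hy j hn hj]; simp,
      sum_range_eq_sum_of_support hal (fun j => g j * (z j : ℝ)) fun j hn hj => by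
        rw [hz j hn hj]; simp, Finset.mul_sum, ← Finset.sum_sub_distrib]
    refine (Finset.abs_sum_le_sum_abs _ _).trans ?_
    rw [Finset.card_eq_sum_ones]
    push_cast
    rw [Finset.mul_sum]
    refine Finset.sum_le_sum fun j hj => ?_
    rw [show g j * (y j : ℝ) - τ * (g j * z j) = g j * -(τ * z j - y j) by ring, abs_mul, abs_neg]
    exact mul_le_mul (hg j hj) (herr1 j hj) (abs_nonneg _) ((abs_nonneg _).trans (hg j hj))

/-- The rows of the quadratic form: the rows of `b`, and `x` as row `m`, restricted to `al`. -/
def formRow (m : ℕ) (b : ℕ → ℕ → ℤ) (x : ℕ → ℤ) (al : Finset ℕ) (i j : ℕ) : ℤ :=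
  (if i < m then b i j else x j) * (if j ∈ al then 1 else 0)

/-- The coefficients of the quadratic form: heavy rows and the row `m` get the value `H`. -/
def formCoeff (m : ℕ) (hv : Finset ℕ) (W : ℕ → ℤ) (H : ℤ) (i : ℕ) : ℤ :=
  if i < m then if i ∈ hv then H else W i else H

/-- The number of power iterations: with a = q - 3d, Bernoulli gives (1 + d/a)^(2N) ≥ 1 + 2Nd/a > k.
-/
theorem mul_pow_lt_pow {q k d : ℤ} (N : ℕ) (hd : 0 < d) (hN : N ≠ 0) (hq : 3 * d < q)
    (hk : k * q ≤ N * d) :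
    k * (q - 3 * d) ^ (2 * N) < (q - 2 * d) ^ (2 * N) := by
  set a := q - 3 * d with ha
  have ha0 : 0 < a := by omega
  have haR : (0 : ℝ) < a := by exact_mod_cast ha0
  have hdR : (0 : ℝ) < d := by exact_mod_cast hd
  have hka : k * a ≤ N * d := by
    rcases le_or_gt k 0 with h | h
    · exact (mul_nonpos_of_nonpos_of_nonneg h ha0.le).trans (by positivity)
    · exact (mul_le_mul_of_nonneg_left (by omega) h.le).trans hk
  have h1 := one_add_mul_le_pow (a := (d : ℝ) / a) (by
    have : 0 < (d : ℝ) / a := by positivity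
    linarith) (2 * N)
  have h2 : (k : ℝ) < (1 + (d : ℝ) / a) ^ (2 * N) := by
    refine lt_of_lt_of_le ?_ h1
    have hka' : (k : ℝ) * a ≤ N * d := by exact_mod_cast hka
    have h3 : (k : ℝ) ≤ N * (d / a) := by rw [← mul_div_assoc, le_div_iff₀ haR]; exact hka'
    have h4 : 0 ≤ (N : ℝ) * (d / a) := by positivity
    push_cast
    linarith
  have h3 : (k : ℝ) * (a : ℝ) ^ (2 * N) < ((a : ℝ) + d) ^ (2 * N) := by
    have e : ((a : ℝ) + d) = (1 + (d : ℝ) / a) * a := by field_simp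
    rw [e, mul_pow]
    exact mul_lt_mul_of_pos_right h2 (by positivity)
  have e : q - 2 * d = a + d := by omega
  rw [e]
  exact_mod_cast h3

/-- Orthogonality to the heavy rows and to x costs at most half of the living dimensions. The light
rows have squared norm at most |al|n², so averaging gives a unit vector with form at most 2n²Φ. The
gap up to 3n²Φ makes Q iterations enough, and `hQ` makes Λ = ΦQ dominate the trace. -/
theorem exists_good_direction {n m Q : ℕ} (hn : 0 < n) {al : Finset ℕ}
    (hal : al ⊆ Finset.range n)
    {b : ℕ → ℕ → ℤ} (hb : ∀ i < m, ∀ j < n, |b i j| ≤ n) {x : ℕ → ℤ} {D : ℤ} (hnD : (n : ℤ) ≤ D)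
    (hx : ∀ j < n, |x j| ≤ D) {W : ℕ → ℤ} (hW : ∀ i < m, 0 ≤ W i) {hv : Finset ℕ}
    (hcard : 2 * (hv.card + 1) ≤ al.card) {Φ R : ℤ}
    (hΦ : Φ = ∑ i ∈ Finset.range m, W i) (hΦ0 : 0 < Φ) (hR : 1 ≤ R)
    (hQ : (m + 1) * (R * (n * D ^ 2)) ≤ Q) (hQ3 : 3 * n ^ 2 < Q) :
    ∃ a ∈ al, ∀ z, z = (iterStep n (m + 1) (formRow m b x al) (formCoeff m hv W (R * Φ)) (Φ * Q))^[Q]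
        (Pi.single a 1) →
      ∑ i ∈ Finset.range (m + 1), formCoeff m hv W (R * Φ) i *
          (∑ j ∈ Finset.range n, formRow m b x al i j * z j) ^ 2 <
        (3 * n ^ 2 * Φ) * ∑ j ∈ Finset.range n, z j * z j := by
  classical
  set u := formRow m b x al with hu
  set c := formCoeff m hv W (R * Φ) with hc
  have hnZ : (1 : ℤ) ≤ n := by exact_mod_cast hn
  have hH : 0 ≤ R * Φ := by positivity
  have hWΦ : ∀ i < m, W i ≤ Φ := fun i hi => by
    rw [hΦ]
    exact Finset.single_le_sum (f := W) (fun i hi => hW i (Finset.mem_range.1 hi))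
      (Finset.mem_range.2 hi)
  have hc0 : ∀ i < m + 1, 0 ≤ c i := by
    intro i _
    simp only [hc, formCoeff]
    split_ifs with h1
    · exact hH
    · exact hW i h1
    · exact hH
  have hcH : ∀ i, c i ≤ R * Φ := by
    intro i
    simp only [hc, formCoeff]
    split_ifs with h1
    · exact le_rfl
    · exact (hWΦ i h1).trans (by nlinarith)
    · exact le_rfl
  set al' : Finset (Fin n) := Finset.univ.filter fun j => (j : ℕ) ∈ al with hal'
  have hcard' : al'.card = al.card := by
    rw [← Finset.card_map Fin.valEmbedding]
    congr 1
    ext j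
    simp only [hal', Finset.mem_map, Finset.mem_filter, Finset.mem_univ, true_and,
      Fin.valEmbedding_apply]
    constructor
    · rintro ⟨a, ha, rfl⟩; exact ha
    · intro hj; exact ⟨⟨j, Finset.mem_range.1 (hal hj)⟩, hj, rfl⟩
  have hun : ∀ i < m, ∑ j ∈ Finset.range n, u i j * u i j ≤ al.card * (n : ℤ) ^ 2 := by
    intro i hi
    rw [sum_range_eq_sum_of_support hal _ fun j _ hj => by simp [hu, formRow, hj],
      Finset.card_eq_sum_ones]
    push_cast
    rw [Finset.sum_mul]
    refine Finset.sum_le_sum fun j hj => ?_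
    have := hb i hi j (Finset.mem_range.1 (hal hj))
    simp only [hu, formRow, if_pos hi, if_pos hj, mul_one, one_mul]
    rw [← sq, ← sq_abs]
    exact pow_le_pow_left₀ (abs_nonneg _) this 2
  have huD : ∀ i, ∑ j ∈ Finset.range n, u i j * u i j ≤ n * D ^ 2 := by
    intro i
    have : ∀ j ∈ Finset.range n, u i j * u i j ≤ D ^ 2 := by
      intro j hj
      have hj' := Finset.mem_range.1 hj
      rw [← sq, ← sq_abs]
      refine pow_le_pow_left₀ (abs_nonneg _) ?_ 2
      simp only [hu, formRow, abs_mul]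
      have h1 : |(if i < m then b i j else x j)| ≤ D := by
        split_ifs with h
        · exact (hb i h j hj').trans hnD
        · exact hx j hj'
      have h2 : |(if j ∈ al then (1 : ℤ) else 0)| ≤ 1 := by split_ifs <;> simp
      calc _ ≤ D * 1 := mul_le_mul h1 h2 (abs_nonneg _) ((abs_nonneg _).trans h1)
        _ = D := mul_one _
    refine (Finset.sum_le_sum this).trans (by simp)
  have hwR : ∀ i ∈ Finset.range m \ hv, (0 : ℝ) ≤ W i := fun i hi => by
    exact_mod_cast hW i (Finset.mem_range.1 (Finset.mem_sdiff.1 hi).1)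
  obtain ⟨v, hv1, hvs, hvt, hvq⟩ := exists_unit_vector_small_form (Finset.range m \ hv)
    (insert m hv) al' (fun i => euclideanOfInt n (u i)) (fun i => (W i : ℝ)) hwR
    (U := (al.card * (n : ℤ) ^ 2 : ℤ))
    (fun i hi => by
      rw [norm_sq_euclideanOfInt]
      exact_mod_cast hun i (Finset.mem_range.1 (Finset.mem_sdiff.1 hi).1))
    (by omega)
    (by have := Finset.card_insert_le m hv; omega)
  have hμ : ∑ i ∈ Finset.range (m + 1), (c i : ℝ) * inner ℝ (euclideanOfInt n (u i)) v ^ 2 ≤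
      ((2 * n ^ 2 * Φ : ℤ) : ℝ) := by
    have e1 : ∑ i ∈ Finset.range (m + 1), (c i : ℝ) * inner ℝ (euclideanOfInt n (u i)) v ^ 2 =
        ∑ i ∈ Finset.range m \ hv, (W i : ℝ) * inner ℝ (euclideanOfInt n (u i)) v ^ 2 := by
      rw [← Finset.sum_subset (s₁ := Finset.range m \ hv) (s₂ := Finset.range (m + 1))]
      · refine Finset.sum_congr rfl fun i hi => ?_
        obtain ⟨h1, h2⟩ := Finset.mem_sdiff.1 hi
        simp [hc, formCoeff, Finset.mem_range.1 h1, h2]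
      · intro i hi
        have := Finset.mem_range.1 (Finset.mem_sdiff.1 hi).1
        exact Finset.mem_range.2 (by omega)
      · intro i hi hi'
        have hi2 : i ∈ insert m hv := by
          simp only [Finset.mem_sdiff, Finset.mem_range, not_and, not_not] at hi hi'
          rcases Nat.lt_succ_iff_lt_or_eq.1 hi with h | h
          · exact Finset.mem_insert_of_mem (hi' h)
          · rw [h]; exact Finset.mem_insert_self _ _
        rw [hvt i hi2]; simp
    rw [e1]
    have hkpos : (0 : ℝ) < al.card := by
      have : 0 < al.card := by omega
      exact_mod_cast this
    have h2 : ∑ i ∈ Finset.range m \ hv, (W i : ℝ) ≤ Φ := by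
      rw [hΦ]; push_cast
      exact Finset.sum_le_sum_of_subset_of_nonneg Finset.sdiff_subset fun i hi _ => by
        exact_mod_cast hW i (Finset.mem_range.1 hi)
    rw [hcard'] at hvq
    have h3 : (∑ i ∈ Finset.range m \ hv, (W i : ℝ)) * ((al.card * (n : ℤ) ^ 2 : ℤ) : ℝ) ≤
        Φ * (al.card * (n : ℝ) ^ 2) := by
      push_cast
      exact mul_le_mul_of_nonneg_right h2 (by positivity)
    have h4 : (∑ i ∈ Finset.range m \ hv, (W i : ℝ) * inner ℝ (euclideanOfInt n (u i)) v ^ 2) *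
        al.card ≤ ((2 * n ^ 2 * Φ : ℤ) : ℝ) * al.card := by
      refine hvq.trans ?_
      push_cast at h3 ⊢
      linarith
    exact le_of_mul_le_mul_right h4 hkpos
  have hkn : al.card ≤ n := by simpa using Finset.card_le_card hal
  have hQ3' : 3 * (n : ℤ) ^ 2 < Q := by exact_mod_cast hQ3
  obtain ⟨a, ha, h⟩ := exists_iterStep_small_form u c hc0 al' (Λ := Φ * Q)
    (by
      calc ∑ i ∈ Finset.range (m + 1), c i * ∑ j ∈ Finset.range n, u i j * u i j
          ≤ ∑ i ∈ Finset.range (m + 1), R * Φ * (n * D ^ 2) :=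
            Finset.sum_le_sum fun i hi => mul_le_mul (hcH i) (huD i)
              (Finset.sum_nonneg fun _ _ => mul_self_nonneg _) hH
        _ = Φ * ((m + 1) * (R * (n * D ^ 2))) := by
            rw [Finset.sum_const, Finset.card_range, nsmul_eq_mul]; push_cast; ring
        _ ≤ Φ * Q := mul_le_mul_of_nonneg_left hQ hΦ0.le)
    v hv1 (fun j hj => hvs j hj) (μ := 2 * n ^ 2 * Φ) (θ := 3 * n ^ 2 * Φ) hμ
    (by nlinarith) (by nlinarith) Q
    (by
      rw [hcard', show Φ * Q - 3 * n ^ 2 * Φ = Φ * (Q - 3 * n ^ 2) by ring,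
        show Φ * Q - 2 * n ^ 2 * Φ = Φ * (Q - 2 * n ^ 2) by ring, mul_pow, mul_pow, mul_left_comm]
      refine mul_lt_mul_of_pos_left (mul_pow_lt_pow Q (by positivity) (by omega) hQ3' ?_)
        (by positivity)
      have : (al.card : ℤ) ≤ n ^ 2 := by
        have : (al.card : ℤ) ≤ n := by exact_mod_cast hkn
        nlinarith
      nlinarith)
  refine ⟨a, ?_, h⟩
  simpa [hal'] using ha

/-- What the rounded direction achieves. -/
theorem rounded_direction_bounds {n m : ℕ} {al : Finset ℕ} (hal : al ⊆ Finset.range n)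
    {b : ℕ → ℕ → ℤ} (hb : ∀ i < m, ∀ j < n, |b i j| ≤ n) {x : ℕ → ℤ} {D : ℤ} (hnD : (n : ℤ) ≤ D)
    (hx : ∀ j < n, |x j| ≤ D) {W : ℕ → ℤ} (hW : ∀ i < m, 0 ≤ W i) {hv : Finset ℕ}
    (hhv : hv ⊆ Finset.range m) {Φ L : ℤ}
    (hΦ : Φ = ∑ i ∈ Finset.range m, W i) (hΦ0 : 0 < Φ) (hL : 0 < L) {z y : ℕ → ℤ}
    (htest : ∑ i ∈ Finset.range (m + 1), formCoeff m hv W (3 * L ^ 2 * Φ) i *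
          (∑ j ∈ Finset.range n, formRow m b x al i j * z j) ^ 2 ≤
        (3 * n ^ 2 * Φ) * ∑ j ∈ Finset.range n, z j * z j) {τ : ℝ}
    (hr : RoundingOf n al L τ z y) (hy : ∀ j < n, j ∉ al → y j = 0)
    (hkL : 4 * (al.card : ℝ) ^ 3 ≤ (L : ℝ) ^ 2) :
    (∀ i ∈ hv, |∑ j ∈ Finset.range n, (b i j : ℝ) * y j| ≤ 2 * n ^ 2) ∧
    |∑ j ∈ Finset.range n, (x j : ℝ) * y j| ≤ 2 * n * D ∧
    ∑ i ∈ Finset.range m, (W i : ℝ) * (∑ j ∈ Finset.range n, (b i j : ℝ) * y j) ^ 2 ≤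
      26 * n ^ 2 * (∑ i ∈ Finset.range m, (W i : ℝ)) * ∑ j ∈ Finset.range n, (y j : ℝ) ^ 2 := by
  have hLR : (0 : ℝ) < L := by exact_mod_cast hL
  have hkn : (al.card : ℝ) ≤ n := by
    have : al.card ≤ n := by simpa using Finset.card_le_card hal
    exact_mod_cast this
  have hnDR : (n : ℝ) ≤ D := by exact_mod_cast hnD
  have hΦR : (0 : ℝ) < Φ := by exact_mod_cast hΦ0
  have hΦsum : (Φ : ℝ) = ∑ i ∈ Finset.range m, (W i : ℝ) := by rw [hΦ]; push_cast; rfl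
  set g : ℕ → ℕ → ℝ := fun i j => (formRow m b x al i j : ℝ) with hg
  set Z := ∑ j ∈ Finset.range n, (z j : ℝ) ^ 2 with hZ
  set Y := ∑ j ∈ Finset.range n, (y j : ℝ) ^ 2 with hY
  have hZ0 : 0 ≤ Z := Finset.sum_nonneg fun _ _ => sq_nonneg _
  have hY0 : 0 ≤ Y := Finset.sum_nonneg fun _ _ => sq_nonneg _
  set H : ℤ := 3 * L ^ 2 * Φ with hH
  have hH0 : 0 ≤ H := by positivity
  have hHΦ : Φ ≤ H := by
    have : 1 ≤ 3 * L ^ 2 := by nlinarith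
    rw [hH]; nlinarith
  have hWΦ : ∀ i < m, W i ≤ Φ := fun i hi => by
    rw [hΦ]
    exact Finset.single_le_sum (f := W) (fun i hi => hW i (Finset.mem_range.1 hi))
      (Finset.mem_range.2 hi)
  have hcW : ∀ i < m, W i ≤ formCoeff m hv W H i := by
    intro i hi
    simp only [formCoeff, if_pos hi]
    split_ifs
    · exact (hWΦ i hi).trans hHΦ
    · exact le_rfl
  have hc0 : ∀ i, i < m + 1 → 0 ≤ formCoeff m hv W H i := by
    intro i hi
    by_cases h : i < m
    · exact (hW i h).trans (hcW i h)
    · simp only [formCoeff, if_neg h]; exact hH0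
  have ht : ∑ i ∈ Finset.range (m + 1), (formCoeff m hv W H i : ℝ) *
      (∑ j ∈ Finset.range n, g i j * z j) ^ 2 ≤ 3 * n ^ 2 * Φ * Z := by
    have : ((∑ i ∈ Finset.range (m + 1), formCoeff m hv W H i *
          (∑ j ∈ Finset.range n, formRow m b x al i j * z j) ^ 2 : ℤ) : ℝ) ≤
        (((3 * n ^ 2 * Φ) * ∑ j ∈ Finset.range n, z j * z j : ℤ) : ℝ) := by exact_mod_cast htest
    push_cast at this
    simpa only [hg, hZ, sq] using this
  -- The purpose of H = 3L²Φ: a single term of the form gives L²⟨g_i, z⟩² ≤ n²‖z‖², and τ‖z‖ ≤ L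
  -- then bounds the scaled inner product by n.
  have hheavy : ∀ i < m + 1, formCoeff m hv W H i = H →
      |τ * ∑ j ∈ Finset.range n, g i j * z j| ≤ n := by
    intro i hi hcH
    have h1 : (H : ℝ) * (∑ j ∈ Finset.range n, g i j * z j) ^ 2 ≤ 3 * n ^ 2 * Φ * Z := by
      refine le_trans ?_ ht
      have e : (H : ℝ) * (∑ j ∈ Finset.range n, g i j * z j) ^ 2 =
        (formCoeff m hv W H i : ℝ) * (∑ j ∈ Finset.range n, g i j * z j) ^ 2 := by rw [hcH]
      rw [e]
      exact Finset.single_le_sum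
        (f := fun i => (formCoeff m hv W H i : ℝ) * (∑ j ∈ Finset.range n, g i j * z j) ^ 2)
        (fun i hi => mul_nonneg (by exact_mod_cast hc0 i (Finset.mem_range.1 hi)) (sq_nonneg _))
        (Finset.mem_range.2 hi)
    rw [hH] at h1
    push_cast at h1
    have h2 : (3 * (Φ : ℝ)) * (L ^ 2 * (∑ j ∈ Finset.range n, g i j * z j) ^ 2) ≤
        (3 * (Φ : ℝ)) * (n ^ 2 * Z) := by linarith
    have h3 := le_of_mul_le_mul_left h2 (by positivity)
    have h4 : (L : ℝ) ^ 2 * (τ * ∑ j ∈ Finset.range n, g i j * z j) ^ 2 ≤ (L : ℝ) ^ 2 * n ^ 2 := by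
      calc (L : ℝ) ^ 2 * (τ * ∑ j ∈ Finset.range n, g i j * z j) ^ 2
          = τ ^ 2 * (L ^ 2 * (∑ j ∈ Finset.range n, g i j * z j) ^ 2) := by ring
        _ ≤ τ ^ 2 * (n ^ 2 * Z) := mul_le_mul_of_nonneg_left h3 (sq_nonneg _)
        _ = n ^ 2 * (τ ^ 2 * Z) := by ring
        _ ≤ n ^ 2 * L ^ 2 := mul_le_mul_of_nonneg_left hr.norm_le' (sq_nonneg _)
        _ = _ := by ring
    exact abs_le_of_sq_le_sq (le_of_mul_le_mul_left h4 (by positivity)) (by positivity)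
  have hrow : ∀ i < m, ∑ j ∈ Finset.range n, (b i j : ℝ) * y j =
      ∑ j ∈ Finset.range n, g i j * y j := by
    intro i hi
    refine Finset.sum_congr rfl fun j hjn => ?_
    by_cases hj : j ∈ al
    · simp [hg, formRow, hi, hj]
    · simp [hy j (Finset.mem_range.1 hjn) hj]
  have hxrow : ∑ j ∈ Finset.range n, (x j : ℝ) * y j =
      ∑ j ∈ Finset.range n, g m j * y j := by
    refine Finset.sum_congr rfl fun j hjn => ?_
    by_cases hj : j ∈ al
    · simp [hg, formRow, hj]
    · simp [hy j (Finset.mem_range.1 hjn) hj]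
  have hgn : ∀ i < m, ∀ j ∈ al, |g i j| ≤ n := by
    intro i hi j hj
    have h := hb i hi j (Finset.mem_range.1 (hal hj))
    have h' : |(b i j : ℝ)| ≤ n := by exact_mod_cast h
    simpa [hg, formRow, hi, hj] using h'
  have hgD : ∀ j ∈ al, |g m j| ≤ D := by
    intro j hj
    have h := hx j (Finset.mem_range.1 (hal hj))
    have h' : |(x j : ℝ)| ≤ D := by exact_mod_cast h
    simpa [hg, formRow, hj] using h'
  have hnk : (n : ℝ) * al.card ≤ n ^ 2 := by rw [sq]; exact mul_le_mul_of_nonneg_left hkn (by positivity)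
  have hn0 : (0 : ℝ) ≤ n := by positivity
  refine ⟨fun i hi => ?_, ?_, ?_⟩
  · have him := Finset.mem_range.1 (hhv hi)
    rw [hrow i him]
    have h1 := hheavy i (by omega) (by simp [formCoeff, him, hi])
    have h2 := hr.inner_le (g i) n (hgn i him)
    have h4 : (n : ℝ) ≤ n ^ 2 := by exact_mod_cast Nat.le_self_pow two_ne_zero n
    rw [abs_le] at h1 h2 ⊢
    constructor <;> linarith
  · rw [hxrow]
    have h1 := hheavy m (by omega) (by simp [formCoeff])
    have h2 := hr.inner_le (g m) D hgD
    have h3 : (D : ℝ) * al.card ≤ n * D := by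
      rw [mul_comm]; exact mul_le_mul_of_nonneg_right hkn (hn0.trans hnDR)
    have h4 : (n : ℝ) ≤ n * D := by
      have : (n : ℤ) ≤ n * D := by
        rcases Nat.eq_zero_or_pos n with h | h
        · subst h; simp
        · have : (1 : ℤ) ≤ n := by exact_mod_cast h
          nlinarith
      exact_mod_cast this
    rw [abs_le] at h1 h2 ⊢
    constructor <;> linarith
  · have h1 : ∀ i < m, (∑ j ∈ Finset.range n, (b i j : ℝ) * y j) ^ 2 ≤
        2 * τ ^ 2 * (∑ j ∈ Finset.range n, g i j * z j) ^ 2 + 2 * (n * al.card) ^ 2 := by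
      intro i hi
      rw [hrow i hi]
      have h2 := hr.inner_le (g i) n (hgn i hi)
      have h3 := sq_le_sq' (abs_le.1 h2).1 (abs_le.1 h2).2
      nlinarith [sq_nonneg (∑ j ∈ Finset.range n, g i j * y j -
        2 * (τ * ∑ j ∈ Finset.range n, g i j * z j))]
    have h2 : ∑ i ∈ Finset.range m, (W i : ℝ) * (∑ j ∈ Finset.range n, g i j * z j) ^ 2 ≤
        3 * n ^ 2 * Φ * Z := by
      refine le_trans ?_ ht
      rw [Finset.sum_range_succ]
      refine le_trans (Finset.sum_le_sum fun i hi => ?_) (le_add_of_nonneg_right (mul_nonneg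
        (by exact_mod_cast hc0 m (by omega)) (sq_nonneg _)))
      exact mul_le_mul_of_nonneg_right (by exact_mod_cast hcW i (Finset.mem_range.1 hi))
        (sq_nonneg _)
    have hkY : (al.card : ℝ) ^ 2 ≤ Y := by
      rcases Nat.eq_zero_or_pos al.card with h | h
      · rw [h]; simpa using hY0
      · have hk : (0 : ℝ) < al.card := by exact_mod_cast h
        have h3 := hkL.trans hr.le_norm
        have h4 : (4 * (al.card : ℝ)) * al.card ^ 2 ≤ (4 * al.card) * Y := by linarith
        exact le_of_mul_le_mul_left h4 (by positivity)
    -- 26 = 2·3·4 + 2: the form at τz, with τ²‖z‖² ≤ 4‖y‖², plus the rounding error, with |al|² ≤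
    -- ‖y‖².
    calc ∑ i ∈ Finset.range m, (W i : ℝ) * (∑ j ∈ Finset.range n, (b i j : ℝ) * y j) ^ 2
        ≤ ∑ i ∈ Finset.range m, (W i : ℝ) * (2 * τ ^ 2 * (∑ j ∈ Finset.range n, g i j * z j) ^ 2 +
            2 * (n * al.card) ^ 2) :=
          Finset.sum_le_sum fun i hi => mul_le_mul_of_nonneg_left (h1 i (Finset.mem_range.1 hi))
            (by exact_mod_cast hW i (Finset.mem_range.1 hi))
      _ = 2 * τ ^ 2 * ∑ i ∈ Finset.range m, (W i : ℝ) * (∑ j ∈ Finset.range n, g i j * z j) ^ 2 +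
            2 * (n * al.card) ^ 2 * Φ := by
          rw [hΦsum, Finset.mul_sum, Finset.mul_sum, ← Finset.sum_add_distrib]
          exact Finset.sum_congr rfl fun i _ => by ring
      _ ≤ 2 * τ ^ 2 * (3 * n ^ 2 * Φ * Z) + 2 * (n * al.card) ^ 2 * Φ := by
          gcongr
      _ = 6 * n ^ 2 * Φ * (τ ^ 2 * Z) + 2 * n ^ 2 * Φ * al.card ^ 2 := by ring
      _ ≤ 6 * n ^ 2 * Φ * (4 * Y) + 2 * n ^ 2 * Φ * Y := by
          have := hr.norm_le
          gcongr
      _ = 26 * n ^ 2 * (∑ i ∈ Finset.range m, (W i : ℝ)) * Y := by rw [← hΦsum]; ring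

/-- The better one of the two signs increases the potential by a small factor. -/
theorem potential_growth {m : ℕ} {M : ℝ} (hM : 0 < M) (s d : ℕ → ℤ)
    (hd : ∀ i < m, |(d i : ℝ)| ≤ M) {κ : ℝ}
    (hκ : ∑ i ∈ Finset.range m, phi M (s i) * (d i : ℝ) ^ 2 ≤
      κ * ∑ i ∈ Finset.range m, phi M (s i)) :
    ∑ i ∈ Finset.range m, phi M (s i + d i) + ∑ i ∈ Finset.range m, phi M (s i - d i) ≤
      2 * ((1 + κ / M ^ 2) * ∑ i ∈ Finset.range m, phi M (s i)) := by
  rw [← Finset.sum_add_distrib]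
  calc ∑ i ∈ Finset.range m, (phi M (s i + d i) + phi M (s i - d i))
      ≤ ∑ i ∈ Finset.range m, phi M (s i) * (2 * (1 + (d i : ℝ) ^ 2 / M ^ 2)) := by
        refine Finset.sum_le_sum fun i hi => ?_
        rw [phi_add_phi_sub hM]
        exact mul_le_mul_of_nonneg_left (phi_le hM (hd i (Finset.mem_range.1 hi))) (phi_pos hM _).le
    _ = 2 * (∑ i ∈ Finset.range m, phi M (s i) +
          (∑ i ∈ Finset.range m, phi M (s i) * (d i : ℝ) ^ 2) / M ^ 2) := by
        rw [Finset.sum_div, ← Finset.sum_add_distrib, Finset.mul_sum]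
        exact Finset.sum_congr rfl fun i _ => by ring
    _ ≤ 2 * (∑ i ∈ Finset.range m, phi M (s i) +
          (κ * ∑ i ∈ Finset.range m, phi M (s i)) / M ^ 2) := by gcongr
    _ = _ := by ring

/-- Few rows are heavy. -/
theorem card_heavy_le {m k ℓ : ℕ} (hℓ : 1 ≤ ℓ) (hk : 4 * m ≤ 2 ^ ℓ * k) {M : ℕ} (hM : 0 < M) (s : ℕ → ℤ)
    {hv : Finset ℕ} (hhv : hv ⊆ Finset.range m) (hs : ∀ i ∈ hv, (80 * ℓ * M : ℤ) ≤ |s i|)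
    (hF : ∑ i ∈ Finset.range m, phi M (s i) ≤ 2 * m * Real.exp (52 * ℓ)) : 16 * hv.card ≤ k := by
  have hMR : (0 : ℝ) < M := by exact_mod_cast hM
  have h1 : (hv.card : ℝ) * 2 ^ (80 * ℓ) ≤ ∑ i ∈ Finset.range m, phi M (s i) := by
    calc (hv.card : ℝ) * 2 ^ (80 * ℓ) = ∑ i ∈ hv, (2 : ℝ) ^ (80 * ℓ) := by simp
      _ ≤ ∑ i ∈ hv, phi M (s i) := Finset.sum_le_sum fun i hi =>
          two_pow_le_phi hM _ (by push_cast; exact hs i hi)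
      _ ≤ _ := Finset.sum_le_sum_of_subset_of_nonneg hhv fun _ _ _ => (phi_pos hMR _).le
  -- 52 / log 2 < 76. The threshold 80 leaves a surplus factor 2^(3ℓ) ≥ 8, hence the final 16.
  have h2 : Real.exp (52 * ℓ) ≤ 2 ^ (76 * ℓ) := by
    have : (2 : ℝ) ^ (76 * ℓ) = Real.exp (Real.log 2 * (76 * ℓ : ℕ)) := by
      rw [← Real.rpow_natCast, Real.rpow_def_of_pos (by norm_num)]
    rw [this, Real.exp_le_exp]
    push_cast
    have := Real.log_two_gt_d9
    have h0 : (0 : ℝ) ≤ ℓ := by positivity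
    nlinarith
  have hk' : (4 : ℝ) * m ≤ 2 ^ ℓ * k := by exact_mod_cast hk
  have h3 : (hv.card : ℝ) * 2 ^ (80 * ℓ) ≤ 2 ^ ℓ * k / 2 * 2 ^ (76 * ℓ) := by
    refine h1.trans (hF.trans ?_)
    have : (2 : ℝ) * m ≤ 2 ^ ℓ * k / 2 := by linarith
    exact mul_le_mul this h2 (Real.exp_pos _).le (by positivity)
  have h4 : (hv.card : ℝ) * 2 ^ (80 * ℓ) * 2 ≤ k * 2 ^ (77 * ℓ) := by
    rw [show 77 * ℓ = ℓ + 76 * ℓ by ring, pow_add]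
    nlinarith
  have h5 : hv.card * 2 ^ (80 * ℓ) * 2 ≤ k * 2 ^ (77 * ℓ) := by exact_mod_cast h4
  rw [show 80 * ℓ = 3 * ℓ + 77 * ℓ by ring, pow_add, ← mul_assoc, mul_right_comm] at h5
  have h6 := Nat.le_of_mul_le_mul_right h5 (by positivity)
  have h7 : 2 ^ 3 ≤ 2 ^ (3 * ℓ) := Nat.pow_le_pow_right (by norm_num) (by omega)
  have h8 := Nat.mul_le_mul_left hv.card h7
  omega

/-! ### The invariant of the walk -/

/-- L is the ℓ¹ norm to which a direction is scaled before rounding, D the half-width of the box.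
Then ‖y‖² ≥ L²/(4n) = 256n^7, and half of it, 128n^7 = 2n²D, pays for a heavy row's motion by 2n² in
one step. Also nL = D/2, so rounding the frozen coordinates at the end is cheap. -/
def stepLen (n : ℕ) : ℤ := 32 * n ^ 4

def boxSize (n : ℕ) : ℤ := 64 * n ^ 5

def rowSum (n : ℕ) (b : ℕ → ℕ → ℤ) (x : ℕ → ℤ) (i : ℕ) : ℤ := ∑ j ∈ Finset.range n, b i j * x j

/-- The margin `stepLen n` ensures that one step, with either sign, stays in the box. -/
def aliveSet (n : ℕ) (x : ℕ → ℤ) : Finset ℕ :=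
  (Finset.range n).filter fun j => |x j| < boxSize n - stepLen n

noncomputable def energy (n : ℕ) (x : ℕ → ℤ) : ℝ := ∑ j ∈ Finset.range n, (x j : ℝ) ^ 2

/-- One more than the first `t` with `4 m ≤ 2 ^ t k`. -/
def levelOf (Q m k : ℕ) : ℕ := 1 + ((Finset.range Q).filter fun t => 2 ^ t * k < 4 * m).card

/-- The first `r ≥ 1` with `k ≤ r ^ 2 ℓ`. -/
def radiusOf (Q ℓ k : ℕ) : ℕ := 1 + ((Finset.range Q).filter fun t => (t + 1) ^ 2 * ℓ < k).card

/-- The scale of the potential function. -/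
def scaleOf (n Q m k : ℕ) : ℕ := 64 * n ^ 6 * radiusOf Q (levelOf Q m k) k

/-- The threshold for heavy rows. -/
def threshold (n Q m k : ℕ) : ℕ := 80 * levelOf Q m k * scaleOf n Q m k

/-- The target discrepancy of a phase with `k` living coordinates. -/
noncomputable def phaseBound (m k : ℕ) : ℝ := √(k * Real.log (4 * m / k))

/-- As k ≤ m, the first t with 4m ≤ 2^t k is positive, so its predecessor violates the inequality.
This is the source of the upper bound. -/
theorem levelOf_spec {Q m k : ℕ} (hk : 0 < k) (hkm : k ≤ m) (hQ : 4 * m ≤ Q) :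
    1 ≤ levelOf Q m k ∧ 4 * m ≤ 2 ^ levelOf Q m k * k ∧
      2 ^ levelOf Q m k * k < 16 * m := by
  obtain ⟨c, hc, -, h1, h2⟩ := count_eq_first (Q := Q) (fun t => 2 ^ t * k < 4 * m)
    (fun s t hst h => (Nat.mul_le_mul_right k (Nat.pow_le_pow_right (by norm_num) hst)).trans_lt h)
    (by
      have : Q < 2 ^ Q := Nat.lt_two_pow_self
      nlinarith)
  rw [Finset.sum_boole] at hc
  have hc' : ((Finset.range Q).filter fun t => 2 ^ t * k < 4 * m).card = c := by exact_mod_cast hc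
  have hc0 : c ≠ 0 := by
    rintro rfl
    simp at h1
    omega
  obtain ⟨d, rfl⟩ := Nat.exists_eq_succ_of_ne_zero hc0
  have h3 := h2 d (Nat.lt_succ_self d)
  simp only [levelOf, hc', not_lt, Nat.succ_eq_add_one, pow_succ, pow_add] at h1 h3 ⊢
  refine ⟨by omega, ?_, ?_⟩ <;> nlinarith

theorem radiusOf_spec {Q ℓ k : ℕ} (hℓ : 1 ≤ ℓ) (hQ : k ≤ Q) :
    k ≤ radiusOf Q ℓ k ^ 2 * ℓ ∧ (radiusOf Q ℓ k = 1 ∨ (radiusOf Q ℓ k - 1) ^ 2 * ℓ < k) ∧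
      1 ≤ radiusOf Q ℓ k := by
  obtain ⟨c, hc, -, h1, h2⟩ := count_eq_first (Q := Q) (fun t => (t + 1) ^ 2 * ℓ < k)
    (fun s t hst h => by
      have : (s + 1) ^ 2 * ℓ ≤ (t + 1) ^ 2 * ℓ :=
        Nat.mul_le_mul_right _ (Nat.pow_le_pow_left (by omega) 2)
      omega)
    (by
      have h1 : Q + 1 ≤ (Q + 1) ^ 2 := Nat.le_self_pow two_ne_zero _
      have h2 : (Q + 1) ^ 2 * 1 ≤ (Q + 1) ^ 2 * ℓ := Nat.mul_le_mul_left _ hℓ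
      omega)
  rw [Finset.sum_boole] at hc
  have hc' : ((Finset.range Q).filter fun t => (t + 1) ^ 2 * ℓ < k).card = c := by exact_mod_cast hc
  simp only [radiusOf, hc', not_lt] at h1 ⊢
  refine ⟨by rwa [add_comm], ?_, by omega⟩
  rcases Nat.eq_zero_or_pos c with h | h
  · left; omega
  · right
    have h3 := h2 (c - 1) (by omega)
    rw [Nat.sub_add_cancel h] at h3
    simpa using h3

/-- Put Λ = log(4m/k) ≥ 2 log 2. Using log u ≤ u - 1 for u = k/(2k'), the square of the left side is
at most (k/2)(Λ + log 2) ≤ (3/4)kΛ, and 3/4 < (7/8)². -/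
theorem phaseBound_half {m k k' : ℕ} (hk : 2 * k' ≤ k) (hkm : k ≤ m) :
    phaseBound m k' ≤ 7 / 8 * phaseBound m k := by
  rcases Nat.eq_zero_or_pos k' with h0 | h0
  · subst h0
    simp only [phaseBound, Nat.cast_zero, zero_mul, Real.sqrt_zero]
    positivity
  have hk'R : (0 : ℝ) < k' := by exact_mod_cast h0
  have hkR : (0 : ℝ) < k := by
    have : 0 < k := by omega
    exact_mod_cast this
  have hmk : (k : ℝ) ≤ m := by exact_mod_cast hkm
  have h2 : (2 : ℝ) * k' ≤ k := by exact_mod_cast hk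
  have hmR : (0 : ℝ) < m := by linarith
  set Λ := Real.log (4 * m / k) with hΛ
  have hΛ2 : 2 * Real.log 2 ≤ Λ := by
    rw [← Real.log_rpow (by norm_num)]
    refine Real.log_le_log (by norm_num) ?_
    rw [le_div_iff₀ hkR]
    norm_num
    linarith
  have hl2 := Real.log_two_gt_d9
  have hl2' := Real.log_two_lt_d9
  have h3 : Real.log (4 * m / k') = Λ + (Real.log 2 + Real.log (k / (2 * k'))) := by
    rw [hΛ, ← Real.log_mul (by norm_num) (by positivity), ← Real.log_mul (by positivity) (by positivity)]
    congr 1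
    field_simp
  have h4 : Real.log (k / (2 * k')) ≤ k / (2 * k') - 1 :=
    Real.log_le_sub_one_of_pos (by positivity)
  have h5 : (k' : ℝ) * Real.log (4 * m / k') ≤ (7 / 8) ^ 2 * (k * Λ) := by
    have h6 : (k' : ℝ) * Real.log (k / (2 * k')) ≤ k / 2 - k' := by
      calc (k' : ℝ) * Real.log (k / (2 * k')) ≤ k' * (k / (2 * k') - 1) :=
            mul_le_mul_of_nonneg_left h4 hk'R.le
        _ = k / 2 - k' := by field_simp
    rw [h3]
    nlinarith [mul_nonneg (sub_nonneg.2 h2) (sub_nonneg.2 hΛ2)]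
  rw [phaseBound, phaseBound, ← Real.sqrt_sq (show (0 : ℝ) ≤ 7 / 8 by norm_num), ← Real.sqrt_mul (by norm_num)]
  exact Real.sqrt_le_sqrt h5

/-- The number of rows, columns, the loop bound, and the rounded matrix. -/
structure Params (n m Q : ℕ) (b : ℕ → ℕ → ℤ) : Prop where
  hn : 0 < n
  hnm : n ≤ m
  hQ : 3 * 2 ^ 22 * (m + 1) * n ^ 19 ≤ Q
  hb : ∀ i < m, ∀ j < n, |b i j| ≤ n

/-- The invariant after `t` steps, with position `x`; the current phase started at `x₀` with `k₀`
living coordinates. -/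
structure WalkInv (n m Q : ℕ) (b : ℕ → ℕ → ℤ) (t : ℕ) (x x₀ : ℕ → ℤ) (k₀ : ℕ) : Prop where
  box : ∀ j < n, |x j| ≤ boxSize n
  box₀ : ∀ j < n, |x₀ j| ≤ boxSize n
  le : k₀ ≤ n
  subset : aliveSet n x ⊆ aliveSet n x₀
  card_le : (aliveSet n x₀).card ≤ k₀
  frozen : ∀ j < n, j ∉ aliveSet n x₀ → x j = x₀ j
  energy_le : energy n x₀ ≤ energy n x
  potential : 0 < k₀ → ∑ i ∈ Finset.range m, phi (scaleOf n Q m k₀) (rowSum n b (x - x₀) i) ≤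
    2 * m * Real.exp (52 * n ^ 2 * (energy n x - energy n x₀) / scaleOf n Q m k₀ ^ 2)
  row : ∀ i < m, |(rowSum n b (x - x₀) i : ℝ)| ≤
    threshold n Q m k₀ + 64 * n ^ 6 + (energy n x - energy n x₀) / (64 * n ^ 5)
  start : ∀ i < m, |(rowSum n b x₀ i : ℝ)| ≤
    64 * n ^ 6 * (2592 * (phaseBound m n - phaseBound m k₀))
  progress : t * (128 * n ^ 7) ≤ energy n x ∨ (aliveSet n x).card < 16

section

variable {n m Q : ℕ} {b : ℕ → ℕ → ℤ} {t : ℕ} {x x₀ : ℕ → ℤ} {k₀ : ℕ}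

theorem Params.hn1 (P : Params n m Q b) : (1 : ℝ) ≤ n := by exact_mod_cast P.hn

theorem Params.pow_le (P : Params n m Q b) {a e c : ℕ} (ha : a ≤ 3 * 2 ^ 22) (he : e ≤ 19)
    (hc : c ≤ m + 1) : a * c * n ^ e ≤ Q := by
  refine le_trans ?_ P.hQ
  exact Nat.mul_le_mul (Nat.mul_le_mul ha hc) (Nat.pow_le_pow_right P.hn he)

theorem rowSum_add (n : ℕ) (b : ℕ → ℕ → ℤ) (x y : ℕ → ℤ) (i : ℕ) :
    rowSum n b (x + y) i = rowSum n b x i + rowSum n b y i := by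
  simp [rowSum, mul_add, Finset.sum_add_distrib]

theorem rowSum_zero (n : ℕ) (b : ℕ → ℕ → ℤ) (i : ℕ) : rowSum n b 0 i = 0 := by simp [rowSum]

theorem WalkInv.energy_sub_le (h : WalkInv n m Q b t x x₀ k₀) :
    energy n x - energy n x₀ ≤ k₀ * (64 * n ^ 5) ^ 2 := by
  rw [energy, energy, ← Finset.sum_sub_distrib,
    ← Finset.sum_subset (s₁ := aliveSet n x₀) (Finset.filter_subset _ _)
      fun j hj hj' => by rw [h.frozen j (Finset.mem_range.1 hj) hj', sub_self]]
  have h1 : ∀ j ∈ aliveSet n x₀, (x j : ℝ) ^ 2 - (x₀ j : ℝ) ^ 2 ≤ (64 * n ^ 5) ^ 2 := by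
    intro j hj
    have h2 := h.box j (Finset.mem_range.1 (Finset.mem_filter.1 hj).1)
    have h3 : |(x j : ℝ)| ≤ 64 * n ^ 5 := by
      have : ((|x j| : ℤ) : ℝ) ≤ (boxSize n : ℝ) := by exact_mod_cast h2
      simpa [boxSize] using this
    have h4 := pow_le_pow_left₀ (abs_nonneg _) h3 2
    rw [sq_abs] at h4
    nlinarith [sq_nonneg (x₀ j : ℝ)]
  refine (Finset.sum_le_sum h1).trans ?_
  rw [Finset.sum_const, nsmul_eq_mul]
  have : ((aliveSet n x₀).card : ℝ) ≤ k₀ := by exact_mod_cast h.card_le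
  gcongr

theorem WalkInv.abs_rowSum_le (P : Params n m Q b) (h : WalkInv n m Q b t x x₀ k₀) {i : ℕ}
    (hi : i < m) : |rowSum n b (x - x₀) i| ≤ k₀ * (2 * n * boxSize n) := by
  have hB : 0 ≤ boxSize n := by rw [boxSize]; positivity
  rw [rowSum, ← Finset.sum_subset (s₁ := aliveSet n x₀) (Finset.filter_subset _ _)
      fun j hj hj' => by simp [h.frozen j (Finset.mem_range.1 hj) hj']]
  refine (Finset.abs_sum_le_sum_abs _ _).trans ?_
  have h1 : ∀ j ∈ aliveSet n x₀, |b i j * (x - x₀) j| ≤ 2 * n * boxSize n := by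
    intro j hj
    have hj' := Finset.mem_range.1 (Finset.mem_filter.1 hj).1
    have h2 : |x j - x₀ j| ≤ 2 * boxSize n := (abs_sub _ _).trans (by
      linarith [h.box j hj', h.box₀ j hj'])
    rw [abs_mul, Pi.sub_apply]
    calc |b i j| * |x j - x₀ j| ≤ n * (2 * boxSize n) :=
          mul_le_mul (P.hb i hi j hj') h2 (abs_nonneg _) (by positivity)
      _ = _ := by ring
  refine (Finset.sum_le_sum h1).trans ?_
  rw [Finset.sum_const, nsmul_eq_mul]
  have : ((aliveSet n x₀).card : ℤ) ≤ k₀ := by exact_mod_cast h.card_le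
  exact mul_le_mul_of_nonneg_right this (by positivity)

theorem Params.four_mul_le (P : Params n m Q b) : 4 * m ≤ Q := by
  have := P.pow_le (a := 4) (e := 0) (c := m) (by norm_num) (by norm_num) (by omega)
  simpa using this

/-- With q = √(k₀ℓ), the radius satisfies ρℓ ≤ 2q when ℓ ≤ k₀, so threshold, overshoot and drift add
up to at most nD(160q + 2). The factor 324 comes from 162q and q ≤ 2 · `phaseBound m k₀`. -/
theorem WalkInv.row_le_phaseBound (P : Params n m Q b) (h : WalkInv n m Q b t x x₀ k₀) {i : ℕ}
    (hi : i < m) :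
    |(rowSum n b (x - x₀) i : ℝ)| ≤ 64 * n ^ 6 * (324 * phaseBound m k₀) := by
  have htriv : |(rowSum n b (x - x₀) i : ℝ)| ≤ 64 * n ^ 6 * (2 * k₀) := by
    have h1 : ((|rowSum n b (x - x₀) i| : ℤ) : ℝ) ≤ ((k₀ * (2 * n * boxSize n) : ℤ) : ℝ) := by
      exact_mod_cast h.abs_rowSum_le P hi
    push_cast [boxSize] at h1
    refine h1.trans (le_of_eq ?_)
    ring
  rcases Nat.eq_zero_or_pos k₀ with h0 | h0
  · subst h0
    simpa [phaseBound] using htriv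
  have hn1 := P.hn1
  have hkm : k₀ ≤ m := h.le.trans P.hnm
  obtain ⟨hℓ1, -, hℓ2⟩ := levelOf_spec h0 hkm P.four_mul_le
  obtain ⟨-, hρ, hρ1⟩ := radiusOf_spec (k := k₀) hℓ1 (hkm.trans ((by omega : m ≤ 4 * m).trans P.four_mul_le))
  have hrow := h.row i hi
  have hen := h.energy_sub_le
  rw [threshold, scaleOf] at hrow
  set ℓ := levelOf Q m k₀ with hℓ
  set ρ := radiusOf Q ℓ k₀ with hρdef
  have hkR : (1 : ℝ) ≤ k₀ := by exact_mod_cast h0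
  have hℓR : (1 : ℝ) ≤ ℓ := by exact_mod_cast hℓ1
  have hmR : (k₀ : ℝ) ≤ m := by exact_mod_cast hkm
  set q := √((k₀ : ℝ) * ℓ) with hq
  have hq1 : 1 ≤ q := by
    rw [hq, Real.one_le_sqrt]; nlinarith
  have hqq : q ^ 2 = k₀ * ℓ := Real.sq_sqrt (by positivity)
  -- the level is comparable with the logarithm
  have hqf : q ≤ 2 * phaseBound m k₀ := by
    have hl2 := Real.log_two_gt_d9
    have h1 : (ℓ : ℝ) * Real.log 2 ≤ Real.log (16 * m / k₀) := by
      rw [← Real.log_pow]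
      refine Real.log_le_log (by positivity) ?_
      rw [le_div_iff₀ (by linarith)]
      exact_mod_cast hℓ2.le
    have h2 : Real.log (16 * m / k₀) = 2 * Real.log 2 + Real.log (4 * m / k₀) := by
      rw [← Real.log_rpow (by norm_num), ← Real.log_mul (by norm_num) (by
        have : (0 : ℝ) < 4 * m / k₀ := by
          apply div_pos <;> linarith
        exact this.ne')]
      congr 1
      norm_num
      ring
    have h3 : 2 * Real.log 2 ≤ Real.log (4 * m / k₀) := by
      rw [← Real.log_rpow (by norm_num)]
      refine Real.log_le_log (by norm_num) ?_
      rw [le_div_iff₀ (by linarith)]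
      norm_num
      linarith
    have h4 : (ℓ : ℝ) ≤ 4 * Real.log (4 * m / k₀) := by nlinarith
    rw [hq, phaseBound, show (2 : ℝ) = √(2 ^ 2) by rw [Real.sqrt_sq (by norm_num)],
      ← Real.sqrt_mul (by norm_num)]
    refine Real.sqrt_le_sqrt ?_
    nlinarith
  have key : |(rowSum n b (x - x₀) i : ℝ)| ≤ 64 * n ^ 6 * (162 * q) := by
    -- For ℓ > k₀ the threshold is too large to be useful, but k₀ coordinates, each moving by at
    -- most 2D, give a row change of at most 2nDk₀ ≤ 2nDq.
    rcases le_or_gt ℓ k₀ with hc | hc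
    · have hcR : (ℓ : ℝ) ≤ k₀ := by exact_mod_cast hc
      have hρℓ : (ρ : ℝ) * ℓ ≤ 2 * q := by
        rcases hρ with hρ | hρ
        · rw [hρ]
          have : (ℓ : ℝ) ≤ q := by
            rw [hq]
            refine Real.le_sqrt_of_sq_le ?_
            nlinarith
          push_cast
          linarith
        · have h1 : (((ρ - 1 : ℕ) : ℝ)) ^ 2 * ℓ < k₀ := by exact_mod_cast hρ
          have h2 : ((ρ - 1 : ℕ) : ℝ) * ℓ ≤ q := by
            rw [hq]
            refine Real.le_sqrt_of_sq_le ?_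
            nlinarith
          rcases Nat.eq_or_lt_of_le hρ1 with h3 | h3
          · rw [← h3]
            have : (ℓ : ℝ) ≤ q := by
              rw [hq]
              refine Real.le_sqrt_of_sq_le ?_
              nlinarith
            push_cast
            linarith
          · have h4 : (ρ : ℝ) ≤ 2 * ((ρ - 1 : ℕ) : ℝ) := by
              have : ρ ≤ 2 * (ρ - 1) := by omega
              exact_mod_cast this
            nlinarith
      have hdrift : (energy n x - energy n x₀) / (64 * (n : ℝ) ^ 5) ≤ 64 * n ^ 6 := by
        rw [div_le_iff₀ (by positivity)]
        refine hen.trans ?_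
        have hkn : (k₀ : ℝ) ≤ n := by exact_mod_cast h.le
        calc (k₀ : ℝ) * (64 * n ^ 5) ^ 2 ≤ n * (64 * n ^ 5) ^ 2 := by gcongr
          _ = _ := by ring
      push_cast at hrow
      have h6 : (0 : ℝ) ≤ 64 * n ^ 6 := by positivity
      calc |(rowSum n b (x - x₀) i : ℝ)| ≤ 64 * n ^ 6 * (80 * (ρ * ℓ) + 2) := by linarith
        _ ≤ 64 * n ^ 6 * (162 * q) := mul_le_mul_of_nonneg_left (by linarith) h6
    · have hcR : (k₀ : ℝ) ≤ ℓ := by exact_mod_cast hc.le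
      refine htriv.trans (mul_le_mul_of_nonneg_left ?_ (by positivity))
      have : (k₀ : ℝ) ≤ q := by
        rw [hq]
        refine Real.le_sqrt_of_sq_le ?_
        nlinarith
      linarith
  refine key.trans (mul_le_mul_of_nonneg_left ?_ (by positivity))
  linarith

/-- A new phase starts. -/
theorem WalkInv.restart (P : Params n m Q b) (h : WalkInv n m Q b t x x₀ k₀)
    (hk : 2 * (aliveSet n x).card ≤ k₀) : WalkInv n m Q b t x x (aliveSet n x).card where
  box := h.box
  box₀ := h.box
  le := (Finset.card_le_card (Finset.filter_subset _ _)).trans (by simp)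
  subset := le_rfl
  card_le := le_rfl
  frozen _ _ _ := rfl
  energy_le := le_rfl
  potential _ := by
    simp [rowSum_zero, phi_zero, mul_comm]
  row i hi := by
    have : rowSum n b (x - x) i = 0 := by simp [rowSum]
    rw [this]
    simp only [Int.cast_zero, abs_zero, sub_self, zero_div]
    positivity
  start i hi := by
    have h1 := h.start i hi
    have h2 := h.row_le_phaseBound P hi
    have h3 : rowSum n b x i = rowSum n b x₀ i + rowSum n b (x - x₀) i := by
      rw [← rowSum_add]; congr 1; ring
    -- 2592 = 8 · 324: with ratio 7/8, the cost of the finished phase is at most 2592 times the drop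
    -- of `phaseBound`, and the sum over phases telescopes.
    have h4 := phaseBound_half hk (h.le.trans P.hnm)
    rw [h3]
    push_cast
    refine (abs_add_le _ _).trans ((add_le_add h1 h2).trans ?_)
    rw [← mul_add]
    exact mul_le_mul_of_nonneg_left (by linarith) (by positivity)
  progress := h.progress

theorem WalkInv.idle (h : WalkInv n m Q b t x x₀ k₀) (hk : (aliveSet n x).card < 16) :
    WalkInv n m Q b (t + 1) x x₀ k₀ :=
  { h with progress := Or.inr hk }

theorem WalkInv.init : WalkInv n m Q b 0 0 0 n where
  box j _ := by simp only [Pi.zero_apply, abs_zero, boxSize]; positivity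
  box₀ j _ := by simp only [Pi.zero_apply, abs_zero, boxSize]; positivity
  le := le_rfl
  subset := le_rfl
  card_le := (Finset.card_le_card (Finset.filter_subset _ _)).trans (by simp)
  frozen _ _ _ := rfl
  energy_le := le_rfl
  potential _ := by
    simp [rowSum_zero, phi_zero, mul_comm]
  row i hi := by
    have : rowSum n b (0 - 0) i = 0 := by simp [rowSum]
    rw [this]
    simp only [Int.cast_zero, abs_zero, sub_self, zero_div]
    positivity
  start i hi := by simp [rowSum]
  progress := by left; simp [energy]

/-- The box holds energy at most nD² = 4096n^11 and every active step gains 128n^7, so at most 32n^4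
steps are active. -/
theorem WalkInv.finished (P : Params n m Q b) (h : WalkInv n m Q b Q x x₀ k₀) :
    (aliveSet n x).card < 16 := by
  rcases h.progress with h1 | h1
  · exfalso
    have hn1 := P.hn1
    have h2 : energy n x ≤ n * (64 * n ^ 5) ^ 2 := by
      rw [energy]
      have h1 : ∀ j ∈ Finset.range n, (x j : ℝ) ^ 2 ≤ (64 * n ^ 5) ^ 2 := by
        intro j hj
        have h3 : |(x j : ℝ)| ≤ 64 * n ^ 5 := by
          have : ((|x j| : ℤ) : ℝ) ≤ (boxSize n : ℝ) := by
            exact_mod_cast h.box j (Finset.mem_range.1 hj)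
          simpa [boxSize] using this
        have h4 := pow_le_pow_left₀ (abs_nonneg _) h3 2
        rwa [sq_abs] at h4
      refine (Finset.sum_le_sum h1).trans ?_
      rw [Finset.sum_const, nsmul_eq_mul, Finset.card_range]
    have h3 : 33 * n ^ 4 ≤ Q := by
      have := P.pow_le (a := 33) (e := 4) (c := 1) (by norm_num) (by norm_num) (by omega)
      simpa using this
    have h4 : (33 : ℝ) * n ^ 4 ≤ Q := by exact_mod_cast h3
    have h5 : (33 : ℝ) * n ^ 4 * (128 * n ^ 7) ≤ n * (64 * n ^ 5) ^ 2 :=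
      (mul_le_mul_of_nonneg_right h4 (by positivity)).trans (h1.trans h2)
    have h6 : (0 : ℝ) < n ^ 11 := by positivity
    nlinarith
  · exact h1

theorem WalkInv.final_row_le (P : Params n m Q b) (h : WalkInv n m Q b t x x₀ k₀) {i : ℕ}
    (hi : i < m) : |(rowSum n b x i : ℝ)| ≤ 64 * n ^ 6 * (2592 * phaseBound m n) := by
  have h1 := h.start i hi
  have h2 := h.row_le_phaseBound P hi
  have h3 : rowSum n b x i = rowSum n b x₀ i + rowSum n b (x - x₀) i := by
    rw [← rowSum_add]; congr 1; ring
  have h4 : 0 ≤ phaseBound m k₀ := Real.sqrt_nonneg _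
  rw [h3]
  push_cast
  refine (abs_add_le _ _).trans ((add_le_add h1 h2).trans ?_)
  rw [← mul_add]
  exact mul_le_mul_of_nonneg_left (by linarith) (by positivity)

end

/-! ### One step of the walk -/

section

variable {n m Q : ℕ} {b : ℕ → ℕ → ℤ} {t : ℕ} {x x₀ : ℕ → ℤ} {k₀ : ℕ}

/-- A bound for all row sums. -/
def rowBound (n : ℕ) : ℤ := 2 * n ^ 2 * boxSize n

/-- The weights of the rows. -/
def walkWeight (n m Q : ℕ) (b : ℕ → ℕ → ℤ) (x x₀ : ℕ → ℤ) (k₀ i : ℕ) : ℤ :=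
  weight Q (rowBound n) (scaleOf n Q m k₀) (rowSum n b (x - x₀) i)

/-- The heavy rows. -/
def heavyRows (n m Q : ℕ) (b : ℕ → ℕ → ℤ) (x x₀ : ℕ → ℤ) (k₀ : ℕ) : Finset ℕ :=
  (Finset.range m).filter fun i => (threshold n Q m k₀ : ℤ) ≤ |rowSum n b (x - x₀) i|

theorem scaleOf_le (n m Q k : ℕ) : 64 * n ^ 6 ≤ scaleOf n Q m k := by
  have h : 1 ≤ radiusOf Q (levelOf Q m k) k := by rw [radiusOf]; omega
  have h2 := Nat.mul_le_mul_left (64 * n ^ 6) h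
  rw [scaleOf]
  omega

theorem Params.scaleOf_pos (P : Params n m Q b) (k : ℕ) : 0 < scaleOf n Q m k := by
  have := scaleOf_le n m Q k
  have h2 : 0 < n ^ 6 := pow_pos P.hn 6
  omega

/-- The common factor of all weights. -/
noncomputable def weightFactor (n m Q k₀ : ℕ) : ℝ :=
  (scaleOf n Q m k₀ : ℝ) ^ Q * (1 + 1 / (scaleOf n Q m k₀ : ℝ)) ^ rowBound n

theorem Params.weightFactor_pos (P : Params n m Q b) (k : ℕ) : 0 < weightFactor n m Q k := by
  have : (0 : ℝ) < scaleOf n Q m k := by exact_mod_cast P.scaleOf_pos k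
  exact mul_pos (pow_pos this _) (zpow_pos (one_add_inv_pos this) _)

theorem Params.weight_eq (P : Params n m Q b) (k : ℕ) {s : ℤ} (hs : |s| ≤ rowBound n) :
    (weight Q (rowBound n) (scaleOf n Q m k) s : ℝ) =
      weightFactor n m Q k * phi (scaleOf n Q m k) s := by
  have h1 := _root_.weight_eq (Q := Q) (S := rowBound n) (M := scaleOf n Q m k) (s := s)
    (by exact_mod_cast P.scaleOf_pos k) hs
    (by
      have := P.pow_le (a := 256) (e := 7) (c := 1) (by norm_num) (by norm_num) (by omega)
      zify at this
      rw [rowBound, boxSize]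
      nlinarith)
  simpa [weightFactor] using h1

theorem Params.abs_rowSum_sub_le (P : Params n m Q b) {w : ℕ → ℤ} (hw : ∀ j < n, |w j| ≤ boxSize n)
    (hx₀ : ∀ j < n, |x₀ j| ≤ boxSize n) {i : ℕ} (hi : i < m) :
    |rowSum n b (w - x₀) i| ≤ rowBound n := by
  refine (Finset.abs_sum_le_sum_abs _ _).trans ?_
  have h1 : ∀ j ∈ Finset.range n, |b i j * (w - x₀) j| ≤ n * (2 * boxSize n) := by
    intro j hj
    have hj' := Finset.mem_range.1 hj
    have h2 : |w j - x₀ j| ≤ 2 * boxSize n := (abs_sub _ _).trans (by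
      linarith [hw j hj', hx₀ j hj'])
    rw [abs_mul, Pi.sub_apply]
    exact mul_le_mul (P.hb i hi j hj') h2 (abs_nonneg _) (by positivity)
  refine (Finset.sum_le_sum h1).trans (le_of_eq ?_)
  rw [Finset.sum_const, nsmul_eq_mul, Finset.card_range, rowBound]
  ring

theorem WalkInv.walkWeight_eq (P : Params n m Q b) (h : WalkInv n m Q b t x x₀ k₀) {i : ℕ}
    (hi : i < m) : (walkWeight n m Q b x x₀ k₀ i : ℝ) =
      weightFactor n m Q k₀ * phi (scaleOf n Q m k₀) (rowSum n b (x - x₀) i) :=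
  P.weight_eq k₀ (P.abs_rowSum_sub_le h.box h.box₀ hi)

theorem WalkInv.walkWeight_pos (P : Params n m Q b) (h : WalkInv n m Q b t x x₀ k₀) {i : ℕ}
    (hi : i < m) : 0 < walkWeight n m Q b x x₀ k₀ i := by
  have : (0 : ℝ) < walkWeight n m Q b x x₀ k₀ i := by
    rw [h.walkWeight_eq P hi]
    exact mul_pos (P.weightFactor_pos k₀) (phi_pos (by exact_mod_cast P.scaleOf_pos k₀) _)
  exact_mod_cast this

theorem WalkInv.sum_walkWeight_pos (P : Params n m Q b) (h : WalkInv n m Q b t x x₀ k₀) :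
    0 < ∑ i ∈ Finset.range m, walkWeight n m Q b x x₀ k₀ i :=
  Finset.sum_pos (fun _ hi => h.walkWeight_pos P (Finset.mem_range.1 hi))
    ⟨0, Finset.mem_range.2 (P.hn.trans_le P.hnm)⟩

/-- The phase gains at most k₀D² of energy, and M = nDρ with k₀ ≤ ρ²ℓ, so the exponent in the
potential bound is at most 52k₀/ρ² ≤ 52ℓ. -/
theorem WalkInv.card_heavyRows_le (P : Params n m Q b) (h : WalkInv n m Q b t x x₀ k₀)
    (hk : 0 < k₀) : 16 * (heavyRows n m Q b x x₀ k₀).card ≤ k₀ := by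
  have hkm : k₀ ≤ m := h.le.trans P.hnm
  obtain ⟨hℓ1, hℓ, -⟩ := levelOf_spec hk hkm P.four_mul_le
  obtain ⟨hρ, -, hρ1⟩ := radiusOf_spec (k := k₀) hℓ1
    (hkm.trans ((by omega : m ≤ 4 * m).trans P.four_mul_le))
  refine card_heavy_le hℓ1 hℓ (P.scaleOf_pos k₀) (rowSum n b (x - x₀)) (Finset.filter_subset _ _)
    (fun i hi => ?_) ((h.potential hk).trans ?_)
  · have := (Finset.mem_filter.1 hi).2
    rw [threshold] at this
    exact_mod_cast this
  · refine mul_le_mul_of_nonneg_left (Real.exp_le_exp.2 ?_) (by positivity)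
    have hM : (0 : ℝ) < scaleOf n Q m k₀ := by exact_mod_cast P.scaleOf_pos k₀
    rw [div_le_iff₀ (by positivity)]
    have h1 := h.energy_sub_le
    have h2 : (k₀ : ℝ) ≤ (radiusOf Q (levelOf Q m k₀) k₀ : ℝ) ^ 2 * levelOf Q m k₀ := by
      exact_mod_cast hρ
    rw [scaleOf]
    push_cast
    calc 52 * (n : ℝ) ^ 2 * (energy n x - energy n x₀)
        ≤ 52 * (n : ℝ) ^ 2 * (k₀ * (64 * n ^ 5) ^ 2) := mul_le_mul_of_nonneg_left h1 (by positivity)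
      _ = 52 * (64 * n ^ 6) ^ 2 * k₀ := by ring
      _ ≤ 52 * (64 * (n : ℝ) ^ 6) ^ 2 * ((radiusOf Q (levelOf Q m k₀) k₀ : ℝ) ^ 2 * levelOf Q m k₀) :=
          mul_le_mul_of_nonneg_left h2 (by positivity)
      _ = _ := by ring

/-- The coefficient of the heavy rows. -/
def heavyCoeff (n m Q : ℕ) (b : ℕ → ℕ → ℤ) (x x₀ : ℕ → ℤ) (k₀ : ℕ) : ℤ :=
  3 * stepLen n ^ 2 * ∑ i ∈ Finset.range m, walkWeight n m Q b x x₀ k₀ i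

/-- The vector `z` is a good direction. -/
def GoodDirection (n m Q : ℕ) (b : ℕ → ℕ → ℤ) (x x₀ : ℕ → ℤ) (k₀ : ℕ) (z : ℕ → ℤ) : Prop :=
  ∑ i ∈ Finset.range (m + 1),
    formCoeff m (heavyRows n m Q b x x₀ k₀) (walkWeight n m Q b x x₀ k₀)
      (heavyCoeff n m Q b x x₀ k₀) i *
        (∑ j ∈ Finset.range n, formRow m b x (aliveSet n x) i j * z j) ^ 2 <
  (3 * n ^ 2 * ∑ i ∈ Finset.range m, walkWeight n m Q b x x₀ k₀ i) *
    ∑ j ∈ Finset.range n, z j * z j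

theorem GoodDirection.sum_abs_pos {z : ℕ → ℤ} (h : GoodDirection n m Q b x x₀ k₀ z) :
    0 < ∑ j ∈ Finset.range n, |z j| := by
  refine lt_of_le_of_ne (Finset.sum_nonneg fun _ _ => abs_nonneg _) fun h0 => ?_
  have hz0 : ∀ j ∈ Finset.range n, z j = 0 := fun j hj =>
    abs_eq_zero.1 ((Finset.sum_eq_zero_iff_of_nonneg fun _ _ => abs_nonneg _).1 h0.symm j hj)
  have e1 : ∑ j ∈ Finset.range n, z j * z j = 0 :=
    Finset.sum_eq_zero fun j hj => by rw [hz0 j hj, mul_zero]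
  have e2 : ∀ i, ∑ j ∈ Finset.range n, formRow m b x (aliveSet n x) i j * z j = 0 := fun i =>
    Finset.sum_eq_zero fun j hj => by rw [hz0 j hj, mul_zero]
  simp [GoodDirection, e1, e2] at h

/-- The power iteration of the algorithm. -/
def walkIter (n m Q : ℕ) (b : ℕ → ℕ → ℤ) (x x₀ : ℕ → ℤ) (k₀ : ℕ) : (ℕ → ℤ) → ℕ → ℤ :=
  iterStep n (m + 1) (formRow m b x (aliveSet n x))
    (formCoeff m (heavyRows n m Q b x x₀ k₀) (walkWeight n m Q b x x₀ k₀)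
      (heavyCoeff n m Q b x x₀ k₀))
    ((∑ i ∈ Finset.range m, walkWeight n m Q b x x₀ k₀ i) * Q)

theorem WalkInv.exists_goodDirection (P : Params n m Q b) (h : WalkInv n m Q b t x x₀ k₀)
    (hk : 16 ≤ (aliveSet n x).card) (hk' : k₀ < 2 * (aliveSet n x).card) :
    ∃ a ∈ aliveSet n x, GoodDirection n m Q b x x₀ k₀
      ((walkIter n m Q b x x₀ k₀)^[Q] (Pi.single a 1)) := by
  have hk0 : 0 < k₀ := by
    have := Finset.card_le_card h.subset
    have := h.card_le
    omega
  have hheavy := h.card_heavyRows_le P hk0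
  have hn1 : (1 : ℤ) ≤ n := by exact_mod_cast P.hn
  have hL : 1 ≤ stepLen n := by
    rw [stepLen]
    have : (1 : ℤ) ≤ n ^ 4 := one_le_pow₀ hn1
    linarith
  obtain ⟨a, ha, hz⟩ := exists_good_direction (Q := Q) P.hn (al := aliveSet n x)
    (Finset.filter_subset _ _) P.hb
    (x := x) (D := boxSize n)
    (by
      rw [boxSize]
      have : (n : ℤ) ≤ n ^ 5 := le_self_pow₀ hn1 (by norm_num)
      have : (0 : ℤ) ≤ n ^ 5 := by positivity
      linarith)
    h.box (W := walkWeight n m Q b x x₀ k₀) (fun _ hi => (h.walkWeight_pos P hi).le)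
    (hv := heavyRows n m Q b x x₀ k₀) (by omega) rfl (h.sum_walkWeight_pos P)
    (R := 3 * stepLen n ^ 2) (by nlinarith)
    (by
      -- The condition on Q in `Params` is exactly this one: 3L² · nD² = 3 · 2^22 · n^19.
      have := P.hQ
      zify at this
      rw [stepLen, boxSize]
      refine le_trans (le_of_eq ?_) this
      ring)
    (by
      have := P.pow_le (a := 4) (e := 2) (c := 1) (by norm_num) (by norm_num) (by omega)
      have h2 : 0 < n ^ 2 := pow_pos P.hn 2
      omega)
  exact ⟨a, ha, hz _ rfl⟩

/-- Energy is the common currency: its gain is at least ‖y‖²/2, which pays for the growth of the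
potential, and at least 128n^7, which pays for the drift of heavy rows and bounds the number of
steps. -/
theorem WalkInv.step (P : Params n m Q b) (h : WalkInv n m Q b t x x₀ k₀)
    (hk : 16 ≤ (aliveSet n x).card) {z y : ℕ → ℤ}
    (hgood : GoodDirection n m Q b x x₀ k₀ z) (hz : ∀ j < n, j ∉ aliveSet n x → z j = 0)
    (hfl : ∀ j < n, y j * (∑ j ∈ Finset.range n, |z j|) ≤ stepLen n * z j ∧
      stepLen n * z j < (y j + 1) * (∑ j ∈ Finset.range n, |z j|)) {σ : ℤ} (hσ : σ = 1 ∨ σ = -1)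
    (hsign : ∑ i ∈ Finset.range m, weight Q (rowBound n) (scaleOf n Q m k₀)
        (rowSum n b (x - x₀) i + σ * rowSum n b y i) ≤
      ∑ i ∈ Finset.range m, weight Q (rowBound n) (scaleOf n Q m k₀)
        (rowSum n b (x - x₀) i - σ * rowSum n b y i))
    {x' : ℕ → ℤ} (hx' : ∀ j < n, x' j = x j + σ * y j) :
    WalkInv n m Q b (t + 1) x' x₀ k₀ := by
  have hn1 := P.hn1
  have hk0 : 0 < k₀ := by
    have := Finset.card_le_card h.subset
    have := h.card_le
    omega
  have hal : aliveSet n x ⊆ Finset.range n := Finset.filter_subset _ _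
  have hkn : (aliveSet n x).card ≤ n := by simpa using Finset.card_le_card hal
  set al := aliveSet n x with haldef
  have hknR : (al.card : ℝ) ≤ n := by exact_mod_cast hkn
  have hn16 : (16 : ℝ) ≤ n := by exact_mod_cast hk.trans hkn
  have hnZ : (1 : ℤ) ≤ n := by exact_mod_cast P.hn
  have hL0 : 0 < stepLen n := by rw [stepLen]; positivity
  have hLR : (stepLen n : ℝ) = 32 * n ^ 4 := by simp [stepLen]
  have hDR : (boxSize n : ℝ) = 64 * n ^ 5 := by simp [boxSize]
  set Z := ∑ j ∈ Finset.range n, |z j| with hZ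
  have hΦ0 := h.sum_walkWeight_pos P
  have hZ0 : 0 < Z := hgood.sum_abs_pos
  have hy : ∀ j < n, j ∉ al → y j = 0 := by
    intro j hj hja
    obtain ⟨h1, h2⟩ := hfl j hj
    rw [hz j hj hja, mul_zero] at h1 h2
    have h3 : y j ≤ 0 := by
      by_contra hc
      exact absurd h1 (not_le.2 (mul_pos (by omega) hZ0))
    have h4 : 0 < y j + 1 := by
      by_contra hc
      exact absurd h2 (not_lt.2 (mul_nonpos_of_nonpos_of_nonneg (by omega) hZ0.le))
    omega
  have hkL : 4 * (al.card : ℝ) ^ 3 ≤ (stepLen n : ℝ) ^ 2 := by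
    rw [hLR]
    calc 4 * (al.card : ℝ) ^ 3 ≤ 4 * (n : ℝ) ^ 3 := by gcongr
      _ ≤ 1024 * (n : ℝ) ^ 8 := by
          have : (n : ℝ) ^ 3 ≤ n ^ 8 := pow_le_pow_right₀ hn1 (by norm_num)
          have : (0 : ℝ) ≤ n ^ 3 := by positivity
          linarith
      _ = _ := by ring
  have hk1 : (1 : ℝ) ≤ al.card := by
    have : 1 ≤ al.card := by omega
    exact_mod_cast this
  have hr := roundingOf_floor hal hL0 (by omega)
    (by
      refine le_trans ?_ hkL
      have : (al.card : ℝ) ^ 2 ≤ al.card ^ 3 := pow_le_pow_right₀ hk1 (by norm_num)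
      linarith) hz hy hZ hZ0 hfl
  obtain ⟨hheavy, hxy, hlight⟩ := rounded_direction_bounds hal P.hb (x := x) (D := boxSize n)
    (by
      rw [boxSize]
      have : (n : ℤ) ≤ n ^ 5 := le_self_pow₀ hnZ (by norm_num)
      have : (0 : ℤ) ≤ n ^ 5 := by positivity
      linarith) h.box (W := walkWeight n m Q b x x₀ k₀) (fun i hi => (h.walkWeight_pos P hi).le)
    (hv := heavyRows n m Q b x x₀ k₀) (Finset.filter_subset _ _) rfl hΦ0 hL0 (z := z) (y := y)
    hgood.le hr hy hkL
  set Y := ∑ j ∈ Finset.range n, (y j : ℝ) ^ 2 with hYdef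
  have hY : 256 * (n : ℝ) ^ 7 ≤ Y := by
    have h1 := hr.le_norm
    rw [hLR] at h1
    have hY0 : 0 ≤ Y := Finset.sum_nonneg fun _ _ => sq_nonneg _
    have h2 : 4 * (al.card : ℝ) * Y ≤ 4 * n * Y := by gcongr
    have h3 : 4 * (n : ℝ) * (256 * n ^ 7) ≤ 4 * n * Y := by
      refine le_trans (le_of_eq ?_) (h1.trans h2); ring
    exact le_of_mul_le_mul_left h3 (by linarith)
  have hσ2 : (σ : ℝ) ^ 2 = 1 := by rcases hσ with rfl | rfl <;> norm_num
  have hσabs : |(σ : ℝ)| = 1 := by rcases hσ with rfl | rfl <;> norm_num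
  have hσabsZ : |σ| = 1 := by rcases hσ with rfl | rfl <;> norm_num
  have hE : energy n x' = energy n x + (2 * σ * ∑ j ∈ Finset.range n, (x j : ℝ) * y j) + Y := by
    rw [energy, energy, hYdef, Finset.mul_sum, ← Finset.sum_add_distrib, ← Finset.sum_add_distrib]
    refine Finset.sum_congr rfl fun j hj => ?_
    rw [hx' j (Finset.mem_range.1 hj)]
    push_cast
    linear_combination (y j : ℝ) ^ 2 * hσ2
  -- Near orthogonality to x limits the cross term to 256n^6 ≤ 128n^7 ≤ Y/2; here n ≥ 16 is used.
  have hEE : Y / 2 ≤ energy n x' - energy n x := by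
    have h1 : |2 * σ * ∑ j ∈ Finset.range n, (x j : ℝ) * y j| ≤ 2 * (2 * n * (64 * n ^ 5)) := by
      rw [abs_mul, abs_mul, hσabs, ← hDR, abs_two, mul_one]
      linarith
    have h2 := (abs_le.1 h1).1
    have h3 : 2 * (2 * (n : ℝ) * (64 * n ^ 5)) ≤ 128 * n ^ 7 := by
      have : (n : ℝ) ^ 7 = n * n ^ 6 := by ring
      have h6 : (0 : ℝ) ≤ n ^ 6 := by positivity
      nlinarith
    linarith
  have hEE' : 128 * (n : ℝ) ^ 7 ≤ energy n x' - energy n x := by linarith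
  have hEpos : (0 : ℝ) ≤ 128 * (n : ℝ) ^ 7 := by positivity
  have hrow : ∀ i, rowSum n b (x' - x₀) i = rowSum n b (x - x₀) i + σ * rowSum n b y i := by
    intro i
    rw [rowSum, rowSum, rowSum, Finset.mul_sum, ← Finset.sum_add_distrib]
    refine Finset.sum_congr rfl fun j hj => ?_
    simp only [Pi.sub_apply, hx' j (Finset.mem_range.1 hj)]
    ring
  have hyL : ∀ j < n, |y j| ≤ stepLen n := fun j hj => by exact_mod_cast hr.abs_le j hj
  have hbox : ∀ τ : ℤ, |τ| = 1 → ∀ j < n, |x j + τ * y j| ≤ boxSize n := by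
    intro τ hτ j hj
    by_cases hja : j ∈ al
    · have h1 := (Finset.mem_filter.1 hja).2
      have h2 := hyL j hj
      have h3 : |τ * y j| = |y j| := by rw [abs_mul, hτ, one_mul]
      have h4 := abs_add_le (x j) (τ * y j)
      linarith
    · rw [hy j hj hja]; simpa using h.box j hj
  have hM := P.scaleOf_pos k₀
  have hMR : (0 : ℝ) < scaleOf n Q m k₀ := by exact_mod_cast hM
  have hd : ∀ i < m, |rowSum n b y i| ≤ 32 * n ^ 6 := by
    intro i hi
    refine (Finset.abs_sum_le_sum_abs _ _).trans ?_
    have h1 : ∀ j ∈ Finset.range n, |b i j * y j| ≤ n * stepLen n := by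
      intro j hj
      have hj' := Finset.mem_range.1 hj
      rw [abs_mul]
      exact mul_le_mul (P.hb i hi j hj') (hyL j hj') (abs_nonneg _) (by positivity)
    refine (Finset.sum_le_sum h1).trans (le_of_eq ?_)
    rw [Finset.sum_const, nsmul_eq_mul, Finset.card_range, stepLen]
    ring
  have hdM : ∀ i < m, |((σ * rowSum n b y i : ℤ) : ℝ)| ≤ scaleOf n Q m k₀ := by
    intro i hi
    have h1 : |σ * rowSum n b y i| ≤ (scaleOf n Q m k₀ : ℤ) := by
      rw [abs_mul, hσabsZ, one_mul]
      have h2 := scaleOf_le n m Q k₀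
      zify at h2
      have : (0 : ℤ) ≤ n ^ 6 := by positivity
      linarith [hd i hi]
    exact_mod_cast h1
  have hC := P.weightFactor_pos k₀
  have hcastd : ∀ i, ((rowSum n b y i : ℤ) : ℝ) = ∑ j ∈ Finset.range n, (b i j : ℝ) * y j := by
    intro i; rw [rowSum]; push_cast; rfl
  refine ⟨?_, h.box₀, h.le, ?_, h.card_le, ?_, ?_, ?_, ?_, h.start, ?_⟩
  · intro j hj
    rw [hx' j hj]
    exact hbox σ hσabsZ j hj
  · intro j hj
    obtain ⟨h1, h2⟩ := Finset.mem_filter.1 hj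
    refine h.subset ?_
    by_contra hja
    rw [hx' j (Finset.mem_range.1 h1), hy j (Finset.mem_range.1 h1) hja, mul_zero, add_zero] at h2
    exact hja (Finset.mem_filter.2 ⟨h1, h2⟩)
  · intro j hj hja
    rw [hx' j hj, hy j hj fun hc => hja (h.subset hc), mul_zero, add_zero]
    exact h.frozen j hj hja
  · linarith [h.energy_le]
  · intro _
    have hpot := h.potential hk0
    set M : ℝ := ((scaleOf n Q m k₀ : ℕ) : ℝ) with hMdef
    set F := ∑ i ∈ Finset.range m, phi M (rowSum n b (x - x₀) i) with hF
    have hF0 : 0 ≤ F := Finset.sum_nonneg fun _ _ => (phi_pos hMR _).le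
    have hsign' : ∑ i ∈ Finset.range m, phi M (rowSum n b (x - x₀) i + σ * rowSum n b y i) ≤
        ∑ i ∈ Finset.range m, phi M (rowSum n b (x - x₀) i - σ * rowSum n b y i) := by
      -- Integer weights represent φ only for displacements within `rowBound n`. Both candidate
      -- points lie in the box, so the comparison of integers is one of potentials.
      have hs : ∀ τ : ℤ, |τ| = 1 → ((∑ i ∈ Finset.range m, weight Q (rowBound n) (scaleOf n Q m k₀)
          (rowSum n b (x - x₀) i + τ * rowSum n b y i) : ℤ) : ℝ) = weightFactor n m Q k₀ *
          ∑ i ∈ Finset.range m, phi M (rowSum n b (x - x₀) i + τ * rowSum n b y i) := by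
        intro τ hτ
        rw [Finset.mul_sum]
        push_cast
        refine Finset.sum_congr rfl fun i hi => P.weight_eq k₀ ?_
        have := P.abs_rowSum_sub_le (hbox τ hτ) h.box₀ (Finset.mem_range.1 hi)
        refine le_trans (le_of_eq ?_) this
        congr 1
        rw [rowSum, rowSum, rowSum, Finset.mul_sum, ← Finset.sum_add_distrib]
        refine Finset.sum_congr rfl fun j _ => ?_
        simp only [Pi.sub_apply]
        ring
      have h1 := hs σ hσabsZ
      have h2 := hs (-σ) (by rwa [abs_neg])
      simp only [neg_mul, ← sub_eq_add_neg] at h2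
      have h3 : ((∑ i ∈ Finset.range m, weight Q (rowBound n) (scaleOf n Q m k₀)
        (rowSum n b (x - x₀) i + σ * rowSum n b y i) : ℤ) : ℝ) ≤
          ((∑ i ∈ Finset.range m, weight Q (rowBound n) (scaleOf n Q m k₀)
        (rowSum n b (x - x₀) i - σ * rowSum n b y i) : ℤ) : ℝ) := by exact_mod_cast hsign
      rw [h1, h2] at h3
      exact le_of_mul_le_mul_left h3 hC
    have hgrow := potential_growth hMR (rowSum n b (x - x₀)) (fun i => σ * rowSum n b y i) hdM
      (κ := 26 * n ^ 2 * Y) (by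
        have e1 : ∑ i ∈ Finset.range m, (walkWeight n m Q b x x₀ k₀ i : ℝ) *
            (∑ j ∈ Finset.range n, (b i j : ℝ) * y j) ^ 2 = weightFactor n m Q k₀ *
            ∑ i ∈ Finset.range m, phi M (rowSum n b (x - x₀) i) *
              ((σ * rowSum n b y i : ℤ) : ℝ) ^ 2 := by
          rw [Finset.mul_sum]
          refine Finset.sum_congr rfl fun i hi => ?_
          rw [h.walkWeight_eq P (Finset.mem_range.1 hi), ← hcastd]
          push_cast
          rw [mul_pow, hσ2, one_mul, mul_assoc]
        have e2 : ∑ i ∈ Finset.range m, (walkWeight n m Q b x x₀ k₀ i : ℝ) =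
            weightFactor n m Q k₀ * F := by
          rw [hF, Finset.mul_sum]
          exact Finset.sum_congr rfl fun i hi => h.walkWeight_eq P (Finset.mem_range.1 hi)
        rw [e1, e2] at hlight
        refine le_of_mul_le_mul_left (hlight.trans (le_of_eq ?_)) hC
        ring)
    have h1 : ∑ i ∈ Finset.range m, phi M (rowSum n b (x' - x₀) i) ≤
        (1 + 26 * n ^ 2 * Y / M ^ 2) * F := by
      have e : ∑ i ∈ Finset.range m, phi M (rowSum n b (x' - x₀) i) =
          ∑ i ∈ Finset.range m, phi M (rowSum n b (x - x₀) i + σ * rowSum n b y i) :=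
        Finset.sum_congr rfl fun i _ => by rw [hrow]
      rw [e]
      linarith
    refine h1.trans ?_
    have h2 : 1 + 26 * n ^ 2 * Y / M ^ 2 ≤
        Real.exp (52 * n ^ 2 * (energy n x' - energy n x) / M ^ 2) := by
      refine le_trans ?_ (Real.add_one_le_exp _)
      rw [add_comm]
      refine add_le_add (div_le_div_of_nonneg_right ?_ (sq_nonneg M)) le_rfl
      nlinarith [mul_nonneg (sq_nonneg (n : ℝ)) (sub_nonneg.2 hEE)]
    calc (1 + 26 * n ^ 2 * Y / M ^ 2) * F
        ≤ Real.exp (52 * n ^ 2 * (energy n x' - energy n x) / M ^ 2) *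
          (2 * m * Real.exp (52 * n ^ 2 * (energy n x - energy n x₀) / M ^ 2)) :=
          mul_le_mul h2 hpot hF0 (Real.exp_pos _).le
      _ = _ := by
          rw [mul_left_comm, ← Real.exp_add]
          congr 2
          ring
  · intro i hi
    have hD0 : (0 : ℝ) < 64 * n ^ 5 := by positivity
    rw [hrow]
    push_cast
    have h1 := abs_add_le (rowSum n b (x - x₀) i : ℝ) (σ * rowSum n b y i)
    rw [abs_mul, hσabs, one_mul] at h1
    -- A heavy row moves by at most 2n² ≤ (energy gain)/D. A light row was below the threshold, and
    -- its step of at most 32n^6 fits into the allowance 64n^6.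
    by_cases hh : i ∈ heavyRows n m Q b x x₀ k₀
    · have h2 := hheavy i hh
      rw [← hcastd] at h2
      have h3 := h.row i hi
      have h4 : (energy n x' - energy n x₀) / (64 * n ^ 5) =
          (energy n x - energy n x₀) / (64 * n ^ 5) + (energy n x' - energy n x) / (64 * n ^ 5) := by
        rw [← add_div]; congr 1; ring
      have h5 : 2 * (n : ℝ) ^ 2 ≤ (energy n x' - energy n x) / (64 * n ^ 5) := by
        rw [le_div_iff₀ hD0]
        refine le_trans (le_of_eq ?_) hEE'
        ring
      linarith
    · have h2 : |(rowSum n b (x - x₀) i : ℝ)| < threshold n Q m k₀ := by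
        have : ¬ ((threshold n Q m k₀ : ℤ) ≤ |rowSum n b (x - x₀) i|) := fun hc =>
          hh (Finset.mem_filter.2 ⟨Finset.mem_range.2 hi, hc⟩)
        exact_mod_cast not_le.1 this
      have h3 : |(rowSum n b y i : ℝ)| ≤ 32 * n ^ 6 := by exact_mod_cast hd i hi
      have h4 : 0 ≤ (energy n x' - energy n x₀) / (64 * n ^ 5) :=
        div_nonneg (by linarith [h.energy_le]) hD0.le
      have h6 : (0 : ℝ) ≤ n ^ 6 := by positivity
      linarith
  · rcases h.progress with h1 | h1
    · left
      push_cast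
      linarith
    · rw [← haldef] at h1
      omega

end

namespace RealRAM

infixl:65 " +ₑ " => Expr.bin BinOp.add
infixl:65 " -ₑ " => Expr.bin BinOp.sub
infixl:70 " *ₑ " => Expr.bin BinOp.mul

/-! ### The program

Variables: `0`: `m`, `1`: `n`, `2`: zero, `3`: one, `4`: `m + 1`, `5`: the loop bound `Q`.
Variables from `8` on are bound.

Arrays: `1`: output, `2`: position, `3`: start of the phase, `4`: rounded matrix, `5`: `n`, `6`: `m`,
`7`: size of the phase, `8`: number of living coordinates, `9`: flag for a new phase, `10`: level,
`11`: radius, `12`: scale, `13`: threshold, `14`: displacements, `15`: weights, `16`: sum of weights,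
`17`: rows of the form, `18`: coefficients of the form, `19`: power iterate, `20`: direction,
`21`: step, `22`: change of the displacements, `23`: sign, `24`: living coordinates, `25`: `Q`,
`26`: flag for a good direction, `27`: `stepLen n`, `28`: `boxSize n`, `29`: `rowBound n`,
`30`: norm of the direction, `31`, `32`: the potential after a step in either direction. -/

/-- The scalar in array `a`. -/
abbrev Expr.sc (a : ℕ) : Expr := .cell a 2 2

/-- The entry of the row vector in array `a` with index in variable `j`. -/
abbrev Expr.vec (a j : ℕ) : Expr := .cell a 2 j

/-- The value of the variable `k`. -/
def Expr.idx (k : ℕ) : Expr := .sum k (.const 1)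

/-- The weight of a row with displacement `s`; the bound variable is `l`. -/
def Expr.wt (l : ℕ) (s : Expr) : Expr :=
  .prod 5 (.ite (.idx l) (.sc 29 +ₑ s) (.sc 12 +ₑ .const 1) (.sc 12)) +ₑ
    .prod 5 (.ite (.idx l) (.sc 29 -ₑ s) (.sc 12 +ₑ .const 1) (.sc 12))

/-- `|e|` -/
def Expr.abs (e : Expr) : Expr := .ite e (.const 0) (.const 0 -ₑ e) e

theorem Expr.eval_idx (A : ℕ → ℕ → ℝ) (M : Mem) (k l : ℕ) (v : ℕ → ℕ) :
    (Expr.idx k).eval A M l v = v k := by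
  simp [Expr.idx, Expr.eval]

theorem Expr.eval_abs (A : ℕ → ℕ → ℝ) (M : Mem) (e : Expr) (l : ℕ) (v : ℕ → ℕ) :
    e.abs.eval A M l v = |e.eval A M l v| := by
  simp only [Expr.abs, Expr.eval, BinOp.eval, zero_sub]
  split_ifs with h
  · rw [abs_of_neg h]
  · rw [abs_of_nonneg (not_lt.1 h)]

/-- The variables hold the parameters of the problem. -/
structure BaseVars (m n Q : ℕ) (v : ℕ → ℕ) : Prop where
  v0 : v 0 = m
  v1 : v 1 = n
  v2 : v 2 = 0
  v3 : v 3 = 1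
  v4 : v 4 = m + 1
  v5 : v 5 = Q

theorem BaseVars.update {m n Q : ℕ} {v : ℕ → ℕ} (h : BaseVars m n Q v) {l : ℕ} (hl : 8 ≤ l)
    (i : ℕ) : BaseVars m n Q (Function.update v l i) := by
  constructor <;> rw [Function.update_of_ne (by omega)]
  exacts [h.v0, h.v1, h.v2, h.v3, h.v4, h.v5]

theorem Com.exec_assign (A : ℕ → ℕ → ℝ) (M : Mem) (a p q : ℕ) (e : Expr) (l : ℕ) (v : ℕ → ℕ) :
    ∃ M', (Com.assign a p q e).exec A l v M = M' ∧ (∀ a', a' ≠ a → M' a' = M a') ∧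
      ∀ i < v p, ∀ j < v q, M' a i j =
        e.eval A M (l + 2) (Function.update (Function.update v l i) (l + 1) j) := by
  refine ⟨_, rfl, fun a' h => ?_, fun i hi j hj => ?_⟩
  · funext i j
    simp [Com.exec, Mem.assign, h]
  · simp [Com.exec, Mem.assign, hi, hj]

/-- The arrays that a program may change. -/
def Com.writes : Com → List ℕ
  | .assign a _ _ _ => [a]
  | .seq c d => c.writes ++ d.writes
  | .rep _ c => c.writes

theorem Com.exec_of_not_mem_writes (A : ℕ → ℕ → ℝ) (c : Com) {a : ℕ} (h : a ∉ c.writes) :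
    ∀ (l : ℕ) (v : ℕ → ℕ) (M : Mem), c.exec A l v M a = M a := by
  induction c with
  | assign a' p q e =>
    intro l v M
    have h' : a ≠ a' := by simpa [Com.writes] using h
    funext i j
    simp [Com.exec, Mem.assign, h']
  | seq c d ihc ihd =>
    intro l v M
    simp only [Com.writes, List.mem_append, not_or] at h
    rw [Com.exec, ihd h.2, ihc h.1]
  | rep b c ih =>
    intro l v M
    simp only [Com.exec]
    induction v b with
    | zero => rfl
    | succ k ihk => exact (ih h _ _ _).trans ihk

theorem Expr.eval_wt (A : ℕ → ℕ → ℝ) (M : Mem) {m n Q : ℕ} {v : ℕ → ℕ} (hv : BaseVars m n Q v)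
    (l : ℕ) (hl : 8 ≤ l) (s : Expr) (x : ℤ)
    (hs : ∀ i, s.eval A M (l + 1) (Function.update v l i) = x) :
    (Expr.wt l s).eval A M l v = weight Q (M 29 0 0) (M 12 0 0) x := by
  simp only [Expr.wt, Expr.eval, BinOp.eval, Expr.eval_idx, hs, weight, hv.v5,
    (hv.update hl _).v2, Function.update_self]

/-- Constants and rounding of the input. -/
def initCom : Com :=
  .seq (.assign 5 3 3 (.idx 1)) <|
  .seq (.assign 6 3 3 (.idx 0)) <|
  .seq (.assign 25 3 3 (.idx 5)) <|
  .seq (.assign 27 3 3 (.const 32 *ₑ (.sc 5 *ₑ .sc 5 *ₑ .sc 5 *ₑ .sc 5))) <|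
  .seq (.assign 28 3 3 (.const 2 *ₑ .sc 5 *ₑ .sc 27)) <|
  .seq (.assign 29 3 3 (.const 2 *ₑ (.sc 5 *ₑ .sc 5) *ₑ .sc 28)) <|
  .seq (.assign 4 0 1 (.sum 5 (.iteInput (.idx 10 -ₑ .sc 5) (.sc 5) 8 9 (.const 1) (.const 0)) -ₑ
    .sc 5)) <|
  .assign 7 3 3 (.sc 5)

/-- Find the living coordinates, and start a new phase if they are few. -/
def phaseCom : Com :=
  .seq (.assign 24 3 1 (.ite (.vec 2 10) (.sc 28 -ₑ .sc 27)
    (.ite (.const 0 -ₑ .vec 2 10) (.sc 28 -ₑ .sc 27) (.const 1) (.const 0)) (.const 0))) <|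
  .seq (.assign 8 3 3 (.sum 1 (.vec 24 11))) <|
  .seq (.assign 9 3 3 (.ite (.sc 7) (.sc 8 +ₑ .sc 8) (.const 0) (.const 1))) <|
  .seq (.assign 3 3 1 (.ite (.const 0) (.sc 9) (.vec 2 10) (.vec 3 10))) <|
  .assign 7 3 3 (.ite (.const 0) (.sc 9) (.sc 8) (.sc 7))

/-- The potential. -/
def potentialCom : Com :=
  .seq (.assign 10 3 3 (.const 1 +ₑ .sum 5 (.ite (.prod 11 (.const 2) *ₑ .sc 7)
    (.const 4 *ₑ .sc 6) (.const 1) (.const 0)))) <|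
  .seq (.assign 11 3 3 (.const 1 +ₑ .sum 5 (.ite
    ((.idx 11 +ₑ .const 1) *ₑ (.idx 11 +ₑ .const 1) *ₑ .sc 10) (.sc 7) (.const 1) (.const 0)))) <|
  .seq (.assign 12 3 3 (.sc 28 *ₑ .sc 5 *ₑ .sc 11)) <|
  .seq (.assign 13 3 3 (.const 80 *ₑ .sc 10 *ₑ .sc 12)) <|
  .seq (.assign 14 0 3 (.sum 1 (.cell 4 9 11 *ₑ (.vec 2 11 -ₑ .vec 3 11)))) <|
  .seq (.assign 15 0 3 (.wt 11 (.cell 14 9 2))) <|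
  .assign 16 3 3 (.sum 0 (.cell 15 11 2))

/-- The coefficient of the heavy rows. -/
def Expr.heavy : Expr := .const 3 *ₑ (.sc 27 *ₑ .sc 27) *ₑ .sc 16

/-- The quadratic form. -/
def formCom : Com :=
  .seq (.assign 17 4 1 (.ite (.idx 9) (.sc 6) (.cell 4 9 10) (.vec 2 10) *ₑ .vec 24 10)) <|
  .assign 18 4 3 (.ite (.idx 9) (.sc 6)
    (.ite (.cell 14 9 2) (.sc 13) (.ite (.const 0 -ₑ .cell 14 9 2) (.sc 13) (.cell 15 9 2) .heavy)
      .heavy) .heavy)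

/-- Search for a good direction. -/
def searchCom : Com :=
  .rep 1 <|
    .seq (.assign 19 3 1 (.ite (.idx 11) (.idx 9) (.const 0)
      (.ite (.idx 9) (.idx 11) (.const 0) (.vec 24 11)))) <|
    .seq (.rep 5 (.assign 19 3 1 (.sc 16 *ₑ .sc 25 *ₑ .vec 19 12 -ₑ
      .sum 4 (.cell 18 13 2 *ₑ .cell 17 13 12 *ₑ .sum 1 (.cell 17 13 14 *ₑ .vec 19 14))))) <|
    .seq (.assign 26 3 3 (.ite
      (.sum 4 (.cell 18 12 2 *ₑ (.sum 1 (.cell 17 12 13 *ₑ .vec 19 13) *ₑ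
        .sum 1 (.cell 17 12 13 *ₑ .vec 19 13))))
      (.const 3 *ₑ (.sc 5 *ₑ .sc 5) *ₑ .sc 16 *ₑ .sum 1 (.vec 19 12 *ₑ .vec 19 12))
      (.const 1) (.const 0))) <|
    .assign 20 3 1 (.ite (.const 0) (.sc 26) (.vec 19 11) (.vec 20 11))

/-- Move in the direction that has been found. -/
def moveCom : Com :=
  .seq (.assign 30 3 3 (.sum 1 (.abs (.vec 20 11)))) <|
  .seq (.assign 21 3 1 (.sum 5 (.ite (.sc 27 *ₑ .vec 20 10)
    ((.idx 11 +ₑ .const 1 -ₑ .sc 27) *ₑ .sc 30) (.const 0) (.const 1)) -ₑ .sc 27)) <|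
  .seq (.assign 22 0 3 (.sum 1 (.cell 4 9 11 *ₑ .vec 21 11))) <|
  .seq (.assign 31 3 3 (.sum 0 (.wt 12 (.cell 14 11 2 +ₑ .cell 22 11 2)))) <|
  .seq (.assign 32 3 3 (.sum 0 (.wt 12 (.cell 14 11 2 -ₑ .cell 22 11 2)))) <|
  .seq (.assign 23 3 3 (.ite (.sc 32) (.sc 31) (.const (-1)) (.const 1))) <|
  .assign 2 3 1 (.ite (.sc 8) (.const 16) (.vec 2 10) (.vec 2 10 +ₑ .sc 23 *ₑ .vec 21 10))

def stepCom : Com :=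
  .seq phaseCom (.seq potentialCom (.seq formCom (.seq searchCom moveCom)))

def mainCom : Com :=
  .seq initCom (.seq (.rep 5 stepCom)
    (.assign 1 3 1 (.ite (.vec 2 9) (.const 0) (.const (-1)) (.const 1))))

theorem mainCom_wf : mainCom.wf 8 = true := by decide

end RealRAM

/-! ### Correctness of the phase, potential and form computations -/

namespace RealRAM

/-- Replacing the new memory by an arbitrary one with the relevant properties keeps terms small
through long sequences of assignments. -/
theorem Com.exec_assign_elim {P : Mem → Prop} {A : ℕ → ℕ → ℝ} {M : Mem} {a p q : ℕ} {e : Expr}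
    {l : ℕ} {v : ℕ → ℕ}
    (h : ∀ M' : Mem, (∀ a', a' ≠ a → M' a' = M a') → (∀ i < v p, ∀ j < v q, M' a i j =
      e.eval A M (l + 2) (Function.update (Function.update v l i) (l + 1) j)) → P M') :
    P ((Com.assign a p q e).exec A l v M) := by
  obtain ⟨M', e1, h1, h2⟩ := Com.exec_assign A M a p q e l v
  rw [e1]
  exact h M' h1 h2

theorem Com.exec_seq_assign_elim {P : Mem → Prop} {A : ℕ → ℕ → ℝ} {M : Mem} {a p q : ℕ} {e : Expr}
    {d : Com} {l : ℕ} {v : ℕ → ℕ}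
    (h : ∀ M' : Mem, (∀ a', a' ≠ a → M' a' = M a') → (∀ i < v p, ∀ j < v q, M' a i j =
      e.eval A M (l + 2) (Function.update (Function.update v l i) (l + 1) j)) →
      P (d.exec A l v M')) :
    P ((Com.seq (.assign a p q e) d).exec A l v M) :=
  Com.exec_assign_elim (P := fun M' => P (d.exec A l v M')) h

/-- The constants and the rounded matrix. -/
structure ConstMem (n m Q : ℕ) (b : ℕ → ℕ → ℤ) (M : Mem) : Prop where
  c5 : M 5 0 0 = n
  c6 : M 6 0 0 = m
  c25 : M 25 0 0 = Q
  c27 : M 27 0 0 = stepLen n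
  c28 : M 28 0 0 = boxSize n
  c29 : M 29 0 0 = rowBound n
  c4 : M 4 = b

theorem ConstMem.of_eq {n m Q : ℕ} {b : ℕ → ℕ → ℤ} {M M' : Mem} (h : ConstMem n m Q b M)
    (hM : ∀ a ∈ [4, 5, 6, 25, 27, 28, 29], M' a = M a) : ConstMem n m Q b M' := by
  constructor
  · rw [hM 5 (by simp)]; exact h.c5
  · rw [hM 6 (by simp)]; exact h.c6
  · rw [hM 25 (by simp)]; exact h.c25
  · rw [hM 27 (by simp)]; exact h.c27
  · rw [hM 28 (by simp)]; exact h.c28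
  · rw [hM 29 (by simp)]; exact h.c29
  · rw [hM 4 (by simp)]; exact h.c4

section

variable {n m Q : ℕ} {b : ℕ → ℕ → ℤ} {A : ℕ → ℕ → ℝ} {M : Mem} {v : ℕ → ℕ} {k₀ : ℕ}

structure PhaseSpec (n : ℕ) (k₀ : ℕ) (M M' : Mem) : Prop where
  alive : ∀ j < n, M' 24 0 j = if j ∈ aliveSet n (M 2 0) then 1 else 0
  card : M' 8 0 0 = (aliveSet n (M 2 0)).card
  start : ∀ j < n, M' 3 0 j = if 2 * (aliveSet n (M 2 0)).card ≤ k₀ then M 2 0 j else M 3 0 j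
  size : M' 7 0 0 =
    ((if 2 * (aliveSet n (M 2 0)).card ≤ k₀ then (aliveSet n (M 2 0)).card else k₀ : ℕ) : ℤ)

theorem phaseCom_spec (hv : BaseVars m n Q v) (hM : ConstMem n m Q b M) (hk : M 7 0 0 = k₀) :
    PhaseSpec n k₀ M (phaseCom.exec A 9 v M) := by
  unfold phaseCom
  refine Com.exec_seq_assign_elim fun M1 o1 h1 => ?_
  refine Com.exec_seq_assign_elim fun M2 o2 h2 => ?_
  refine Com.exec_seq_assign_elim fun M3 o3 h3 => ?_
  refine Com.exec_seq_assign_elim fun M4 o4 h4 => ?_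
  refine Com.exec_assign_elim fun M5 o5 h5 => ?_
  simp only [Expr.eval, BinOp.eval, Function.update_apply, hv.v1, hv.v2, hv.v3, Nat.reduceAdd, Nat.reduceEqDiff, reduceIte, Nat.lt_one_iff, forall_eq] at h1 h2 h3 h4 h5
  rw [hM.c27, hM.c28] at h1
  have e1 : ∀ j < n, M1 24 0 j = if j ∈ aliveSet n (M 2 0) then 1 else 0 := by
    intro j hj
    rw [h1 j hj]
    simp only [aliveSet, Finset.mem_filter, Finset.mem_range, hj, true_and, abs_lt, ite_and]
    split_ifs <;> omega
  have e2 : M2 8 0 0 = (aliveSet n (M 2 0)).card := by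
    rw [h2, Finset.sum_congr rfl fun j hj => e1 j (Finset.mem_range.1 hj), Finset.sum_boole,
      Finset.filter_mem_eq_inter]
    congr 2
    exact Finset.inter_eq_right.2 (Finset.filter_subset _ _)
  have e3 : M3 9 0 0 = if 2 * (aliveSet n (M 2 0)).card ≤ k₀ then 1 else 0 := by
    rw [h3, e2, o2 7 (by decide), o1 7 (by decide), hk]
    split_ifs <;> omega
  refine ⟨fun j hj => ?_, ?_, fun j hj => ?_, ?_⟩
  · rw [o5 24 (by decide), o4 24 (by decide), o3 24 (by decide), o2 24 (by decide), e1 j hj]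
  · rw [o5 8 (by decide), o4 8 (by decide), o3 8 (by decide), e2]
  · rw [o5 3 (by decide), h4 j hj, e3, o3 2 (by decide), o2 2 (by decide), o1 2 (by decide),
      o3 3 (by decide), o2 3 (by decide), o1 3 (by decide)]
    split_ifs <;> first | rfl | omega
  · rw [h5, o4 9 (by decide), e3, o4 8 (by decide), o3 8 (by decide), e2, o4 7 (by decide),
      o3 7 (by decide), o2 7 (by decide), o1 7 (by decide), hk]
    split_ifs <;> first | rfl | omega

structure PotentialSpec (n m Q : ℕ) (b : ℕ → ℕ → ℤ) (x x₀ : ℕ → ℤ) (k₀ : ℕ) (M' : Mem) : Prop where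
  scale : M' 12 0 0 = scaleOf n Q m k₀
  threshold : M' 13 0 0 = threshold n Q m k₀
  row : ∀ i < m, M' 14 i 0 = rowSum n b (x - x₀) i
  weight : ∀ i < m, M' 15 i 0 = walkWeight n m Q b x x₀ k₀ i
  sum : M' 16 0 0 = ∑ i ∈ Finset.range m, walkWeight n m Q b x x₀ k₀ i

theorem potentialCom_spec (hv : BaseVars m n Q v) (hM : ConstMem n m Q b M) (hk : M 7 0 0 = k₀) :
    PotentialSpec n m Q b (M 2 0) (M 3 0) k₀ (potentialCom.exec A 9 v M) := by
  unfold potentialCom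
  refine Com.exec_seq_assign_elim fun M1 o1 h1 => ?_
  refine Com.exec_seq_assign_elim fun M2 o2 h2 => ?_
  refine Com.exec_seq_assign_elim fun M3 o3 h3 => ?_
  refine Com.exec_seq_assign_elim fun M4 o4 h4 => ?_
  refine Com.exec_seq_assign_elim fun M5 o5 h5 => ?_
  refine Com.exec_seq_assign_elim fun M6 o6 h6 => ?_
  refine Com.exec_assign_elim fun M7 o7 h7 => ?_
  simp only [Expr.eval, Expr.eval_idx, BinOp.eval, Function.update_apply, hv.v0, hv.v1, hv.v2,
    hv.v3, hv.v5, Nat.reduceAdd, Nat.reduceEqDiff, reduceIte, Nat.lt_one_iff, forall_eq,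
    Finset.prod_const, Finset.card_range] at h1 h2 h3 h4 h5 h7
  have e1 : M1 10 0 0 = levelOf Q m k₀ := by
    rw [h1, hk, hM.c6, levelOf, Nat.cast_add, Nat.cast_one, ← Finset.sum_boole]
    congr 1
    exact Finset.sum_congr rfl fun t _ => if_congr (by norm_cast) rfl rfl
  have e2 : M2 11 0 0 = radiusOf Q (levelOf Q m k₀) k₀ := by
    rw [h2, e1, o1 7 (by decide), hk, radiusOf, Nat.cast_add, Nat.cast_one, ← Finset.sum_boole]
    congr 1
    exact Finset.sum_congr rfl fun t _ => if_congr (by rw [← sq]; norm_cast) rfl rfl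
  have e3 : M3 12 0 0 = scaleOf n Q m k₀ := by
    rw [h3, e2, o2 28 (by decide), o1 28 (by decide), o2 5 (by decide), o1 5 (by decide), hM.c28,
      hM.c5, scaleOf, boxSize]
    push_cast
    ring
  have e4 : M4 13 0 0 = threshold n Q m k₀ := by
    rw [h4, e3, o3 10 (by decide), o2 10 (by decide), e1, threshold]
    push_cast
    ring
  have e5 : ∀ i < m, M5 14 i 0 = rowSum n b (M 2 0 - M 3 0) i := by
    intro i hi
    rw [h5 i hi, o4 4 (by decide), o3 4 (by decide), o2 4 (by decide), o1 4 (by decide), hM.c4,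
      o4 2 (by decide), o3 2 (by decide), o2 2 (by decide), o1 2 (by decide),
      o4 3 (by decide), o3 3 (by decide), o2 3 (by decide), o1 3 (by decide)]
    rfl
  have e6 : ∀ i < m, M6 15 i 0 = walkWeight n m Q b (M 2 0) (M 3 0) k₀ i := by
    intro i hi
    rw [h6 i (by rwa [hv.v0]) 0 (by simp [hv.v3]),
      Expr.eval_wt A M5 ((hv.update (l := 9) (by norm_num) i).update (l := 9 + 1) (by norm_num) 0)
        (9 + 2) (by norm_num) _ (rowSum n b (M 2 0 - M 3 0) i) fun k => by
          simp [Expr.eval, hv.v2, e5 i hi]]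
    · rw [o5 29 (by decide), o4 29 (by decide), o3 29 (by decide), o2 29 (by decide),
        o1 29 (by decide), hM.c29, o5 12 (by decide), o4 12 (by decide), e3, walkWeight]
  have e7 : M7 16 0 0 = ∑ i ∈ Finset.range m, walkWeight n m Q b (M 2 0) (M 3 0) k₀ i := by
    rw [h7]
    exact Finset.sum_congr rfl fun i hi => e6 i (Finset.mem_range.1 hi)
  refine ⟨?_, ?_, fun i hi => ?_, fun i hi => ?_, e7⟩
  · rw [o7 12 (by decide), o6 12 (by decide), o5 12 (by decide), o4 12 (by decide), e3]
  · rw [o7 13 (by decide), o6 13 (by decide), o5 13 (by decide), e4]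
  · rw [o7 14 (by decide), o6 14 (by decide), e5 i hi]
  · rw [o7 15 (by decide), e6 i hi]

structure FormSpec (n m Q : ℕ) (b : ℕ → ℕ → ℤ) (x x₀ : ℕ → ℤ) (k₀ : ℕ) (M' : Mem) : Prop where
  row : ∀ i < m + 1, ∀ j < n, M' 17 i j = formRow m b x (aliveSet n x) i j
  coeff : ∀ i < m + 1, M' 18 i 0 = formCoeff m (heavyRows n m Q b x x₀ k₀)
    (walkWeight n m Q b x x₀ k₀) (heavyCoeff n m Q b x x₀ k₀) i

theorem formCom_spec {x₀ : ℕ → ℤ} (hv : BaseVars m n Q v) (hM : ConstMem n m Q b M)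
    (h24 : ∀ j < n, M 24 0 j = if j ∈ aliveSet n (M 2 0) then 1 else 0)
    (hP : PotentialSpec n m Q b (M 2 0) x₀ k₀ M) :
    FormSpec n m Q b (M 2 0) x₀ k₀ (formCom.exec A 9 v M) := by
  unfold formCom
  refine Com.exec_seq_assign_elim fun M1 o1 h1 => ?_
  refine Com.exec_assign_elim fun M2 o2 h2 => ?_
  simp only [Expr.eval, Expr.eval_idx, Expr.heavy, BinOp.eval, Function.update_apply, hv.v1,
    hv.v2, hv.v3, hv.v4, Nat.reduceAdd, Nat.reduceEqDiff, reduceIte, Nat.lt_one_iff,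
    forall_eq] at h1 h2
  refine ⟨fun i hi j hj => ?_, fun i hi => ?_⟩
  · rw [o2 17 (by decide), h1 i hi j hj, h24 j hj, hM.c6, hM.c4, formRow]
    simp only [Nat.cast_lt]
  · rw [h2 i hi, o1 6 (by decide), o1 14 (by decide), o1 13 (by decide), o1 15 (by decide),
      o1 27 (by decide), o1 16 (by decide), hM.c6, hP.threshold, hP.sum, hM.c27, formCoeff]
    simp only [Nat.cast_lt]
    have hH : 3 * (stepLen n * stepLen n) * ∑ i ∈ Finset.range m,
        walkWeight n m Q b (M 2 0) x₀ k₀ i = heavyCoeff n m Q b (M 2 0) x₀ k₀ := by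
      rw [heavyCoeff, sq]
    rw [hH]
    by_cases him : i < m
    · rw [if_pos him, if_pos him, hP.row i him, hP.weight i him]
      simp only [heavyRows, Finset.mem_filter, Finset.mem_range, him, true_and, le_abs]
      split_ifs <;> first | rfl | omega
    · rw [if_neg him, if_neg him]

end
end RealRAM

section

variable {n m Q : ℕ} {b : ℕ → ℕ → ℤ} {x x₀ : ℕ → ℤ} {k₀ : ℕ}

theorem GoodDirection.congr {z z' : ℕ → ℤ} (h : GoodDirection n m Q b x x₀ k₀ z)
    (hz : ∀ j < n, z' j = z j) : GoodDirection n m Q b x x₀ k₀ z' := by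
  have e1 : ∀ f : ℕ → ℤ, ∑ j ∈ Finset.range n, f j * z' j = ∑ j ∈ Finset.range n, f j * z j :=
    fun f => Finset.sum_congr rfl fun j hj => by rw [hz j (Finset.mem_range.1 hj)]
  have e2 : ∑ j ∈ Finset.range n, z' j * z' j = ∑ j ∈ Finset.range n, z j * z j :=
    Finset.sum_congr rfl fun j hj => by rw [hz j (Finset.mem_range.1 hj)]
  rw [GoodDirection] at h ⊢
  simpa only [e2, e1] using h

theorem walkIter_eq_zero {z : ℕ → ℤ} {j : ℕ} (hj : j ∉ aliveSet n x) (hz : z j = 0) :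
    walkIter n m Q b x x₀ k₀ z j = 0 := by
  simp [walkIter, iterStep, formRow, hj, hz]

theorem iterate_walkIter_eq_zero {z : ℕ → ℤ} {j : ℕ} (hj : j ∉ aliveSet n x) (hz : z j = 0)
    (r : ℕ) : (walkIter n m Q b x x₀ k₀)^[r] z j = 0 := by
  induction r with
  | zero => exact hz
  | succ r ih => rw [Function.iterate_succ_apply']; exact walkIter_eq_zero hj ih

end

/-! ### Correctness of the search for a direction -/

namespace RealRAM

theorem Com.exec_rep_elim {P : Mem → Prop} (R : ℕ → Mem → Prop) {A : ℕ → ℕ → ℝ} {M : Mem} {b : ℕ}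
    {c : Com} {l : ℕ} {v : ℕ → ℕ} (h0 : R 0 M)
    (hs : ∀ i < v b, ∀ M', R i M' → R (i + 1) (c.exec A (l + 1) (Function.update v l i) M'))
    (h : ∀ M', R (v b) M' → P M') : P ((Com.rep b c).exec A l v M) := by
  refine h _ ?_
  simp only [Com.exec]
  generalize v b = k at hs
  induction k with
  | zero => exact h0
  | succ k ih => exact hs k (Nat.lt_succ_self k) _ (ih fun i hi => hs i (hi.trans (Nat.lt_succ_self k)))

theorem Com.exec_seq_rep_elim {P : Mem → Prop} (R : ℕ → Mem → Prop) {A : ℕ → ℕ → ℝ} {M : Mem}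
    {b : ℕ} {c d : Com} {l : ℕ} {v : ℕ → ℕ} (h0 : R 0 M)
    (hs : ∀ i < v b, ∀ M', R i M' → R (i + 1) (c.exec A (l + 1) (Function.update v l i) M'))
    (h : ∀ M', R (v b) M' → P (d.exec A l v M')) :
    P ((Com.seq (.rep b c) d).exec A l v M) :=
  Com.exec_rep_elim (P := fun M' => P (d.exec A l v M')) R h0 hs h

section

variable {n m Q : ℕ} {b : ℕ → ℕ → ℤ} {A : ℕ → ℕ → ℝ} {M : Mem} {v : ℕ → ℕ} {x x₀ : ℕ → ℤ} {k₀ : ℕ}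

/-- The arrays read by the search. -/
structure SearchMem (n m Q : ℕ) (b : ℕ → ℕ → ℤ) (x x₀ : ℕ → ℤ) (k₀ : ℕ) (M : Mem) : Prop where
  form : FormSpec n m Q b x x₀ k₀ M
  alive : ∀ j < n, M 24 0 j = if j ∈ aliveSet n x then 1 else 0
  sum : M 16 0 0 = ∑ i ∈ Finset.range m, walkWeight n m Q b x x₀ k₀ i
  c5 : M 5 0 0 = n
  c25 : M 25 0 0 = Q

theorem SearchMem.of_eq {M M' : Mem} (h : SearchMem n m Q b x x₀ k₀ M)
    (hM : ∀ a, a ≠ 19 → a ≠ 20 → a ≠ 26 → M' a = M a) : SearchMem n m Q b x x₀ k₀ M' where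
  form := ⟨by rw [hM 17 (by decide) (by decide) (by decide)]; exact h.form.row,
    by rw [hM 18 (by decide) (by decide) (by decide)]; exact h.form.coeff⟩
  alive := by rw [hM 24 (by decide) (by decide) (by decide)]; exact h.alive
  sum := by rw [hM 16 (by decide) (by decide) (by decide)]; exact h.sum
  c5 := by rw [hM 5 (by decide) (by decide) (by decide)]; exact h.c5
  c25 := by rw [hM 25 (by decide) (by decide) (by decide)]; exact h.c25

theorem searchCom_spec (hv : BaseVars m n Q v) (hM : SearchMem n m Q b x x₀ k₀ M)
    (hex : ∃ a ∈ aliveSet n x, GoodDirection n m Q b x x₀ k₀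
      ((walkIter n m Q b x x₀ k₀)^[Q] (Pi.single a 1))) :
    GoodDirection n m Q b x x₀ k₀ (searchCom.exec A 9 v M 20 0) ∧
      ∀ j < n, j ∉ aliveSet n x → searchCom.exec A 9 v M 20 0 j = 0 := by
  unfold searchCom
  -- A successful start overwrites array 20 and a failed one leaves it alone, so it suffices that
  -- some start before i succeeds.
  set R : ℕ → Mem → Prop := fun i M' => SearchMem n m Q b x x₀ k₀ M' ∧
      ((∃ a < i, a ∈ aliveSet n x ∧
        GoodDirection n m Q b x x₀ k₀ ((walkIter n m Q b x x₀ k₀)^[Q] (Pi.single a 1))) →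
      GoodDirection n m Q b x x₀ k₀ (M' 20 0) ∧ ∀ j < n, j ∉ aliveSet n x → M' 20 0 j = 0) with hR
  refine Com.exec_rep_elim (P := fun M' => GoodDirection n m Q b x x₀ k₀ (M' 20 0) ∧
      ∀ j < n, j ∉ aliveSet n x → M' 20 0 j = 0) R
    ⟨hM, fun ⟨a, ha, _⟩ => absurd ha (Nat.not_lt_zero a)⟩ ?_ ?_
  · intro k hk M0 ⟨hM0, ih⟩
    have hv' : BaseVars m n Q (Function.update v 9 k) := hv.update (by norm_num) k
    rw [hv.v1] at hk
    set w := Function.update v 9 k with hw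
    have hw9 : w 9 = k := by simp [hw]
    -- All n indices are tried; a dead one starts from 0, so every iterate vanishes outside the
    -- living coordinates.
    set z₀ : ℕ → ℤ := if k ∈ aliveSet n x then Pi.single k 1 else 0 with hz₀
    refine Com.exec_seq_assign_elim (P := R (k + 1)) fun M1 o1 h1 => ?_
    simp only [Expr.eval, Expr.eval_idx, Function.update_apply, hv'.v1, hv'.v2, hv'.v3, hw9,
      Nat.reduceAdd, Nat.reduceEqDiff, reduceIte, Nat.lt_one_iff, forall_eq, Nat.cast_lt] at h1
    have e1 : ∀ j < n, M1 19 0 j = z₀ j := by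
      intro j hj
      rw [h1 j hj, hM0.alive j hj, hz₀]
      rcases lt_trichotomy k j with h | h | h
      · rw [if_pos h]
        split_ifs <;> simp [h.ne']
      · subst h
        simp only [lt_self_iff_false, reduceIte]
        split_ifs <;> simp
      · rw [if_neg h.le.not_gt, if_pos h]
        split_ifs <;> simp [h.ne]
    refine Com.exec_seq_rep_elim (P := R (k + 1)) (fun r M' => (∀ a, a ≠ 19 → M' a = M0 a) ∧
      ∀ j < n, M' 19 0 j = (walkIter n m Q b x x₀ k₀)^[r] z₀ j) ⟨o1, e1⟩ ?_ fun M2 ⟨o2, h2⟩ => ?_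
    · intro r _ M2 ⟨o2, h2⟩
      have hM2 := hM0.of_eq fun a h19 _ _ => o2 a h19
      refine Com.exec_assign_elim (P := fun M' => (∀ a, a ≠ 19 → M' a = M0 a) ∧
        ∀ j < n, M' 19 0 j = (walkIter n m Q b x x₀ k₀)^[r + 1] z₀ j)
        fun M3 o3 h3 => ⟨fun a ha => (o3 a ha).trans (o2 a ha), ?_⟩
      simp only [Expr.eval, BinOp.eval, Function.update_apply, hv'.v1, hv'.v2, hv'.v3, hv'.v4,
        Nat.reduceAdd, Nat.reduceEqDiff, reduceIte, Nat.lt_one_iff, forall_eq] at h3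
      intro j hj
      rw [h3 j hj, Function.iterate_succ_apply', walkIter, iterStep, hM2.sum, hM2.c25,
        ← walkIter, h2 j hj]
      congr 1
      refine Finset.sum_congr rfl fun i hi => ?_
      have hi' := Finset.mem_range.1 hi
      rw [hM2.form.coeff i hi', hM2.form.row i hi' j hj]
      congr 1
      refine Finset.sum_congr rfl fun p hp => ?_
      have hp' := Finset.mem_range.1 hp
      rw [hM2.form.row i hi' p hp', h2 p hp']
    · rw [hv'.v5] at h2
      have hM2 := hM0.of_eq fun a h19 _ _ => o2 a h19
      refine Com.exec_seq_assign_elim (P := R (k + 1)) fun M3 o3 h3 => ?_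
      refine Com.exec_assign_elim (P := R (k + 1)) fun M4 o4 h4 => ?_
      simp only [Expr.eval, BinOp.eval, Function.update_apply, hv'.v1, hv'.v2, hv'.v3, hv'.v4,
        Nat.reduceAdd, Nat.reduceEqDiff, reduceIte, Nat.lt_one_iff, forall_eq] at h3 h4
      have hM4 : SearchMem n m Q b x x₀ k₀ M4 := hM2.of_eq fun a _ h20 h26 =>
        (o4 a h20).trans (o3 a h26)
      refine ⟨hM4, ?_⟩
      have e3 : M3 26 0 0 = 1 ∧ GoodDirection n m Q b x x₀ k₀ (M2 19 0) ∨
          M3 26 0 0 = 0 ∧ ¬ GoodDirection n m Q b x x₀ k₀ (M2 19 0) := by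
        have h : (∑ i ∈ Finset.range (m + 1), M2 18 i 0 *
            ((∑ j ∈ Finset.range n, M2 17 i j * M2 19 0 j) *
              ∑ j ∈ Finset.range n, M2 17 i j * M2 19 0 j) <
            3 * (M2 5 0 0 * M2 5 0 0) * M2 16 0 0 * ∑ j ∈ Finset.range n, M2 19 0 j * M2 19 0 j) ↔
            GoodDirection n m Q b x x₀ k₀ (M2 19 0) := by
          rw [GoodDirection, hM2.c5, hM2.sum, sq (n : ℤ)]
          refine Eq.to_iff (congrArg₂ _ (Finset.sum_congr rfl fun i hi => ?_) rfl)
          have hi' := Finset.mem_range.1 hi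
          rw [hM2.form.coeff i hi', ← sq]
          congr 2
          exact Finset.sum_congr rfl fun j hj => by rw [hM2.form.row i hi' j (Finset.mem_range.1 hj)]
        rw [h3]
        by_cases hg : GoodDirection n m Q b x x₀ k₀ (M2 19 0)
        · exact Or.inl ⟨if_pos (h.2 hg), hg⟩
        · exact Or.inr ⟨if_neg (mt h.1 hg), hg⟩
      rcases e3 with ⟨e3, hg⟩ | ⟨e3, hg⟩
      · intro _
        simp only [e3, zero_lt_one, reduceIte, o3 19 (by decide)] at h4
        refine ⟨hg.congr h4, fun j hj hja => ?_⟩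
        rw [h4 j hj, h2 j hj]
        refine iterate_walkIter_eq_zero hja ?_ Q
        rw [hz₀]
        split_ifs with hka
        · exact Pi.single_eq_of_ne (by rintro rfl; exact hja hka) 1
        · rfl
      · rintro ⟨a, ha, haal, hgood⟩
        simp only [e3, lt_self_iff_false, reduceIte, o3 20 (by decide), o2 20 (by decide)] at h4
        rcases Nat.lt_succ_iff_lt_or_eq.1 ha with ha | rfl
        · obtain ⟨i1, i2⟩ := ih ⟨a, ha, haal, hgood⟩
          exact ⟨i1.congr h4, fun j hj hja => (h4 j hj).trans (i2 j hj hja)⟩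
        · refine absurd (hgood.congr fun j hj => ?_) hg
          rw [h2 j hj, hz₀, if_pos haal]
  · rintro M' ⟨-, h⟩
    obtain ⟨a, ha, hg⟩ := hex
    refine h ⟨a, ?_, ha, hg⟩
    rw [hv.v1]
    exact Finset.mem_range.1 (Finset.mem_filter.1 ha).1

end
end RealRAM

section

variable {n m Q t : ℕ} {b : ℕ → ℕ → ℤ} {x x₀ x' x₀' : ℕ → ℤ} {k₀ : ℕ}

theorem rowSum_congr (hx : ∀ j < n, x' j = x j) (i : ℕ) : rowSum n b x' i = rowSum n b x i :=
  Finset.sum_congr rfl fun j hj => by rw [hx j (Finset.mem_range.1 hj)]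

theorem aliveSet_congr (hx : ∀ j < n, x' j = x j) : aliveSet n x' = aliveSet n x :=
  Finset.filter_congr fun j hj => by rw [hx j (Finset.mem_range.1 hj)]

theorem energy_congr (hx : ∀ j < n, x' j = x j) : energy n x' = energy n x :=
  Finset.sum_congr rfl fun j hj => by rw [hx j (Finset.mem_range.1 hj)]

/-- Assignments specify only the first n entries of an array row, so the invariant must be
insensitive to the rest. -/
theorem WalkInv.congr (h : WalkInv n m Q b t x x₀ k₀) (hx : ∀ j < n, x' j = x j)
    (hx₀ : ∀ j < n, x₀' j = x₀ j) : WalkInv n m Q b t x' x₀' k₀ := by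
  have hr : ∀ i, rowSum n b (x' - x₀') i = rowSum n b (x - x₀) i := rowSum_congr fun j hj => by
    rw [Pi.sub_apply, Pi.sub_apply, hx j hj, hx₀ j hj]
  constructor
  · exact fun j hj => by rw [hx j hj]; exact h.box j hj
  · exact fun j hj => by rw [hx₀ j hj]; exact h.box₀ j hj
  · exact h.le
  · rw [aliveSet_congr hx, aliveSet_congr hx₀]; exact h.subset
  · rw [aliveSet_congr hx₀]; exact h.card_le
  · intro j hj hj'
    rw [hx j hj, hx₀ j hj]
    exact h.frozen j hj (by rwa [aliveSet_congr hx₀] at hj')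
  · rw [energy_congr hx, energy_congr hx₀]; exact h.energy_le
  · simp only [hr, energy_congr hx, energy_congr hx₀]; exact h.potential
  · simp only [hr, energy_congr hx, energy_congr hx₀]; exact h.row
  · simp only [rowSum_congr hx₀]; exact h.start
  · rw [energy_congr hx, aliveSet_congr hx]; exact h.progress

end

/-! ### Correctness of the move and of the main loop -/

namespace RealRAM

section

variable {n m Q t : ℕ} {b : ℕ → ℕ → ℤ} {A : ℕ → ℕ → ℝ} {M : Mem} {v : ℕ → ℕ} {x₀ : ℕ → ℤ} {k₀ : ℕ}

/-- The count is of those t with (t + 1 - L)Z ≤ Lz. Since |z| ≤ Z, the floor of Lz/Z lies between -L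
and L, so 2L candidates suffice. -/
theorem count_sub_eq_floor {Q : ℕ} {L z Z : ℤ} (hZ : 0 < Z) (hz : |z| ≤ Z) (hL : 0 ≤ L)
    (hQ : 2 * L ≤ Q) {y : ℤ}
    (hy : y = (∑ t ∈ Finset.range Q, if L * z < ((t : ℤ) + 1 - L) * Z then 0 else 1) - L) :
    y * Z ≤ L * z ∧ L * z < (y + 1) * Z := by
  obtain ⟨h1, h2⟩ := abs_le.1 hz
  obtain ⟨c, hc, -, h3, h4⟩ := count_eq_first (Q := Q)
    (fun t => ¬ L * z < ((t : ℤ) + 1 - L) * Z)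
    (fun s t hst h => by
      have : (s : ℤ) ≤ t := by exact_mod_cast hst
      rw [not_lt] at h ⊢
      exact (mul_le_mul_of_nonneg_right (by linarith) hZ.le).trans h)
    (by
      rw [not_not]
      calc L * z ≤ L * Z := mul_le_mul_of_nonneg_left h2 hL
        _ < _ := mul_lt_mul_of_pos_right (by linarith) hZ)
  simp only [ite_not] at hc
  rw [hc] at hy
  subst hy
  refine ⟨?_, ?_⟩
  · rcases Nat.eq_zero_or_pos c with rfl | h0
    · have := mul_le_mul_of_nonneg_left h1 hL
      push_cast
      linarith
    · have := not_lt.1 (h4 (c - 1) (by omega))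
      rw [Nat.cast_sub h0] at this
      simpa using this
  · have := not_not.1 h3
    rwa [show (c : ℤ) - L + 1 = c + 1 - L by ring]

theorem moveCom_spec (P : Params n m Q b) (hv : BaseVars m n Q v) (hM : ConstMem n m Q b M)
    (hP : PotentialSpec n m Q b (M 2 0) x₀ k₀ M) (h8 : M 8 0 0 = (aliveSet n (M 2 0)).card)
    (h : WalkInv n m Q b t (M 2 0) x₀ k₀)
    (hgood : 16 ≤ (aliveSet n (M 2 0)).card → GoodDirection n m Q b (M 2 0) x₀ k₀ (M 20 0) ∧
      ∀ j < n, j ∉ aliveSet n (M 2 0) → M 20 0 j = 0) :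
    WalkInv n m Q b (t + 1) (moveCom.exec A 9 v M 2 0) x₀ k₀ := by
  unfold moveCom
  refine Com.exec_seq_assign_elim (P := fun M' => WalkInv n m Q b (t + 1) (M' 2 0) x₀ k₀)
    fun M1 o1 h1 => ?_
  refine Com.exec_seq_assign_elim (P := fun M' => WalkInv n m Q b (t + 1) (M' 2 0) x₀ k₀)
    fun M2 o2 h2 => ?_
  refine Com.exec_seq_assign_elim (P := fun M' => WalkInv n m Q b (t + 1) (M' 2 0) x₀ k₀)
    fun M3 o3 h3 => ?_
  refine Com.exec_seq_assign_elim (P := fun M' => WalkInv n m Q b (t + 1) (M' 2 0) x₀ k₀)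
    fun M4 o4 h4 => ?_
  refine Com.exec_seq_assign_elim (P := fun M' => WalkInv n m Q b (t + 1) (M' 2 0) x₀ k₀)
    fun M5 o5 h5 => ?_
  refine Com.exec_seq_assign_elim (P := fun M' => WalkInv n m Q b (t + 1) (M' 2 0) x₀ k₀)
    fun M6 o6 h6 => ?_
  refine Com.exec_assign_elim (P := fun M' => WalkInv n m Q b (t + 1) (M' 2 0) x₀ k₀)
    fun M7 o7 h7 => ?_
  have hwt : ∀ (N : Mem) (e : Expr) (s : ℕ → ℤ), N 29 = M 29 → N 12 = M 12 →
      (∀ i < m, ∀ k, e.eval A N 13 (Function.update (Function.update (Function.update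
        (Function.update v 9 0) 10 0) 11 i) 12 k) = s i) →
      (Expr.sum 0 (.wt 12 e)).eval A N 11 (Function.update (Function.update v 9 0) 10 0) =
        ∑ i ∈ Finset.range m, weight Q (rowBound n) (scaleOf n Q m k₀) (s i) := by
    intro N e s h29 h12 hs
    have hv' : BaseVars m n Q (Function.update (Function.update v 9 0) 10 0) :=
      (hv.update (by norm_num) _).update (by norm_num) _
    rw [Expr.eval, hv'.v0]
    refine Finset.sum_congr rfl fun i hi => ?_
    rw [Expr.eval_wt A N (hv'.update (l := 11) (by norm_num) i) 12 (by norm_num) e (s i)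
      (hs i (Finset.mem_range.1 hi)), h29, h12, hM.c29, hP.scale]
  have h4' := h4 0 (by simp [hv.v3]) 0 (by simp [hv.v3])
  have h5' := h5 0 (by simp [hv.v3]) 0 (by simp [hv.v3])
  simp only [Expr.eval, Expr.eval_idx, Expr.eval_abs, BinOp.eval, Function.update_apply, hv.v0,
    hv.v1, hv.v2, hv.v3, hv.v5, Nat.reduceAdd, Nat.reduceEqDiff, reduceIte, Nat.lt_one_iff,
    forall_eq] at h1 h2 h3 h6 h7
  rw [o6 8 (by decide), o5 8 (by decide), o4 8 (by decide), o3 8 (by decide), o2 8 (by decide),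
    o1 8 (by decide), h8, o6 2 (by decide), o5 2 (by decide), o4 2 (by decide), o3 2 (by decide),
    o2 2 (by decide), o1 2 (by decide), o6 21 (by decide), o5 21 (by decide), o4 21 (by decide),
    o3 21 (by decide)] at h7
  -- With so few living coordinates the program leaves the position unchanged, and array 20 may then
  -- contain anything.
  by_cases hk : (aliveSet n (M 2 0)).card < 16
  · refine (h.idle hk).congr (fun j hj => ?_) fun _ _ => rfl
    rw [h7 j hj, if_pos (by exact_mod_cast hk)]
  have hk' : ¬ (((aliveSet n (M 2 0)).card : ℕ) : ℤ) < 16 := by exact_mod_cast hk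
  simp only [hk', reduceIte] at h7
  rw [not_lt] at hk
  obtain ⟨hg, hsupp⟩ := hgood hk
  set Z := ∑ j ∈ Finset.range n, |M 20 0 j| with hZ
  have hZ0 : 0 < Z := hg.sum_abs_pos
  have hL0 : 0 ≤ stepLen n := by rw [stepLen]; positivity
  have hs : ∀ i < m, M 14 i 0 = rowSum n b (M 2 0 - x₀) i := hP.row
  have hd : ∀ i < m, M3 22 i 0 = rowSum n b (M2 21 0) i := by
    intro i hi
    rw [h3 i hi, o2 4 (by decide), o1 4 (by decide), hM.c4, rowSum]
  have e4 : M4 31 0 0 = ∑ i ∈ Finset.range m, weight Q (rowBound n) (scaleOf n Q m k₀)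
      (rowSum n b (M 2 0 - x₀) i + rowSum n b (M2 21 0) i) := by
    rw [h4']
    refine hwt M3 _ _ ?_ ?_ fun i hi k => ?_
    · rw [o3 29 (by decide), o2 29 (by decide), o1 29 (by decide)]
    · rw [o3 12 (by decide), o2 12 (by decide), o1 12 (by decide)]
    · simp [Expr.eval, BinOp.eval, hv.v2, hd i hi, o3 14, o2 14, o1 14, hs i hi]
  have e5 : M5 32 0 0 = ∑ i ∈ Finset.range m, weight Q (rowBound n) (scaleOf n Q m k₀)
      (rowSum n b (M 2 0 - x₀) i - rowSum n b (M2 21 0) i) := by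
    rw [h5']
    refine hwt M4 _ _ ?_ ?_ fun i hi k => ?_
    · rw [o4 29 (by decide), o3 29 (by decide), o2 29 (by decide), o1 29 (by decide)]
    · rw [o4 12 (by decide), o3 12 (by decide), o2 12 (by decide), o1 12 (by decide)]
    · simp [Expr.eval, BinOp.eval, hv.v2, o4 22, hd i hi, o4 14, o3 14, o2 14, o1 14, hs i hi]
  rw [o5 31 (by decide), e4, e5] at h6
  refine h.step P hk hg hsupp (y := M2 21 0) (fun j hj => ?_) (σ := M6 23 0 0) ?_ ?_ h7
  · refine count_sub_eq_floor hZ0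
      (Finset.single_le_sum (f := fun j => |M 20 0 j|) (fun _ _ => abs_nonneg _)
        (Finset.mem_range.2 hj)) hL0 (Q := Q) ?_ ?_
    · have := P.pow_le (a := 64) (e := 4) (c := 1) (by norm_num) (by norm_num) (by omega)
      zify at this
      rw [stepLen]
      linarith
    · rw [h2 j hj, o1 27 (by decide), o1 20 (by decide), h1, hM.c27]
  · rw [h6]; split_ifs <;> simp
  · rw [h6]
    split_ifs with hlt
    · simpa only [neg_one_mul, sub_neg_eq_add, ← sub_eq_add_neg] using hlt.le
    · simpa only [one_mul] using not_lt.1 hlt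

/-- The invariant of the main loop. -/
def LoopInv (n m Q : ℕ) (b : ℕ → ℕ → ℤ) (t : ℕ) (M : Mem) : Prop :=
  ConstMem n m Q b M ∧ ∃ k₀ : ℕ, M 7 0 0 = k₀ ∧ WalkInv n m Q b t (M 2 0) (M 3 0) k₀

theorem stepCom_spec (P : Params n m Q b) (hv : BaseVars m n Q v) (h : LoopInv n m Q b t M) :
    LoopInv n m Q b (t + 1) (stepCom.exec A 9 v M) := by
  obtain ⟨hM, k, hk, hw⟩ := h
  obtain ⟨k₀, hk₀⟩ : ∃ k₀, k₀ = if 2 * (aliveSet n (M 2 0)).card ≤ k then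
    (aliveSet n (M 2 0)).card else k := ⟨_, rfl⟩
  simp only [stepCom, Com.exec]
  have s1 := phaseCom_spec (A := A) hv hM hk
  have hM1 : ConstMem n m Q b (phaseCom.exec A 9 v M) := hM.of_eq fun a ha =>
    Com.exec_of_not_mem_writes A _ (by fin_cases ha <;> decide) 9 v M
  have e1 : phaseCom.exec A 9 v M 2 = M 2 := Com.exec_of_not_mem_writes A _ (by decide) 9 v M
  generalize phaseCom.exec A 9 v M = M1 at *
  have hw1 : WalkInv n m Q b t (M1 2 0) (M1 3 0) k₀ := by
    rw [e1, hk₀]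
    split_ifs with hc
    · exact (hw.restart P hc).congr (fun _ _ => rfl) fun j hj => by rw [s1.start j hj, if_pos hc]
    · exact hw.congr (fun _ _ => rfl) fun j hj => by rw [s1.start j hj, if_neg hc]
  have hk1 : M1 7 0 0 = k₀ := by rw [s1.size, hk₀]
  -- Either a restart made k₀ equal to the positive number of living coordinates, or the restart
  -- test failed.
  have h16 : 16 ≤ (aliveSet n (M1 2 0)).card → k₀ < 2 * (aliveSet n (M1 2 0)).card := by
    rw [e1, hk₀]
    split_ifs <;> omega
  have s8 := s1.card
  have s24 := s1.alive
  rw [← e1] at s8 s24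
  clear s1 hw hM hk
  have s2 := potentialCom_spec (A := A) hv hM1 hk1
  have hM2 : ConstMem n m Q b (potentialCom.exec A 9 v M1) := hM1.of_eq fun a ha =>
    Com.exec_of_not_mem_writes A _ (by fin_cases ha <;> decide) 9 v M1
  have o2 : ∀ a ∈ [2, 3, 7, 8, 24], potentialCom.exec A 9 v M1 a = M1 a := fun a ha =>
    Com.exec_of_not_mem_writes A _ (by fin_cases ha <;> decide) 9 v M1
  generalize potentialCom.exec A 9 v M1 = M2 at *
  rw [← o2 2 (by decide)] at s2 hw1 h16 s8 s24
  rw [← o2 3 (by decide)] at s2 hw1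
  rw [← o2 7 (by decide)] at hk1
  rw [← o2 8 (by decide)] at s8
  rw [← o2 24 (by decide)] at s24
  have s3 := formCom_spec (A := A) hv hM2 s24 s2
  have hM3 : ConstMem n m Q b (formCom.exec A 9 v M2) := hM2.of_eq fun a ha =>
    Com.exec_of_not_mem_writes A _ (by fin_cases ha <;> decide) 9 v M2
  have o3 : ∀ a ∈ [2, 3, 7, 8, 24, 12, 13, 14, 15, 16], formCom.exec A 9 v M2 a = M2 a :=
    fun a ha => Com.exec_of_not_mem_writes A _ (by fin_cases ha <;> decide) 9 v M2
  generalize formCom.exec A 9 v M2 = M3 at *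
  have hS : SearchMem n m Q b (M2 2 0) (M2 3 0) k₀ M3 :=
    ⟨s3, by rw [o3 24 (by decide)]; exact s24, by rw [o3 16 (by decide)]; exact s2.sum,
      hM3.c5, hM3.c25⟩
  have s4 := searchCom_spec (A := A) hv hS
  have hM4 : ConstMem n m Q b (searchCom.exec A 9 v M3) := hM3.of_eq fun a ha =>
    Com.exec_of_not_mem_writes A _ (by fin_cases ha <;> decide) 9 v M3
  have o4 : ∀ a ∈ [2, 3, 7, 8, 24, 12, 13, 14, 15, 16], searchCom.exec A 9 v M3 a = M2 a :=
    fun a ha => (Com.exec_of_not_mem_writes A _ (by fin_cases ha <;> decide) 9 v M3).trans (o3 a ha)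
  generalize searchCom.exec A 9 v M3 = M4 at *
  have s2' : PotentialSpec n m Q b (M4 2 0) (M2 3 0) k₀ M4 := by
    constructor
    · rw [o4 12 (by decide)]; exact s2.scale
    · rw [o4 13 (by decide)]; exact s2.threshold
    · rw [o4 14 (by decide), o4 2 (by decide)]; exact s2.row
    · rw [o4 15 (by decide), o4 2 (by decide)]; exact s2.weight
    · rw [o4 16 (by decide), o4 2 (by decide)]; exact s2.sum
  have s5 := moveCom_spec (A := A) P hv hM4 s2'
    (by rw [o4 8 (by decide), o4 2 (by decide)]; exact s8)
    (by rw [o4 2 (by decide)]; exact hw1)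
    (by
      rw [o4 2 (by decide)]
      exact fun hk => s4 (hw1.exists_goodDirection P hk (h16 hk)))
  have hM5 : ConstMem n m Q b (moveCom.exec A 9 v M4) := hM4.of_eq fun a ha =>
    Com.exec_of_not_mem_writes A _ (by fin_cases ha <;> decide) 9 v M4
  have o5 : ∀ a ∈ [3, 7], moveCom.exec A 9 v M4 a = M2 a := fun a ha =>
    (Com.exec_of_not_mem_writes A _ (by fin_cases ha <;> decide) 9 v M4).trans
      (o4 a (by fin_cases ha <;> decide))
  refine ⟨hM5, k₀, ?_, ?_⟩
  · rw [o5 7 (by decide), hk1]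
  · rw [o5 3 (by decide)]; exact s5

end
end RealRAM

/-- Replacing x by D times its signs changes a frozen coordinate by at most L and each of the at
most 15 living ones by at most D. A row changes by at most n(nL + 15D) ≤ 16nD; division by D gives
the claim. -/
theorem WalkInv.sign_row_le {n m Q t : ℕ} {b : ℕ → ℕ → ℤ} {x x₀ y : ℕ → ℤ} {k₀ : ℕ}
    (P : Params n m Q b) (h : WalkInv n m Q b t x x₀ k₀) (hk : (aliveSet n x).card < 16)
    (hy : ∀ j < n, y j = if x j < 0 then -1 else 1) {i : ℕ} (hi : i < m) :
    |(rowSum n b y i : ℝ)| ≤ n * (2592 * phaseBound m n + 16) := by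
  have hL0 : 0 ≤ stepLen n := by rw [stepLen]; positivity
  have h1 : ∀ j ∈ Finset.range n, |b i j * (boxSize n * y j - x j)| ≤
      n * (stepLen n + if j ∈ aliveSet n x then boxSize n else 0) := by
    intro j hj
    have hj' := Finset.mem_range.1 hj
    rw [abs_mul]
    refine mul_le_mul (P.hb i hi j hj') ?_ (abs_nonneg _) (Nat.cast_nonneg n)
    have hbox := h.box j hj'
    have e1 : |boxSize n * y j - x j| = boxSize n - |x j| := by
      rw [hy j hj']
      split_ifs with h0
      · rw [abs_of_neg h0] at hbox ⊢
        rw [abs_of_nonpos (by linarith)]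
        ring
      · rw [abs_of_nonneg (not_lt.1 h0)] at hbox ⊢
        rw [abs_of_nonneg (by linarith)]
        ring
    rw [e1]
    split_ifs with ha
    · linarith [abs_nonneg (x j)]
    · simp only [aliveSet, Finset.mem_filter, hj, true_and, not_lt] at ha
      linarith
  have h2 : |rowSum n b (fun j => boxSize n * y j - x j) i| ≤ n * (n * stepLen n + 15 * boxSize n) := by
    refine (Finset.abs_sum_le_sum_abs _ _).trans ((Finset.sum_le_sum h1).trans ?_)
    rw [← Finset.mul_sum, Finset.sum_add_distrib, Finset.sum_const, Finset.card_range,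
      ← Finset.sum_filter, Finset.sum_const, nsmul_eq_mul, nsmul_eq_mul]
    have h3 : ((Finset.range n).filter fun j => j ∈ aliveSet n x).card ≤ 15 := by
      refine le_trans (Finset.card_le_card fun j hj => (Finset.mem_filter.1 hj).2)
        (Nat.lt_succ_iff.1 hk)
    have h4 : ((((Finset.range n).filter fun j => j ∈ aliveSet n x).card : ℕ) : ℤ) ≤ 15 := by
      exact_mod_cast h3
    have h5 : 0 ≤ boxSize n := by rw [boxSize]; positivity
    gcongr
  have h3 : rowSum n b (fun j => boxSize n * y j - x j) i =
      boxSize n * rowSum n b y i - rowSum n b x i := by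
    rw [rowSum, rowSum, rowSum, Finset.mul_sum, ← Finset.sum_sub_distrib]
    exact Finset.sum_congr rfl fun j _ => by ring
  rw [h3] at h2
  have h4 : |(boxSize n * rowSum n b y i - rowSum n b x i : ℝ)| ≤
      n * (n * stepLen n + 15 * boxSize n) := by exact_mod_cast h2
  have h5 := h.final_row_le P hi
  have hn1 := P.hn1
  have h6 : (64 * n ^ 5 : ℝ) * |(rowSum n b y i : ℝ)| ≤
      64 * n ^ 5 * (n * (2592 * phaseBound m n + 16)) := by
    have e : (64 * n ^ 5 : ℝ) * |(rowSum n b y i : ℝ)| = |(boxSize n * rowSum n b y i : ℝ)| := by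
      rw [abs_mul, boxSize]
      push_cast
      rw [abs_of_nonneg (show (0 : ℝ) ≤ 64 * n ^ 5 by positivity)]
    rw [e]
    calc |(boxSize n * rowSum n b y i : ℝ)|
        = |(boxSize n * rowSum n b y i - rowSum n b x i) + (rowSum n b x i : ℝ)| := by
          rw [sub_add_cancel]
      _ ≤ n * (n * stepLen n + 15 * boxSize n) + 64 * n ^ 6 * (2592 * phaseBound m n) :=
          (abs_add_le _ _).trans (add_le_add h4 h5)
      _ ≤ _ := by
          rw [stepLen, boxSize]
          push_cast
          have : (0 : ℝ) ≤ n ^ 6 := by positivity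
          nlinarith
  exact le_of_mul_le_mul_left h6 (by positivity)

/-! ### Rounding of the input and correctness of the integer program -/

namespace RealRAM

section

variable {n m Q : ℕ} {A : ℕ → ℕ → ℝ} {v : ℕ → ℕ}

/-- B is the ceiling of na: the count stops at the first t with t - n ≥ na. Only comparisons of a
with rationals are used. -/
theorem round_entry {n Q : ℕ} (hn : 0 < n) (hQ : 2 * n ≤ Q) {a : ℝ} (ha : a ∈ Set.Icc (-1 : ℝ) 1)
    {B : ℤ} (hB : B = (∑ t ∈ Finset.range Q,
      if ((((t : ℤ) - n : ℤ) : ℝ) / ((n : ℤ) : ℝ) < a) then 1 else 0) - n) :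
    |B| ≤ n ∧ |(B : ℝ) - n * a| ≤ 1 := by
  have hn' : (0 : ℝ) < n := by exact_mod_cast hn
  have hp : ∀ t : ℕ, ((((t : ℤ) - n : ℤ) : ℝ) / ((n : ℤ) : ℝ) < a) ↔ (t : ℝ) - n < n * a := by
    intro t
    push_cast
    rw [div_lt_iff₀ hn', mul_comm]
  simp only [hp] at hB
  obtain ⟨c, hc, -, h3, h4⟩ := count_eq_first (Q := Q) (fun t => (t : ℝ) - n < n * a)
    (fun s t hst h => by
      have : (s : ℝ) ≤ t := by exact_mod_cast hst
      linarith)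
    (by
      have : (2 * n : ℝ) ≤ Q := by exact_mod_cast hQ
      have := mul_le_mul_of_nonneg_left ha.2 hn'.le
      linarith)
  rw [hc] at hB
  have hlo := mul_le_mul_of_nonneg_left ha.1 hn'.le
  have hhi := mul_le_mul_of_nonneg_left ha.2 hn'.le
  have hBR : (B : ℝ) = c - n := by rw [hB]; push_cast; ring
  rw [not_lt] at h3
  have h5 : (B : ℝ) < n * a + 1 := by
    rcases Nat.eq_zero_or_pos c with rfl | h0
    · rw [hBR]; push_cast; linarith
    · have := h4 (c - 1) (by omega)
      rw [Nat.cast_sub h0] at this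
      push_cast at this
      linarith
  refine ⟨abs_le.2 ⟨?_, ?_⟩, abs_le.2 ⟨by linarith, by linarith⟩⟩
  · have : (-n : ℝ) ≤ B := by linarith
    exact_mod_cast this
  · have : (B : ℝ) < n + 1 := by linarith
    have : B < n + 1 := by exact_mod_cast this
    omega

theorem initCom_spec (hn : 0 < n) (hQ : 2 * n ≤ Q) (hv : BaseVars m n Q v)
    (hA : ∀ i < m, ∀ j < n, A i j ∈ Set.Icc (-1 : ℝ) 1) :
    ∃ b : ℕ → ℕ → ℤ, (∀ i < m, ∀ j < n, |b i j| ≤ n ∧ |(b i j : ℝ) - n * A i j| ≤ 1) ∧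
      LoopInv n m Q b 0 (initCom.exec A 8 v 0) := by
  have o2 : initCom.exec A 8 v 0 2 = 0 := Com.exec_of_not_mem_writes A _ (by decide) 8 v 0
  have o3 : initCom.exec A 8 v 0 3 = 0 := Com.exec_of_not_mem_writes A _ (by decide) 8 v 0
  refine ⟨initCom.exec A 8 v 0 4, ?_⟩
  suffices h : (∀ i < m, ∀ j < n, |initCom.exec A 8 v 0 4 i j| ≤ n ∧
      |(initCom.exec A 8 v 0 4 i j : ℝ) - n * A i j| ≤ 1) ∧
      ConstMem n m Q (initCom.exec A 8 v 0 4) (initCom.exec A 8 v 0) ∧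
      initCom.exec A 8 v 0 7 0 0 = n by
    refine ⟨h.1, h.2.1, n, h.2.2, ?_⟩
    rw [o2, o3]
    exact WalkInv.init
  clear o2 o3
  set R : Mem → Prop := fun M => (∀ i < m, ∀ j < n, |M 4 i j| ≤ n ∧
      |(M 4 i j : ℝ) - n * A i j| ≤ 1) ∧ ConstMem n m Q (M 4) M ∧ M 7 0 0 = n
  change R (initCom.exec A 8 v 0)
  unfold initCom
  refine Com.exec_seq_assign_elim (P := R) fun M1 o1 h1 => ?_
  refine Com.exec_seq_assign_elim (P := R) fun M2 o2 h2 => ?_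
  refine Com.exec_seq_assign_elim (P := R) fun M3 o3 h3 => ?_
  refine Com.exec_seq_assign_elim (P := R) fun M4 o4 h4 => ?_
  refine Com.exec_seq_assign_elim (P := R) fun M5 o5 h5 => ?_
  refine Com.exec_seq_assign_elim (P := R) fun M6 o6 h6 => ?_
  refine Com.exec_seq_assign_elim (P := R) fun M7 o7 h7 => ?_
  refine Com.exec_assign_elim (P := R) fun M8 o8 h8 => ?_
  simp only [Expr.eval, Expr.eval_idx, BinOp.eval, Function.update_apply, hv.v0,
    hv.v1, hv.v2, hv.v3, hv.v5, Nat.reduceAdd, Nat.reduceEqDiff, reduceIte, Nat.lt_one_iff,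
    forall_eq] at h1 h2 h3 h4 h5 h6 h7 h8
  rw [o3 5 (by decide), o2 5 (by decide), h1] at h4
  rw [o4 5 (by decide), o3 5 (by decide), o2 5 (by decide), h1, h4] at h5
  rw [o5 5 (by decide), o4 5 (by decide), o3 5 (by decide), o2 5 (by decide), h1, h5] at h6
  rw [o6 5 (by decide), o5 5 (by decide), o4 5 (by decide), o3 5 (by decide), o2 5 (by decide),
    h1] at h7
  have e5 : M7 5 0 0 = n := by
    rw [o7 5 (by decide), o6 5 (by decide), o5 5 (by decide), o4 5 (by decide), o3 5 (by decide),
      o2 5 (by decide), h1]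
  refine ⟨fun i hi j hj => round_entry hn hQ (hA i hi j hj) ?_, ⟨?_, ?_, ?_, ?_, ?_, ?_, rfl⟩, ?_⟩
  · rw [o8 4 (by decide), h7 i hi j hj]
  · rw [o8 5 (by decide), e5]
  · rw [o8 6 (by decide), o7 6 (by decide), o6 6 (by decide), o5 6 (by decide), o4 6 (by decide),
      o3 6 (by decide), h2]
  · rw [o8 25 (by decide), o7 25 (by decide), o6 25 (by decide), o5 25 (by decide),
      o4 25 (by decide), h3]
  · rw [o8 27 (by decide), o7 27 (by decide), o6 27 (by decide), o5 27 (by decide), h4, stepLen]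
    ring
  · rw [o8 28 (by decide), o7 28 (by decide), o6 28 (by decide), h5, boxSize]
    ring
  · rw [o8 29 (by decide), o7 29 (by decide), h6, rowBound, boxSize]
    ring
  · rw [h8, e5]

theorem mainCom_spec (hn : 0 < n) (hnm : n ≤ m) (hQ : 3 * 2 ^ 22 * (m + 1) * n ^ 19 ≤ Q)
    (hv : BaseVars m n Q v) (hA : ∀ i < m, ∀ j < n, A i j ∈ Set.Icc (-1 : ℝ) 1) :
    (∀ j < n, mainCom.exec A 8 v 0 1 0 j = 1 ∨ mainCom.exec A 8 v 0 1 0 j = -1) ∧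
      ∀ i < m, |∑ j ∈ Finset.range n, A i j * mainCom.exec A 8 v 0 1 0 j| ≤
        2592 * phaseBound m n + 17 := by
  have hQ2 : 2 * n ≤ Q := by
    refine le_trans ?_ hQ
    have : n ≤ n ^ 19 := Nat.le_self_pow (by norm_num) n
    nlinarith
  obtain ⟨b, hb, h0⟩ := initCom_spec hn hQ2 hv hA
  have P : Params n m Q b := ⟨hn, hnm, hQ, fun i hi j hj => (hb i hi j hj).1⟩
  have hn' : (0 : ℝ) < n := by exact_mod_cast hn
  set R : Mem → Prop := fun M => (∀ j < n, M 1 0 j = 1 ∨ M 1 0 j = -1) ∧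
      ∀ i < m, |∑ j ∈ Finset.range n, A i j * M 1 0 j| ≤ 2592 * phaseBound m n + 17
  change R (mainCom.exec A 8 v 0)
  rw [mainCom, Com.exec]
  refine Com.exec_seq_rep_elim (P := R) (LoopInv n m Q b) h0
    (fun i _ M' hM' => stepCom_spec P (hv.update le_rfl i) hM') fun M1 h1 => ?_
  rw [hv.v5] at h1
  obtain ⟨-, k₀, -, hw⟩ := h1
  refine Com.exec_assign_elim (P := R) fun M2 o2 h2 => ?_
  simp only [Expr.eval, Function.update_apply, hv.v1, hv.v2, hv.v3, Nat.reduceAdd,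
    Nat.reduceEqDiff, reduceIte, Nat.lt_one_iff, forall_eq] at h2
  have hpm : ∀ j < n, M2 1 0 j = 1 ∨ M2 1 0 j = -1 := fun j hj => by
    rw [h2 j hj]
    split_ifs <;> simp
  refine ⟨hpm, fun i hi => ?_⟩
  have h3 := hw.sign_row_le P (hw.finished P) h2 hi
  -- Rounding the matrix costs at most 1 per entry of nA, hence 1 after division by n; this turns 16
  -- into 17.
  have h4 : |n * (∑ j ∈ Finset.range n, A i j * M2 1 0 j) - (rowSum n b (M2 1 0) i : ℝ)| ≤ n := by
    rw [rowSum, Finset.mul_sum]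
    push_cast
    rw [← Finset.sum_sub_distrib]
    refine (Finset.abs_sum_le_sum_abs _ _).trans ((Finset.sum_le_card_nsmul _ _ 1 fun j hj => ?_).trans
      (by simp))
    have hj' := Finset.mem_range.1 hj
    rw [← mul_assoc, ← sub_mul, abs_mul, abs_sub_comm]
    have : |((M2 1 0 j : ℤ) : ℝ)| = 1 := by
      rcases hpm j hj' with h | h <;> rw [h] <;> simp
    rw [this, mul_one]
    exact (hb i hi j hj').2
  have h5 : n * |∑ j ∈ Finset.range n, A i j * M2 1 0 j| ≤ n * (2592 * phaseBound m n + 17) := by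
    rw [← abs_of_pos hn', ← abs_mul, abs_of_pos hn']
    have := abs_sub_abs_le_abs_sub (n * (∑ j ∈ Finset.range n, A i j * M2 1 0 j))
      (rowSum n b (M2 1 0) i : ℝ)
    linarith
  exact le_of_mul_le_mul_left h5 hn'

end
end RealRAM

/-! ### Polynomial bounds for the sizes of numbers -/

namespace RealRAM

/-- A function that is bounded by a polynomial. -/
def PolyBounded (f : ℕ → ℕ) : Prop := ∃ p : Polynomial ℕ, ∀ Q, f Q ≤ p.eval Q

theorem PolyBounded.mono {f g : ℕ → ℕ} (hg : PolyBounded g) (h : ∀ Q, f Q ≤ g Q) :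
    PolyBounded f :=
  hg.imp fun _ hp Q => (h Q).trans (hp Q)

theorem PolyBounded.const (c : ℕ) : PolyBounded fun _ => c := ⟨Polynomial.C c, by simp⟩

theorem PolyBounded.id : PolyBounded fun Q => Q := ⟨Polynomial.X, by simp⟩

theorem PolyBounded.add {f g : ℕ → ℕ} (hf : PolyBounded f) (hg : PolyBounded g) :
    PolyBounded fun Q => f Q + g Q := by
  obtain ⟨p, hp⟩ := hf
  obtain ⟨q, hq⟩ := hg
  exact ⟨p + q, fun Q => by rw [Polynomial.eval_add]; exact add_le_add (hp Q) (hq Q)⟩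

theorem PolyBounded.mul {f g : ℕ → ℕ} (hf : PolyBounded f) (hg : PolyBounded g) :
    PolyBounded fun Q => f Q * g Q := by
  obtain ⟨p, hp⟩ := hf
  obtain ⟨q, hq⟩ := hg
  exact ⟨p * q, fun Q => by rw [Polynomial.eval_mul]; exact Nat.mul_le_mul (hp Q) (hq Q)⟩

theorem PolyBounded.max {f g : ℕ → ℕ} (hf : PolyBounded f) (hg : PolyBounded g) :
    PolyBounded fun Q => Max.max (f Q) (g Q) :=
  (hf.add hg).mono fun Q => by omega

theorem PolyBounded.valueBits {Γ : ℕ → ℕ → ℕ} (hΓ : ∀ a, PolyBounded fun Q => Γ Q a) (e : Expr) :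
    PolyBounded fun Q => e.valueBits (Γ Q) Q := by
  induction e with
  | const k => exact .const _
  | cell a i j => exact hΓ a
  | bin o e f he hf =>
    cases o
    · exact (he.max hf).add (.const 1)
    · exact (he.max hf).add (.const 1)
    · exact he.add hf
  | ite e f g h _ _ hg hh => exact hg.max hh
  | iteInput e f i j g h _ _ hg hh => exact hg.max hh
  | sum b e he => exact PolyBounded.id.add he
  | prod b e he => exact (PolyBounded.id.mul he).add (.const 1)

theorem PolyBounded.exprMaxBits {Γ : ℕ → ℕ → ℕ} (hΓ : ∀ a, PolyBounded fun Q => Γ Q a) (e : Expr) :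
    PolyBounded fun Q => e.maxBits (Γ Q) Q := by
  induction e with
  | const k => exact .const _
  | cell a i j => exact hΓ a
  | bin o e f he hf => exact (he.add hf).add (.valueBits hΓ _)
  | ite e f g h he hf hg hh => exact ((he.add hf).add hg).add hh
  | iteInput e f i j g h he hf hg hh => exact ((he.add hf).add hg).add hh
  | sum b e he => exact he.add (PolyBounded.id.add (.valueBits hΓ e))
  | prod b e he => exact he.add ((PolyBounded.id.mul (.valueBits hΓ e)).add (.const 1))

theorem PolyBounded.maxBits {Γ : ℕ → ℕ → ℕ} (hΓ : ∀ a, PolyBounded fun Q => Γ Q a) (c : Com) :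
    PolyBounded fun Q => c.maxBits (Γ Q) Q := by
  induction c with
  | assign a p q e => exact .exprMaxBits hΓ e
  | seq c d hc hd => exact hc.add hd
  | rep b c hc => exact hc

/-- All values assigned by the program respect the bounds for the arrays. -/
def Com.Fits (Q : ℕ) (γ : ℕ → ℕ) : Com → Prop
  | .assign a _ _ e => e.valueBits γ Q ≤ γ a
  | .seq c d => c.Fits Q γ ∧ d.Fits Q γ
  | .rep _ c => c.Fits Q γ

theorem Com.Fits.grows {Q : ℕ} {γ Γ : ℕ → ℕ} (hΓ : γ ≤ Γ) :
    ∀ {c : Com}, c.Fits Q γ → c.Grows Q Γ γ γ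
  | .assign _ _ _ _, h => .assign le_rfl h hΓ
  | .seq _ _, h => .seq (grows hΓ h.1) (grows hΓ h.2)
  | .rep _ _, h => .rep (fun _ => γ) (fun _ _ => grows hΓ h) fun _ _ => le_rfl

/-- The growth of the power iterates in one step. -/
def iterBits (Q : ℕ) : ℕ := 7 * Q ^ 2 + 38 * Q + 51

/-- Coefficients of quadratic bounds for the sizes of the entries of the arrays. -/
def arrayBits : ℕ → ℕ × ℕ × ℕ
  | 1 => (1, 0, 0)
  | 4 => (2, 1, 0)
  | 5 => (1, 1, 0)
  | 6 => (1, 1, 0)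
  | 7 => (1, 1, 0)
  | 8 => (1, 1, 0)
  | 9 => (1, 0, 0)
  | 10 => (2, 1, 0)
  | 11 => (2, 1, 0)
  | 12 => (16, 7, 0)
  | 13 => (25, 8, 0)
  | 14 => (15, 7, 0)
  | 15 => (2, 17, 7)
  | 16 => (2, 18, 7)
  | 17 => (13, 5, 0)
  | 18 => (24, 26, 7)
  | 21 => (11, 4, 0)
  | 22 => (13, 6, 0)
  | 23 => (1, 0, 0)
  | 24 => (1, 0, 0)
  | 25 => (1, 1, 0)
  | 26 => (1, 0, 0)
  | 27 => (10, 4, 0)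
  | 28 => (13, 5, 0)
  | 29 => (17, 7, 0)
  | 31 => (2, 18, 7)
  | 32 => (2, 18, 7)
  | _ => (0, 0, 0)

/-- Bounds for the sizes of the entries of the arrays after `T` moves and `S` power iterations. -/
def bitBound (Q T S a : ℕ) : ℕ :=
  if a = 2 ∨ a = 3 then 4 * Q + 12 + T
  else if a = 19 then 1 + S * iterBits Q
  else if a = 20 then 1 + Q ^ 3 * iterBits Q
  else if a = 30 then 2 + Q + Q ^ 3 * iterBits Q
  else (arrayBits a).1 + (arrayBits a).2.1 * Q + (arrayBits a).2.2 * Q ^ 2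

theorem bitBound_mono {Q T T' S S' : ℕ} (hT : T ≤ T') (hS : S ≤ S') :
    bitBound Q T S ≤ bitBound Q T' S' := by
  intro a
  have := Nat.mul_le_mul_right (iterBits Q) hS
  simp only [bitBound]
  split_ifs <;> omega

theorem polyBounded_bitBound (a : ℕ) : PolyBounded fun Q => bitBound Q Q (Q ^ 3) a := by
  have h2 : PolyBounded fun Q => Q ^ 2 := by simpa only [sq] using PolyBounded.id.mul .id
  have h3 : PolyBounded fun Q => Q ^ 3 := by simpa only [pow_succ] using h2.mul .id
  have hi : PolyBounded fun Q => Q ^ 3 * iterBits Q :=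
    h3.mul (((PolyBounded.const 7).mul h2).add ((PolyBounded.const 38).mul .id) |>.add (.const 51))
  unfold bitBound
  split_ifs
  · exact (((PolyBounded.const 4).mul .id).add (.const 12)).add .id
  · exact (PolyBounded.const 1).add hi
  · exact (PolyBounded.const 1).add hi
  · exact ((PolyBounded.const 2).add .id).add hi
  · exact ((PolyBounded.const _).add ((PolyBounded.const _).mul .id)).add
      ((PolyBounded.const _).mul h2)

section

variable {Q T S : ℕ}

theorem Expr.valueBits_wt (γ : ℕ → ℕ) (l : ℕ) (s : Expr) (h : 1 ≤ γ 12) :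
    (Expr.wt l s).valueBits γ Q = Q * (γ 12 + 1) + 2 := by
  have h1 : max (max (γ 12) 1 + 1) (γ 12) = γ 12 + 1 := by omega
  simp [Expr.wt, Expr.valueBits, h1]

theorem initCom_fits : initCom.Fits Q (bitBound Q T S) := by
  have h32 : Nat.size 32 = 6 := by decide
  have h2 : Nat.size 2 = 2 := by decide
  simp [initCom, Com.Fits, Expr.valueBits, Expr.idx, bitBound, arrayBits, h32, h2]
  omega

theorem phaseCom_fits : phaseCom.Fits Q (bitBound Q T S) := by
  simp [phaseCom, Com.Fits, Expr.valueBits, bitBound, arrayBits]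

theorem potentialCom_fits (hT : T ≤ Q) : potentialCom.Fits Q (bitBound Q T S) := by
  have h80 : Nat.size 80 = 7 := by decide
  have e12 : bitBound Q T S 12 = 16 + 7 * Q := by simp [bitBound, arrayBits]
  have e : Q * (16 + 7 * Q + 1) = 17 * Q + 7 * Q ^ 2 := by ring
  simp only [potentialCom, Com.Fits, Expr.valueBits_wt (bitBound Q T S) _ _ (by rw [e12]; omega)]
  rw [e12, e]
  simp [Expr.valueBits, bitBound, arrayBits, h80]
  omega

theorem formCom_fits (hT : T ≤ Q) : formCom.Fits Q (bitBound Q T S) := by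
  have h3 : Nat.size 3 = 2 := by decide
  simp [formCom, Com.Fits, Expr.heavy, Expr.valueBits, bitBound, arrayBits, h3]
  omega

theorem moveCom_grows (hT : T < Q) (hS : S ≤ Q ^ 3) : moveCom.Grows Q (bitBound Q Q (Q ^ 3))
    (bitBound Q T S) (bitBound Q (T + 1) S) := by
  have h16 : Nat.size 16 = 5 := by decide
  have e12 : bitBound Q T S 12 = 16 + 7 * Q := by simp [bitBound, arrayBits]
  have e : Q * (16 + 7 * Q + 1) = 17 * Q + 7 * Q ^ 2 := by ring
  have hw : ∀ l s, (Expr.wt l s).valueBits (bitBound Q T S) Q = 17 * Q + 7 * Q ^ 2 + 2 :=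
    fun l s => by rw [Expr.valueBits_wt _ _ _ (by rw [e12]; omega), e12, e]
  have hΓ : bitBound Q T S ≤ bitBound Q Q (Q ^ 3) := bitBound_mono hT.le hS
  unfold moveCom
  refine .seq (.assign le_rfl ?_ hΓ) <| .seq (.assign le_rfl ?_ hΓ) <|
    .seq (.assign le_rfl ?_ hΓ) <| .seq (.assign le_rfl ?_ hΓ) <| .seq (.assign le_rfl ?_ hΓ) <|
    .seq (.assign le_rfl ?_ hΓ) <| .assign (bitBound_mono (Nat.le_succ T) le_rfl) ?_ hΓ
  · simp [Expr.valueBits, Expr.abs, bitBound]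
    omega
  · simp [Expr.valueBits, bitBound, arrayBits]
    omega
  · simp [Expr.valueBits, bitBound, arrayBits]
    omega
  · rw [Expr.valueBits, hw]
    simp [bitBound, arrayBits]
    omega
  · rw [Expr.valueBits, hw]
    simp [bitBound, arrayBits]
    omega
  · simp [Expr.valueBits, bitBound, arrayBits]
  · simp [Expr.valueBits, bitBound, arrayBits]
    omega

theorem Com.Grows.rep_of_eq {Γ γ γ' : ℕ → ℕ} {b : ℕ} {c : Com} (g : ℕ → ℕ → ℕ) (h0 : γ = g 0)
    (h : ∀ i < Q, c.Grows Q Γ (g i) (g (i + 1))) (h' : ∀ i ≤ Q, g i ≤ γ') :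
    (Com.rep b c).Grows Q Γ γ γ' :=
  h0 ▸ .rep g h h'

theorem searchCom_grows (hT : T < Q) : searchCom.Grows Q (bitBound Q Q (Q ^ 3))
    (bitBound Q T (T * Q ^ 2)) (bitBound Q T ((T + 1) * Q ^ 2)) := by
  -- Array 19 is reset at each start, but bounds in `Grows` never decrease along an assignment.
  -- Power iterations are therefore counted over the whole run: at most Q moves, Q starts and Q
  -- iterations.
  have key : ∀ k < Q, ∀ r ≤ Q, T * Q ^ 2 + k * Q + r ≤ Q ^ 3 := by
    intro k hk r hr
    have h1 : (T + 1) * Q ^ 2 ≤ Q * Q ^ 2 := Nat.mul_le_mul_right _ hT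
    have h2 : (k + 1) * Q ≤ Q * Q := Nat.mul_le_mul_right _ hk
    nlinarith
  unfold searchCom
  refine .rep_of_eq (fun k => bitBound Q T (T * Q ^ 2 + k * Q)) (by simp) (fun k hk => ?_) fun k hk =>
    bitBound_mono le_rfl ?_
  swap
  · have := Nat.mul_le_mul_right Q hk
    nlinarith
  have hΓ : ∀ r ≤ Q, bitBound Q T (T * Q ^ 2 + k * Q + r) ≤ bitBound Q Q (Q ^ 3) := fun r hr =>
    bitBound_mono hT.le (key k hk r hr)
  have hk1 : T * Q ^ 2 + (k + 1) * Q = T * Q ^ 2 + k * Q + Q := by ring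
  rw [hk1]
  refine .seq (.assign le_rfl ?_ (hΓ 0 (Nat.zero_le Q))) <| .seq
    (.rep_of_eq (γ' := bitBound Q T (T * Q ^ 2 + k * Q + Q))
      (fun r => bitBound Q T (T * Q ^ 2 + k * Q + r)) (by simp)
      (fun r hr => .assign (bitBound_mono le_rfl (by omega)) ?_ (hΓ r hr.le))
      fun r hr => bitBound_mono le_rfl (by omega)) <|
    .seq (.assign le_rfl ?_ (hΓ Q le_rfl)) (.assign le_rfl ?_ (hΓ Q le_rfl))
  · simp [Expr.valueBits, bitBound, arrayBits]
  · have e : (T * Q ^ 2 + k * Q + (r + 1)) * iterBits Q =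
        (T * Q ^ 2 + k * Q + r) * iterBits Q + (7 * Q ^ 2 + 38 * Q + 51) := by
      rw [← add_assoc, add_mul _ 1, one_mul, ← iterBits]
    simp [Expr.valueBits, bitBound, arrayBits, e]
    omega
  · simp [Expr.valueBits, bitBound, arrayBits]
  · have := Nat.mul_le_mul_right (iterBits Q) (key k hk Q le_rfl)
    refine max_le ?_ le_rfl
    simpa [Expr.valueBits, bitBound] using this

theorem mainCom_grows : mainCom.Grows Q (bitBound Q Q (Q ^ 3)) (bitBound Q 0 0)
    (bitBound Q Q (Q ^ 3)) := by
  have hΓ : ∀ {T S : ℕ}, T ≤ Q → S ≤ Q ^ 3 → bitBound Q T S ≤ bitBound Q Q (Q ^ 3) :=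
    fun hT hS => bitBound_mono hT hS
  have hS : ∀ T ≤ Q, T * Q ^ 2 ≤ Q ^ 3 := fun T hT => by
    rw [show Q ^ 3 = Q * Q ^ 2 by ring]
    exact Nat.mul_le_mul_right _ hT
  refine .seq (initCom_fits.grows (hΓ (Nat.zero_le _) (Nat.zero_le _)))
    (.seq (.rep_of_eq (fun T => bitBound Q T (T * Q ^ 2)) (by simp) (fun T hT => ?_)
      fun T hT => hΓ hT (hS T hT)) (.assign le_rfl ?_ le_rfl))
  · have h1 := hΓ hT.le (hS T hT.le)
    exact .seq (phaseCom_fits.grows h1) <| .seq ((potentialCom_fits hT.le).grows h1) <|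
      .seq ((formCom_fits hT.le).grows h1) <| .seq (searchCom_grows hT)
        (moveCom_grows hT (hS (T + 1) hT))
  · simp [Expr.valueBits, bitBound, arrayBits]

end
end RealRAM

namespace RealRAM

/-! ### The complete program -/

theorem eval_le_eval_of_le (p : Polynomial ℕ) {a b : ℕ} (h : a ≤ b) : p.eval a ≤ p.eval b := by
  rw [Polynomial.eval_eq_sum_range, Polynomial.eval_eq_sum_range]
  gcongr

/-- The counters hold the parameters, and `q` in counter `5`. -/
structure CountersAre (m n q : ℕ) (ρ : ℕ → ℕ → ℕ → ℝ) (s : State) : Prop where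
  base : BaseVars m n q s.nat
  real : s.real = ρ

/-- `N 5 := N 5 * N 5` -/
def squareProg : Prog :=
  .seq (.natAdd 7 5 2) (.seq (.natConst 5 0) (forLoop 6 7 (.natAdd 5 5 7)))

def squaresProg : ℕ → Prog
  | 0 => .skip
  | k + 1 => .seq (squaresProg k) squareProg

/-- Prepare the counters. -/
def setupProg : Prog :=
  .seq (.natConst 3 1) <| .seq (.natAdd 4 0 3) <| .seq (.natAdd 5 4 1) <| .seq (.natAdd 5 5 3) <|
    .seq (squaresProg 5) <| .seq (.natConst 6 0) (.natConst 7 0)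

section

variable {V : Set ℝ} {m n q : ℕ} {ρ : ℕ → ℕ → ℕ → ℝ} {s : State}

/-- Counters cannot be multiplied, so q is added q times. This is affordable because the resulting
loop bound is itself polynomial in m + n. -/
theorem run_squareProg (h : CountersAre m n q ρ s) :
    ∃ k s', Run V squareProg s k s' ∧ k ≤ 3 * q + 4 ∧ CountersAre m n (q * q) ρ s' := by
  obtain ⟨⟨h0, h1, h2, h3, h4, h5⟩, hr⟩ := h
  obtain ⟨k, s', hrun, hk, -, -, hI⟩ := Run.forLoop (V := V) (v := 6) (b := 7)
    (body := .natAdd 5 5 7) q 1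
    (fun i s => s.nat 7 = q ∧ CountersAre m n (i * q) ρ s)
    ((s.setNat 7 (s.nat 5 + s.nat 2)).setNat 5 0)
    ⟨by simp [State.setNat, h5, h2], ⟨by simp [State.setNat, h0], by simp [State.setNat, h1],
      by simp [State.setNat, h2], by simp [State.setNat, h3], by simp [State.setNat, h4],
      by simp [State.setNat]⟩, hr⟩
    (fun _ _ h => h.1)
    (fun i _ s ⟨g7, ⟨g0, g1, g2, g3, g4, g5⟩, gr⟩ gv => ⟨1, _, .natAdd s 5 5 7, le_rfl,
      by simp [State.setNat, gv], by simp [State.setNat, g3], by simp [State.setNat, g7],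
      ⟨by simp [State.setNat, g0], by simp [State.setNat, g1],
      by simp [State.setNat, g2], by simp [State.setNat, g3], by simp [State.setNat, g4],
      by simp [State.setNat, g5, g7, add_mul]⟩, gr⟩)
  exact ⟨_, s', .seq (.natAdd s 7 5 2) (.seq (.natConst _ 5 0) hrun), by omega, hI⟩

theorem run_squaresProg (hq : 0 < q) (h : CountersAre m n q ρ s) (k : ℕ) :
    ∃ t s', Run V (squaresProg k) s t s' ∧ t ≤ k * (3 * q ^ 2 ^ k + 4) ∧
      CountersAre m n (q ^ 2 ^ k) ρ s' := by
  induction k with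
  | zero => exact ⟨0, s, .skip s, by simp, by simpa using h⟩
  | succ k ih =>
    obtain ⟨t, s', hrun, ht, hs'⟩ := ih
    obtain ⟨t', s'', hrun', ht', hs''⟩ := run_squareProg (V := V) hs'
    have e : q ^ 2 ^ (k + 1) = q ^ 2 ^ k * q ^ 2 ^ k := by rw [pow_succ, mul_two, pow_add]
    refine ⟨_, s'', .seq hrun hrun', ?_, e ▸ hs''⟩
    have h1 : q ^ 2 ^ k ≤ q ^ 2 ^ (k + 1) :=
      Nat.pow_le_pow_right hq (Nat.pow_le_pow_right (by norm_num) (Nat.le_succ k))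
    have h2 : k * (3 * q ^ 2 ^ k + 4) ≤ k * (3 * q ^ 2 ^ (k + 1) + 4) :=
      Nat.mul_le_mul_left k (by omega)
    rw [add_mul]
    omega

theorem run_setupProg (h0 : s.nat 0 = m) (h1 : s.nat 1 = n) (h2 : s.nat 2 = 0) :
    ∃ t s', Run V setupProg s t s' ∧ t ≤ 15 * (m + n + 2) ^ 32 + 26 ∧
      BaseVars m n ((m + n + 2) ^ 32) s'.nat ∧ s'.nat 6 = 0 ∧ s'.nat 7 = 0 ∧ s'.real = s.real := by
  set s1 := s.setNat 3 1 with hs1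
  set s2 := s1.setNat 4 (s1.nat 0 + s1.nat 3) with hs2
  set s3 := s2.setNat 5 (s2.nat 4 + s2.nat 1) with hs3
  set s4 := s3.setNat 5 (s3.nat 5 + s3.nat 3) with hs4
  have hc : CountersAre m n (m + n + 2) s.real s4 := by
    refine ⟨⟨?_, ?_, ?_, ?_, ?_, ?_⟩, rfl⟩ <;>
      simp [hs4, hs3, hs2, hs1, State.setNat, h0, h1, h2]
    omega
  obtain ⟨t, s5, hrun, ht, ⟨c0, c1, c2, c3, c4, c5⟩, hr⟩ :=
    run_squaresProg (V := V) (q := m + n + 2) (by omega) hc 5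
  refine ⟨_, _, .seq (.natConst s 3 1) (.seq (.natAdd s1 4 0 3) (.seq (.natAdd s2 5 4 1)
    (.seq (.natAdd s3 5 5 3) (.seq hrun (.seq (.natConst _ 6 0) (.natConst _ 7 0)))))), ?_,
    ⟨?_, ?_, ?_, ?_, ?_, ?_⟩, ?_, ?_, hr⟩
  · rw [show 2 ^ 5 = 32 from rfl] at ht
    generalize (m + n + 2) ^ 32 = Q at ht ⊢
    omega
  all_goals simp [State.setNat, c0, c1, c2, c3, c4, c5]

end

/-- The complete program. -/
def balanceProg : Prog := .seq setupProg (mainCom.compile 8)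

/-- With s = m + n + 2 ≥ 4, the constant is at most 4^12 ≤ s^12, and 12 + 1 + 19 = 32 = 2^5 is
reached by five squarings. -/
theorem loopBound_ge {m n : ℕ} (hn : 1 ≤ n) (hnm : n ≤ m) :
    3 * 2 ^ 22 * (m + 1) * n ^ 19 ≤ (m + n + 2) ^ 32 := by
  obtain ⟨s, hs⟩ : ∃ s, s = m + n + 2 := ⟨_, rfl⟩
  rw [← hs]
  have h4 : 4 ^ 12 ≤ s ^ 12 := Nat.pow_le_pow_left (by omega) 12
  have h5 : n ^ 19 ≤ s ^ 19 := Nat.pow_le_pow_left (by omega) 19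
  calc 3 * 2 ^ 22 * (m + 1) * n ^ 19 ≤ s ^ 12 * s * s ^ 19 :=
        Nat.mul_le_mul (Nat.mul_le_mul (le_trans (by norm_num) h4) (by omega)) h5
    _ = s ^ 32 := by rw [← pow_succ, ← pow_add]

theorem phaseBound_le {m n : ℕ} (hn : 1 ≤ n) (hnm : n ≤ m) :
    2592 * phaseBound m n + 17 ≤ 5300 * √(n * Real.log (2 * m / n)) := by
  have hn' : (1 : ℝ) ≤ n := by exact_mod_cast hn
  have hm' : (n : ℝ) ≤ m := by exact_mod_cast hnm
  have hl2 := Real.log_two_gt_d9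
  have h1 : Real.log 2 ≤ Real.log (2 * m / n) := by
    refine Real.log_le_log (by norm_num) ?_
    rw [le_div_iff₀ (by linarith)]
    linarith
  have h2 : Real.log (4 * m / n) = Real.log 2 + Real.log (2 * m / n) := by
    have hm0 : (0 : ℝ) < m := by linarith
    rw [← Real.log_mul (by norm_num) (by positivity)]
    congr 1
    ring
  have h3 : phaseBound m n ≤ 2 * √(n * Real.log (2 * m / n)) := by
    rw [phaseBound, ← Real.sqrt_sq (show (0 : ℝ) ≤ 2 by norm_num), ← Real.sqrt_mul (by norm_num)]
    refine Real.sqrt_le_sqrt ?_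
    rw [h2]
    nlinarith
  -- Since log 2 > 1/4, the additive 17 is at most 34 times the root, and 2 · 2592 + 34 ≤ 5300.
  have h4 : 1 / 2 ≤ √(n * Real.log (2 * m / n)) := by
    refine Real.le_sqrt_of_sq_le ?_
    nlinarith
  linarith

/-- The size bound holds for real matrices too, because no entry of A is ever written; it depends on
m + n only. -/
theorem exists_polynomial_balanceProg : ∃ p : Polynomial ℕ, ∀ (m n : ℕ), 1 ≤ n → n ≤ m →
    ∀ A : Matrix (Fin m) (Fin n) ℝ, (∀ i j, A i j ∈ Set.Icc (-1 : ℝ) 1) →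
      ∃ (t : ℕ) (s : State), Run (ratOfBitSize (p.eval (m + n))) balanceProg (input A) t s ∧
        t ≤ p.eval (m + n) ∧ (∀ j, output n s j = 1 ∨ output n s j = -1) ∧
        ‖A.mulVec (output n s)‖ ≤ 5300 * √(n * Real.log (2 * m / n)) := by
  obtain ⟨p₁, hp₁⟩ := PolyBounded.maxBits polyBounded_bitBound mainCom
  -- One polynomial in Q = (m + n + 2)^32 serves for both bounds: the time of the main program and
  -- of the setup, 15Q + 26, and the size 2P + 1 of numbers in `Written P`.
  refine ⟨(mainCom.cost + 15 * Polynomial.X + 26 + 2 * p₁ + 1).comp ((Polynomial.X + 2) ^ 32),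
    fun m n hn hnm A hA => ?_⟩
  obtain ⟨Q, hQ⟩ : ∃ Q, Q = (m + n + 2) ^ 32 := ⟨_, rfl⟩
  have hp : ((mainCom.cost + 15 * Polynomial.X + 26 + 2 * p₁ + 1).comp
      ((Polynomial.X + 2) ^ 32)).eval (m + n) =
      mainCom.cost.eval Q + 15 * Q + 26 + 2 * p₁.eval Q + 1 := by
    simp [Polynomial.eval_comp, hQ]
  rw [hp]
  obtain ⟨t₁, s₁, hrun₁, ht₁, hv, h6, h7, hr⟩ := run_setupProg
    (V := Written (p₁.eval Q)) (s := input A) (m := m) (n := n) rfl rfl rfl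
  have hmQ : m + n + 2 ≤ Q := hQ ▸ Nat.le_self_pow (by norm_num) _
  have hQ' := loopBound_ge hn hnm
  rw [← hQ] at ht₁ hv hQ'
  -- Counters 6 and 7 served as scratch space in the setup and were cleared, so all eight counters
  -- are at most Q.
  have hgood : GoodVars Q 8 s₁.nat := by
    refine ⟨by norm_num, hv.v2, hv.v3, fun i hi => ?_⟩
    have := hv.v0; have := hv.v1; have := hv.v2; have := hv.v3; have := hv.v4; have := hv.v5
    interval_cases i <;> omega
  obtain ⟨-, t₂, s₂, hrun₂, ht₂, hrep⟩ := Com.run_compile (fun i j => (input A).real 0 i j) Q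
    (p₁.eval Q) (mainCom_grows (Q := Q)) 8 s₁.nat s₁ 0 (fun a i j => by simp) mainCom_wf hgood
    ⟨fun _ _ => rfl, by rw [hr], fun a h0 _ i j => by rw [hr]; simp [input, h0.ne']⟩ (hp₁ Q)
  have hin : ∀ (i : Fin m) (j : Fin n), (input A).real 0 i j = A i j := fun i j => by
    simp [input]
  obtain ⟨hpm, hrow⟩ := mainCom_spec hn hnm hQ' hv
    (A := fun i j => (input A).real 0 i j) (fun i hi j hj => by
      have := hin ⟨i, hi⟩ ⟨j, hj⟩
      simp only at this ⊢
      rw [this]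
      exact hA _ _)
  have hout : ∀ j : Fin n, output n s₂ j =
      (mainCom.exec (fun i j => (input A).real 0 i j) 8 s₁.nat 0 1 0 j : ℤ) := fun j =>
    hrep.real 1 (by norm_num) (by norm_num) 0 j
  refine ⟨_, s₂, .seq (hrun₁.mono ?_) (hrun₂.mono ?_), by omega, fun j => ?_, ?_⟩
  · exact ratOfBitSize_mono (by omega)
  · exact ratOfBitSize_mono (by omega)
  · rw [hout]
    rcases hpm j j.2 with h | h <;> rw [h] <;> simp
  · refine le_trans ?_ (phaseBound_le hn hnm)
    have hpos : 0 ≤ phaseBound m n := Real.sqrt_nonneg _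
    refine (pi_norm_le_iff_of_nonneg (by positivity)).2 fun i => ?_
    have := hrow i i.2
    rw [Real.norm_eq_abs, Matrix.mulVec, dotProduct]
    rw [Finset.sum_range] at this
    simpa only [hin, hout] using this

end RealRAM

theorem mainTheorem3 :
    ∃ (K : ℝ) (c : RealRAM.Prog) (p : Polynomial ℕ),
      ∀ (m n : ℕ), 1 ≤ n → n ≤ m →
        ∀ A : Matrix (Fin m) (Fin n) ℝ, (∀ i j, A i j ∈ Set.Icc (-1 : ℝ) 1) →
          ∃ x : Fin n → ℝ, (∀ j, x j = 1 ∨ x j = -1) ∧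
            RealRAM.ComputesInTime c p A x ∧
            ‖A.mulVec x‖ ≤ K * Real.sqrt ((n : ℝ) * Real.log (2 * (m : ℝ) / (n : ℝ))) := by
  obtain ⟨p, hp⟩ := RealRAM.exists_polynomial_balanceProg
  refine ⟨5300, RealRAM.balanceProg, p, fun m n hn hnm A hA => ?_⟩
  obtain ⟨t, s, hrun, ht, hpm, hle⟩ := hp m n hn hnm A hA
  exact ⟨RealRAM.output n s, hpm, ⟨t, s, hrun.mono (Set.subset_univ _), rfl, ht, fun b _ =>
    hrun.mono (RealRAM.ratOfBitSize_mono (RealRAM.eval_le_eval_of_le p (Nat.le_add_right _ b)))⟩,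
    hle⟩
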